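/- **Theorem (Existence -- Compactness).** Let $W\in C^2(\mathbb R^N)$ have local minima $a^-,a^+$ with $W(a^\pm)=0$. For $\alpha\ge 0$ let $\{W\le\alpha\}^\pm$ denote the connected component of $\{u\in\mathbb R^N: W(u)\le\alpha\}$ containing $a^\pm$. Assume: (A1) There are $\alpha_0,w_0>0$ and $\gamma\ge 2$ such that for all $\alpha\in[0,\alpha_0]$ the sets $\{W\le\alpha\}^+$ and $\{W\le\alpha\}^-$ are convex and different from each other, and $W(u)\ge w_0|u-a^\pm|^\gamma$ for all $u\in\{W\le\alpha_0\}^\pm$. Assume also at least one of the following: (A2') For all $\alpha\in[0,\alpha_0]$, $\{W\le\alpha\}=\{W\le\alpha\}^+\cup\{W\le\alpha\}^-$. In this case put $K=\mathbb R^N$. (A2'') There are a convex set $\Omega\subseteq\mathbb R^N$ containing $a^\pm$ and a number $w_{\max}>\alpha_0$ such that $a^\pm$ are global minima of $W|_\Omega$, $\Omega\subseteq\{W\le w_{\max}\}$, $\partial\Omega\subseteq\{W=w_{\max}\}$, and $\Omega\cap\{W\le\alpha\}\subseteq\{W\le\alpha\}^+\cup\{W\le\alpha\}^-$ for all $\alpha\in[0,\alpha_0]$.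 In this case put $K=\overline\Omega$. (If both hold, the conclusions hold for either choice of $K$.) Let $U_{\rm aff}(x)=a^-$ for $x\le -1$, $U_{\rm aff}(x)=a^+$ for $x\ge 1$ and $U_{\rm aff}(x)=\frac{1-x}{2}a^-+\frac{1+x}{2}a^+$ for $|x|<1$. Let $W^{1;\gamma,2}_{\rm aff}$ be the set of all $U\in W^{1,1}_{\rm loc}(\mathbb R;\mathbb R^N)$ (identified with their continuous representatives) with $U-U_{\rm aff}\in L^\gamma$ and $U_x\in L^2$. Let $$E(U)=\int_{\mathbb R}\Big\{\tfrac12|U_x|^2+W(U)\Big\}\,dx\in(-\infty,+\infty],\qquad \mathcal A_K=\{U\in W^{1;\gamma,2}_{\rm aff}: U(x)\in K\text{ for all }x\in\mathbb R\},$$ $$M=|a^+-a^-|\max_{[a^-,a^+]}\sqrt{2W}.$$ A minimizing sequence is a sequence $(U_i)$ in $\mathcal A_K$ with $E(U_i)\to\inf_{\mathcal A_K}E$; a minimizer is a $U\in\mathcal A_K$ with $E(U)=\inf_{\mathcal A_K}E$. Say that $U$ satisfies $(*)$ if $$|U(x)-a^\pm|\le (M/w_0)^{1/\gamma}|x|^{-1/\gamma}\quad\text{and}\quad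 |U_x(x)|\le(2M)^{1/2}|x|^{-1/2}\qquad\text{for all }|x|\ge M/\alpha_0,$$ with $a^+$ for $x>0$ and $a^-$ for $x<0$. Then: 1. There is a minimizing sequence $(U_i)$ with $E(U_i)\ge 0$ for all $i$. 2. For every minimizing sequence $(U_i)$ with $E(U_i)\ge 0$ for all $i$, there are $x_i\in\mathbb R$ such that the translates $U_i(\cdot-x_i)$ have a subsequence that converges weakly in $W^{1;\gamma,2}_{\rm aff}$ (the differences with the limit converge weakly to $0$ in $L^\gamma$ and their derivatives weakly to $0$ in $L^2$) to a minimizer $U$ that is a $C^2$ solution of $$U_{xx}=\nabla W(U)\ \text{ on }\mathbb R,\qquad U(-\infty)=a^-,\quad U(+\infty)=a^+, \tag{P}$$ and satisfies $(*)$. 3. Every minimizer $U$ that solves (P) satisfies $E(U)\le M$, and some translate $U(\cdot-t)$, $t\in\mathbb R$, satisfies $(*)$. -/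

import Mathlib

open MeasureTheory Filter Topology Set
open scoped ContDiff

/-- The target space `ℝ^N` with the Euclidean norm. -/
abbrev Vec (N : ℕ) : Type := EuclideanSpace ℝ (Fin N)

noncomputable section

/-- The component of the sublevel set `{W ≤ α}` that contains the point `a`. -/
def sublevelComp {N : ℕ} (W : Vec N → ℝ) (α : ℝ) (a : Vec N) : Set (Vec N) :=
  connectedComponentIn {u | W u ≤ α} a

/-- (A1): for `0 ≤ α ≤ α₀` the components of `{W ≤ α}` around `a⁻` and `a⁺` are two different
convex sets, and `W` grows at least like `w₀ |u - a^±| ^ γ` on the components of `{W ≤ α₀}`. -/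
structure HypA1 {N : ℕ} (W : Vec N → ℝ) (am ap : Vec N) (α₀ w₀ γ : ℝ) : Prop where
  alpha_pos : 0 < α₀
  w_pos : 0 < w₀
  two_le_gamma : 2 ≤ γ
  convex_minus : ∀ α ∈ Icc 0 α₀, Convex ℝ (sublevelComp W α am)
  convex_plus : ∀ α ∈ Icc 0 α₀, Convex ℝ (sublevelComp W α ap)
  two_components : ∀ α ∈ Icc 0 α₀, sublevelComp W α am ≠ sublevelComp W α ap
  growth_minus : ∀ u ∈ sublevelComp W α₀ am, w₀ * ‖u - am‖ ^ γ ≤ W u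
  growth_plus : ∀ u ∈ sublevelComp W α₀ ap, w₀ * ‖u - ap‖ ^ γ ≤ W u

/-- (A2'), the coercive case: the sublevel sets `{W ≤ α}`, `0 ≤ α ≤ α₀`, have no components
other than the two around `a⁻` and `a⁺`. -/
def HypCoercive {N : ℕ} (W : Vec N → ℝ) (am ap : Vec N) (α₀ : ℝ) : Prop :=
  ∀ α ∈ Icc 0 α₀, {u | W u ≤ α} = sublevelComp W α ap ∪ sublevelComp W α am

/-- (A2''), the non-coercive case, with localization set `Ω` and level `wmax`. -/
structure HypLocalized {N : ℕ} (W : Vec N → ℝ) (am ap : Vec N) (α₀ : ℝ)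
    (Ω : Set (Vec N)) (wmax : ℝ) : Prop where
  convex : Convex ℝ Ω
  lt_wmax : α₀ < wmax
  minus_mem : am ∈ Ω
  plus_mem : ap ∈ Ω
  isMinOn_minus : IsMinOn W Ω am
  isMinOn_plus : IsMinOn W Ω ap
  subset_sublevel : Ω ⊆ {u | W u ≤ wmax}
  frontier_subset : frontier Ω ⊆ {u | W u = wmax}
  only_components : ∀ α ∈ Icc 0 α₀,
    Ω ∩ {u | W u ≤ α} ⊆ sublevelComp W α ap ∪ sublevelComp W α am

/-- The reference function: `a⁻` for `x ≤ -1`, `a⁺` for `x ≥ 1`, affine in between. -/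
def Uaff {N : ℕ} (am ap : Vec N) (x : ℝ) : Vec N :=
  if x ≤ -1 then am
  else if x < 1 then ((1 - x) / 2) • am + ((1 + x) / 2) • ap
  else ap

/-- `g` is a weak derivative of `U`, both being locally integrable; that is,
`U ∈ W^{1,1}_loc(ℝ; ℝ^N)` with `U_x = g`. -/
def IsWeakDeriv {N : ℕ} (U g : ℝ → Vec N) : Prop :=
  LocallyIntegrable U ∧ LocallyIntegrable g ∧
    ∀ φ : ℝ → ℝ, ContDiff ℝ ∞ φ → HasCompactSupport φ →
      ∫ x, deriv φ x • U x = -∫ x, φ x • g x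

open Classical in
/-- The weak derivative `U_x` (unique up to null sets when it exists). -/
def weakDeriv {N : ℕ} (U : ℝ → Vec N) : ℝ → Vec N :=
  if h : ∃ g, IsWeakDeriv U g then h.choose else 0

/-- The affine anisotropic Sobolev space `W^{1;p,q}_aff`, whose elements are identified with
their continuous representatives. -/
def affSobolev {N : ℕ} (am ap : Vec N) (p q : ℝ) : Set (ℝ → Vec N) :=
  {U | Continuous U ∧ (∃ g, IsWeakDeriv U g) ∧
    MemLp (fun x => U x - Uaff am ap x) (ENNReal.ofReal p) ∧
    MemLp (weakDeriv U) (ENNReal.ofReal q)}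

/-- The action `E(U) = ∫ (|U_x|² / 2 + W(U)) dx` as an extended real number: integral of the
positive part minus integral of the negative part. -/
def action {N : ℕ} (W : Vec N → ℝ) (U : ℝ → Vec N) : EReal :=
  ((∫⁻ x, ENNReal.ofReal (‖weakDeriv U x‖ ^ 2 / 2 + W (U x)) : ENNReal) : EReal) -
    ((∫⁻ x, ENNReal.ofReal (-(‖weakDeriv U x‖ ^ 2 / 2 + W (U x))) : ENNReal) : EReal)

/-- The competitors: elements of `W^{1;γ,2}_aff` with values in `K`. -/
def competitors {N : ℕ} (am ap : Vec N) (γ : ℝ) (K : Set (Vec N)) : Set (ℝ → Vec N) :=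
  {U | U ∈ affSobolev am ap γ 2 ∧ ∀ x, U x ∈ K}

/-- Minimizing sequences of the action among the competitors with values in `K`. -/
def IsMinimizingSeq {N : ℕ} (W : Vec N → ℝ) (am ap : Vec N) (γ : ℝ) (K : Set (Vec N))
    (U : ℕ → ℝ → Vec N) : Prop :=
  (∀ i, U i ∈ competitors am ap γ K) ∧
    Tendsto (fun i => action W (U i)) atTop (𝓝 (sInf (action W '' competitors am ap γ K)))

/-- Minimizers of the action among the competitors with values in `K`. -/
def IsMinimizer {N : ℕ} (W : Vec N → ℝ) (am ap : Vec N) (γ : ℝ) (K : Set (Vec N))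
    (U : ℝ → Vec N) : Prop :=
  U ∈ competitors am ap γ K ∧ action W U = sInf (action W '' competitors am ap γ K)

/-- The translate `U(· - s)`. -/
def shiftRight {N : ℕ} (U : ℝ → Vec N) (s : ℝ) : ℝ → Vec N := fun x => U (x - s)

/-- Weak convergence in `W^{1;γ,2}_aff`: `V i - U ⇀ 0` in `L^γ` and `(V i)_x - U_x ⇀ 0` in `L²`,
tested against `L^{γ/(γ-1)}` and `L²` respectively. -/
def TendstoWeakly {N : ℕ} (am ap : Vec N) (γ : ℝ) (V : ℕ → ℝ → Vec N) (U : ℝ → Vec N) : Prop :=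
  (∀ i, V i ∈ affSobolev am ap γ 2) ∧ U ∈ affSobolev am ap γ 2 ∧
  (∀ φ : ℝ → Vec N, MemLp φ (ENNReal.ofReal (γ / (γ - 1))) →
    Tendsto (fun i => ∫ x, inner ℝ (V i x - U x) (φ x)) atTop (𝓝 0)) ∧
  (∀ ψ : ℝ → Vec N, MemLp ψ 2 →
    Tendsto (fun i => ∫ x, inner ℝ (weakDeriv (V i) x - weakDeriv U x) (ψ x)) atTop (𝓝 0))

/-- `U` is a classical solution of `U_xx = ∇W(U)`, `U(±∞) = a^±`. -/
def IsConnection {N : ℕ} (W : Vec N → ℝ) (am ap : Vec N) (U : ℝ → Vec N) : Prop :=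
  ContDiff ℝ 2 U ∧ (∀ x, deriv (deriv U) x = gradient W (U x)) ∧
    Tendsto U atBot (𝓝 am) ∧ Tendsto U atTop (𝓝 ap)

/-- The constant `M = |a⁺ - a⁻| max_{[a⁻, a⁺]} √(2W)`. -/
def Mconst {N : ℕ} (W : Vec N → ℝ) (am ap : Vec N) : ℝ :=
  ‖ap - am‖ * sSup ((fun u => Real.sqrt (2 * W u)) '' segment ℝ am ap)

/-- The decay estimates for `|x| ≥ M / α₀`. -/
def HasDecay {N : ℕ} (W : Vec N → ℝ) (am ap : Vec N) (α₀ w₀ γ : ℝ) (U : ℝ → Vec N) : Prop :=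
  ∀ x : ℝ, Mconst W am ap / α₀ ≤ |x| →
    (0 < x → ‖U x - ap‖ ≤ (Mconst W am ap / w₀) ^ (1 / γ) * |x| ^ (-(1 / γ))) ∧
    (x < 0 → ‖U x - am‖ ≤ (Mconst W am ap / w₀) ^ (1 / γ) * |x| ^ (-(1 / γ))) ∧
    ‖deriv U x‖ ≤ (2 * Mconst W am ap) ^ (1 / 2 : ℝ) * |x| ^ (-(1 / 2) : ℝ)

end

/-! The proof is the direct method; the work lies in defeating translation invariance and in
handling a target set `K` whose boundary may be touched. Either form of (A2) gives a closed convex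
`K` on which `W ≥ 0`, whose points with `W ≤ α₀` lie in the two wells, and on whose frontier `W` is
maximal; `WellData` records exactly this, and nothing later distinguishes the two cases.

Bounds on the infimum `m`. Running along the segment at speed `max √(2W)` gives `m ≤ M`. Conversely
`|U_x|²/2 + W ≥ √(2W)|U_x|`, and every competitor must travel between the disjoint wells through `{W
> α₀}`, so `m > 0`.

Compactness. A point of a well at level `α` can be joined to its minimum by a unit-time ramp whose
cost tends to `0` with `α`. Hence each passage between the wells costs almost `m`, and a competitor
that returns to the first well costs almost `2m` (`two_mul_minEnergy_le`). With energy at most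
`3m/2` no return is possible. Translating the last visit to the well of `a⁻` to the origin yields
`|U - a^±|^γ ≤ C W(U)` on the half lines, with uniform `C` (`exists_center`), thus a uniform `L^γ`
bound. Derivatives then converge weakly in `L²` along a subsequence, the functions converge
pointwise, and convexity with Fatou's lemma makes the limit a minimizer (`exists_limit`).

Euler-Lagrange equation. Variations are projected back to `K`, which shortens derivatives. Where `U`
touches the frontier, the projection cannot raise `W`, so that set drops out of the first variation.
Comparison with the inward variation towards `a⁻`, which needs no projection, forces `∇W(U) = 0`
almost everywhere on the contact set, and the equation holds on all of `ℝ`.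

Decay. Projecting a minimizer on a half line to a convex sublevel component lowers the action, so
the wells are never left towards the centre and visited in order (`mem_minus_of_le`,
`notMem_minus_of_mem_plus`). Equipartition `|U_x|²/2 = W(U)` makes time spent in `{W ≥ α}` cost at
least `2α` per unit. As the total is at most `M`, the minimizer lies at level `α` at distance `M/α`
from a suitable centre; `α = M/|x|` and the growth of `W` give the rates. -/

/-! ### Primitives of locally integrable functions -/

/-- `U` is the primitive of the locally integrable function `g`. -/
structure HasIntDeriv {N : ℕ} (U g : ℝ → Vec N) : Prop where
  loc : LocallyIntegrable g
  eq : ∀ a b, U b - U a = ∫ x in a..b, g x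

lemma LocallyIntegrable.intervalIntegrable' {E : Type*} [NormedAddCommGroup E] {g : ℝ → E}
    (h : LocallyIntegrable g) (a b : ℝ) : IntervalIntegrable g volume a b :=
  intervalIntegrable_iff.mpr <|
    (h.integrableOn_isCompact isCompact_uIcc).mono_set uIoc_subset_uIcc

lemma absolutelyContinuousOnInterval_of_dist_le {X Y : Type*} [PseudoMetricSpace X]
    [PseudoMetricSpace Y] {f : ℝ → X} {h : ℝ → Y} {a b : ℝ}
    (hh : AbsolutelyContinuousOnInterval h a b) (hfh : ∀ x y, dist (f x) (f y) ≤ dist (h x) (h y)) :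
    AbsolutelyContinuousOnInterval f a b := by
  refine squeeze_zero (fun _ => Finset.sum_nonneg fun _ _ => dist_nonneg) (fun _ => ?_) hh
  exact Finset.sum_le_sum fun i _ => hfh _ _

lemma absolutelyContinuousOnInterval_of_dist_le_integral {X : Type*} [PseudoMetricSpace X]
    {f : ℝ → X} {h : ℝ → ℝ} (hh : LocallyIntegrable h)
    (hfh : ∀ x y, dist (f x) (f y) ≤ |∫ t in x..y, h t|) (a b : ℝ) :
    AbsolutelyContinuousOnInterval f a b := by
  have hI := LocallyIntegrable.intervalIntegrable' hh
  refine absolutelyContinuousOnInterval_of_dist_le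
    ((hI a b).absolutelyContinuousOnInterval_intervalIntegral (c := a) (by simp)) fun x y => ?_
  rw [dist_comm (∫ v in a..x, h v), Real.dist_eq, intervalIntegral.integral_interval_sub_left
    (hI a y) (hI a x)]
  exact hfh x y

lemma absolutelyContinuousOnInterval_integral {E : Type*} [NormedAddCommGroup E]
    [NormedSpace ℝ E] {g : ℝ → E} (hg : LocallyIntegrable g) (c a b : ℝ) :
    AbsolutelyContinuousOnInterval (fun x => ∫ t in c..x, g t) a b := by
  refine absolutelyContinuousOnInterval_of_dist_le_integral (h := fun x => ‖g x‖)
    (fun x => (hg x).norm) (fun x y => ?_) a b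
  have hI := LocallyIntegrable.intervalIntegrable' hg
  rw [dist_comm, dist_eq_norm, intervalIntegral.integral_interval_sub_left (hI c y) (hI c x)]
  exact intervalIntegral.norm_integral_le_abs_integral_norm

namespace HasIntDeriv

variable {N : ℕ} {U V g h : ℝ → Vec N}

lemma intervalIntegrable (hU : HasIntDeriv U g) (a b : ℝ) : IntervalIntegrable g volume a b :=
  LocallyIntegrable.intervalIntegrable' hU.loc a b

lemma absCont (hU : HasIntDeriv U g) (a b : ℝ) : AbsolutelyContinuousOnInterval U a b := by
  refine absolutelyContinuousOnInterval_of_dist_le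
    (absolutelyContinuousOnInterval_integral hU.loc a a b) fun x y => le_of_eq ?_
  rw [dist_eq_norm, dist_eq_norm, ← hU.eq, ← hU.eq]
  congr 1; abel

lemma continuous (hU : HasIntDeriv U g) : Continuous U := by
  have h : U = fun x => U 0 + ∫ t in (0 : ℝ)..x, g t := by
    funext x; rw [← hU.eq]; abel
  rw [h]
  exact continuous_const.add (intervalIntegral.continuous_primitive hU.intervalIntegrable 0)

lemma ae_hasDerivAt (hU : HasIntDeriv U g) : ∀ᵐ x, HasDerivAt U (g x) x := by
  filter_upwards [LocallyIntegrable.ae_hasDerivAt_integral hU.loc] with x hx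
  have h : U = fun x => U 0 + ∫ t in (0 : ℝ)..x, g t := by
    funext x; rw [← hU.eq]; abel
  rw [h]
  exact (hx 0).const_add _

lemma ae_unique (hU : HasIntDeriv U g) (hU' : HasIntDeriv U h) : g =ᵐ[volume] h := by
  filter_upwards [hU.ae_hasDerivAt, hU'.ae_hasDerivAt] with x h1 h2 using h1.unique h2

lemma congr_ae (hU : HasIntDeriv U g) (hgh : g =ᵐ[volume] h) : HasIntDeriv U h := by
  refine ⟨fun x => (hU.loc x).congr hgh, fun a b => ?_⟩
  rw [hU.eq]
  exact intervalIntegral.integral_congr_ae (hgh.mono fun x hx _ => hx)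

/-- An absolutely continuous function whose a.e. derivative is locally integrable is the primitive
of its derivative. -/
lemma of_absCont (hac : ∀ a b, AbsolutelyContinuousOnInterval U a b) (hg : LocallyIntegrable g)
    (hd : ∀ᵐ x, HasDerivAt U (g x) x) : HasIntDeriv U g := by
  refine ⟨hg, fun a b => ?_⟩
  have hI := LocallyIntegrable.intervalIntegrable' hg a b
  have hF := absolutelyContinuousOnInterval_integral hg a a b
  have hG := (hac a b).sub hF
  obtain ⟨C, hC⟩ := hG.const_of_ae_hasDerivAt_zero (by
    filter_upwards [hd, LocallyIntegrable.ae_hasDerivAt_integral hg] with x h1 h2 _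
    simpa using h1.sub (h2 a))
  have h1 := hC a (by simp)
  have h2 := hC b (by simp)
  simp only [Pi.sub_apply, intervalIntegral.integral_same, sub_zero] at h1 h2
  rw [h1, ← h2]; abel

lemma const (c : Vec N) : HasIntDeriv (fun _ => c) (fun _ => 0) :=
  ⟨locallyIntegrable_const 0, by simp⟩

lemma add (hU : HasIntDeriv U g) (hV : HasIntDeriv V h) :
    HasIntDeriv (fun x => U x + V x) (fun x => g x + h x) := by
  refine ⟨hU.loc.add hV.loc, fun a b => ?_⟩
  rw [intervalIntegral.integral_add (hU.intervalIntegrable a b) (hV.intervalIntegrable a b),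
    ← hU.eq, ← hV.eq]
  abel

lemma const_smul (c : ℝ) (hU : HasIntDeriv U g) :
    HasIntDeriv (fun x => c • U x) (fun x => c • g x) := by
  refine ⟨hU.loc.smul c, fun a b => ?_⟩
  rw [intervalIntegral.integral_smul, ← hU.eq, smul_sub]

lemma sub (hU : HasIntDeriv U g) (hV : HasIntDeriv V h) :
    HasIntDeriv (fun x => U x - V x) (fun x => g x - h x) := by
  simpa [sub_eq_add_neg] using hU.add (hV.const_smul (-1))

lemma of_contDiff {f f' : ℝ → Vec N} (hf : ∀ x, HasDerivAt f (f' x) x) (hf' : Continuous f') :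
    HasIntDeriv f f' :=
  ⟨hf'.locallyIntegrable, fun a b =>
    (intervalIntegral.integral_eq_sub_of_hasDerivAt (fun x _ => hf x)
      (hf'.intervalIntegrable a b)).symm⟩

/-- Products of absolutely continuous functions are absolutely continuous, so the almost everywhere
product rule integrates. -/
lemma smul {η η' : ℝ → ℝ} (hη : ∀ x, HasDerivAt η (η' x) x) (hη' : Continuous η')
    (hU : HasIntDeriv U g) :
    HasIntDeriv (fun x => η x • U x) (fun x => η' x • U x + η x • g x) := by
  have hηc : Continuous η := continuous_iff_continuousAt.2 fun x => (hη x).continuousAt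
  refine of_absCont (fun a b => ?_) ?_ ?_
  · have h1 : AbsolutelyContinuousOnInterval η a b := by
      refine absolutelyContinuousOnInterval_of_dist_le
        (absolutelyContinuousOnInterval_integral hη'.locallyIntegrable a a b)
        fun x y => le_of_eq ?_
      rw [intervalIntegral.integral_eq_sub_of_hasDerivAt (fun x _ => hη x)
        (hη'.intervalIntegrable a x), intervalIntegral.integral_eq_sub_of_hasDerivAt
        (fun x _ => hη x) (hη'.intervalIntegrable a y)]
      simp
    exact h1.smul (hU.absCont a b)
  · refine (hη'.smul hU.continuous).locallyIntegrable.add ?_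
    exact locallyIntegrableOn_univ.1 <| (locallyIntegrableOn_univ.2 hU.loc).continuousOn_smul
      isOpen_univ.isLocallyClosed hηc.continuousOn
  · filter_upwards [hU.ae_hasDerivAt] with x hx
    rw [add_comm]
    exact (hη x).smul hx

/-- The product rule for `φ • U` is integrated over an interval whose endpoints lie outside the
support of `φ`, so that the boundary terms vanish. -/
lemma isWeakDeriv (hU : HasIntDeriv U g) : IsWeakDeriv U g := by
  refine ⟨hU.continuous.locallyIntegrable, hU.loc, fun φ hφ hc => ?_⟩
  have hd : ∀ x, HasDerivAt φ (deriv φ x) x := fun x =>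
    ((hφ.differentiable (by simp)) x).hasDerivAt
  have hc' : Continuous (deriv φ) := hφ.continuous_deriv (by simp)
  have hs := hU.smul hd hc'
  obtain ⟨R, hR⟩ := hc.isCompact.isBounded.subset_closedBall 0
  have hz : ∀ x, x ∉ Ioc (-(R+1)) (R+1) → φ x = 0 ∧ deriv φ x = 0 := by
    intro x hx
    have : x ∉ tsupport φ := fun h => hx (by
      have := hR h
      simp only [Metric.mem_closedBall, dist_zero_right, Real.norm_eq_abs] at this
      constructor <;> linarith [abs_le.1 this])
    exact ⟨image_eq_zero_of_notMem_tsupport this,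
      image_eq_zero_of_notMem_tsupport fun h => this (tsupport_deriv_subset h)⟩
  have hb := hs.eq (-(R+1)) (R+1)
  have h1 : φ (-(R+1)) = 0 := (hz _ (by simp)).1
  have h2 : φ (R+1) = 0 := by
    have : (R + 1) ∉ tsupport φ := fun h => by
      have := hR h
      simp only [Metric.mem_closedBall, dist_zero_right, Real.norm_eq_abs] at this
      linarith [abs_le.1 this]
    exact image_eq_zero_of_notMem_tsupport this
  simp only [h1, h2, zero_smul, sub_zero] at hb
  have hi1 : Integrable (fun x => deriv φ x • U x) :=
    (hc'.smul hU.continuous).integrable_of_hasCompactSupport (hc.deriv.smul_right)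
  have hi2 : Integrable (fun x => φ x • g x) :=
    hU.loc.integrable_smul_left_of_hasCompactSupport hφ.continuous hc
  rw [intervalIntegral.integral_eq_integral_of_support_subset, integral_add hi1 hi2] at hb
  · exact eq_neg_of_add_eq_zero_left hb.symm
  · intro x hx
    by_contra h
    exact hx (by simp [hz x h])

lemma comp_sub_right (hU : HasIntDeriv U g) (s : ℝ) :
    HasIntDeriv (fun x => U (x - s)) (fun x => g (x - s)) := by
  refine ⟨?_, fun a b => ?_⟩
  · intro x
    obtain ⟨t, ht, hI⟩ := hU.loc (x - s)
    refine ⟨(fun y => y - s) ⁻¹' t, (continuous_sub_right s).continuousAt.preimage_mem_nhds ht, ?_⟩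
    exact ((measurePreserving_sub_right volume s).integrableOn_comp_preimage
      (measurableEmbedding_subRight s)).2 hI
  · rw [intervalIntegral.integral_comp_sub_right, ← hU.eq]

lemma comp_neg (hU : HasIntDeriv U g) :
    HasIntDeriv (fun x => U (-x)) (fun x => -g (-x)) := by
  refine ⟨LocallyIntegrable.neg ?_, fun a b => ?_⟩
  · intro x
    obtain ⟨t, ht, hI⟩ := hU.loc (-x)
    refine ⟨(fun y => -y) ⁻¹' t, continuous_neg.continuousAt.preimage_mem_nhds ht, ?_⟩
    exact ((Measure.measurePreserving_neg volume).integrableOn_comp_preimage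
      (MeasurableEquiv.neg ℝ).measurableEmbedding).2 hI
  · rw [intervalIntegral.integral_neg, intervalIntegral.integral_comp_neg, ← hU.eq]; abel

lemma glue (hU : HasIntDeriv U g) (hV : HasIntDeriv V h) {c : ℝ} (hc : U c = V c) :
    HasIntDeriv (fun x => if x ≤ c then U x else V x) (fun x => if x ≤ c then g x else h x) := by
  have hloc : LocallyIntegrable (fun x => if x ≤ c then g x else h x) := by
    have h1 : (fun x => if x ≤ c then g x else h x)
        = fun x => (Iic c).indicator g x + (Ioi c).indicator h x := by
      funext x
      by_cases hx : x ≤ c <;> simp [hx, indicator]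
    rw [h1]
    exact (hU.loc.indicator measurableSet_Iic).add (hV.loc.indicator measurableSet_Ioi)
  refine ⟨hloc, ?_⟩
  have key : ∀ b, (if b ≤ c then U b else V b) - U c
      = ∫ x in c..b, (if x ≤ c then g x else h x) := by
    intro b
    split_ifs with hb
    · rw [hU.eq, intervalIntegral.integral_congr_ae]
      refine ae_of_all _ fun x hx => ?_
      rw [uIoc_of_ge hb] at hx
      simp [hx.2]
    · rw [hc, hV.eq, intervalIntegral.integral_congr_ae]
      refine ae_of_all _ fun x hx => ?_
      rw [uIoc_of_le (not_le.1 hb).le] at hx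
      simp [hx.1]
  intro a b
  have hI := LocallyIntegrable.intervalIntegrable' hloc
  rw [← intervalIntegral.integral_interval_sub_left (hI c b) (hI c a), ← key, ← key]
  abel

lemma norm_sub_le (hU : HasIntDeriv U g) {a b : ℝ} (hab : a ≤ b) :
    ‖U b - U a‖ ≤ ∫ x in a..b, ‖g x‖ := by
  rw [hU.eq]; exact intervalIntegral.norm_integral_le_integral_norm hab

end HasIntDeriv

/-! ### Weak derivatives and absolutely continuous representatives -/

/-- A smooth compactly supported function with vanishing integral has a smooth compactly supported
primitive. -/
lemma exists_primitive_hasCompactSupport {θ : ℝ → ℝ} (hθ : ContDiff ℝ ∞ θ)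
    (hc : HasCompactSupport θ) (h0 : ∫ x, θ x = 0) :
    ∃ φ : ℝ → ℝ, ContDiff ℝ ∞ φ ∧ HasCompactSupport φ ∧ deriv φ = θ := by
  obtain ⟨R, hR⟩ := hc.isCompact.isBounded.subset_closedBall 0
  have hz : ∀ x, x ∉ Icc (-R) R → θ x = 0 := by
    intro x hx
    refine image_eq_zero_of_notMem_tsupport fun h => hx ?_
    have := hR h
    rwa [Real.closedBall_eq_Icc, zero_sub, zero_add] at this
  have hd : ∀ x, HasDerivAt (fun x => ∫ t in (-R-1)..x, θ t) (θ x) x := fun x =>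
    (hθ.continuous.integral_hasStrictDerivAt _ x).hasDerivAt
  have hd' : deriv (fun x => ∫ t in (-R-1)..x, θ t) = θ := funext fun x => (hd x).deriv
  refine ⟨fun x => ∫ t in (-R-1)..x, θ t, ?_, ?_, hd'⟩
  · rw [contDiff_infty_iff_deriv, hd']
    exact ⟨fun x => (hd x).differentiableAt, hθ⟩
  · refine HasCompactSupport.intro (K := Icc (-R-1) (R+1)) isCompact_Icc fun x hx => ?_
    by_cases hx' : x < -R - 1
    · rw [intervalIntegral.integral_symm, intervalIntegral.integral_zero_ae, neg_zero]
      refine ae_of_all _ fun t ht => hz t fun h => ?_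
      rw [uIoc_of_le hx'.le] at ht
      linarith [ht.2, h.1]
    · have hx2 : R + 1 < x := by
        by_contra h
        exact hx ⟨not_lt.1 hx', not_lt.1 h⟩
      rw [intervalIntegral.integral_eq_integral_of_support_subset, h0]
      intro t ht
      by_contra h
      refine ht (hz t fun h' => h ⟨by linarith [h'.1], by linarith [h'.2]⟩)

/-- Du Bois-Reymond: a locally integrable function with vanishing weak derivative is constant. -/
lemma ae_eq_const_of_integral_deriv_smul_eq_zero {E : Type*} [NormedAddCommGroup E]
    [NormedSpace ℝ E] [CompleteSpace E] {D : ℝ → E} (hD : LocallyIntegrable D)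
    (h : ∀ φ : ℝ → ℝ, ContDiff ℝ ∞ φ → HasCompactSupport φ → ∫ x, deriv φ x • D x = 0) :
    ∃ c, ∀ᵐ x, D x = c := by
  let b : ContDiffBump (0 : ℝ) := ⟨1, 2, one_pos, one_lt_two⟩
  set ρ : ℝ → ℝ := b.normed volume
  have hρ : ContDiff ℝ ∞ ρ := b.contDiff_normed
  have hρc : HasCompactSupport ρ := b.hasCompactSupport_normed
  have hρ1 : ∫ x, ρ x = 1 := b.integral_normed
  refine ⟨∫ x, ρ x • D x, ?_⟩
  have key : ∀ᵐ x, D x - (∫ x, ρ x • D x) = 0 := by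
    refine ae_eq_zero_of_integral_contDiff_smul_eq_zero (hD.sub (locallyIntegrable_const _)) ?_
    intro ψ hψ hψc
    have hiψ : Integrable ψ := hψ.continuous.integrable_of_hasCompactSupport hψc
    have hiρ : Integrable ρ := hρ.continuous.integrable_of_hasCompactSupport hρc
    have hiψD := hD.integrable_smul_left_of_hasCompactSupport hψ.continuous hψc
    have hiρD := hD.integrable_smul_left_of_hasCompactSupport hρ.continuous hρc
    -- Subtracting the right multiple of the unit-mass bump `ρ` gives `ψ` mean zero, hence turns it
    -- into a derivative of a test function.
    obtain ⟨φ, hφ, hφc, hφd⟩ := exists_primitive_hasCompactSupport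
      (θ := fun x => ψ x - (∫ y, ψ y) * ρ x) (hψ.sub (contDiff_const.mul hρ))
      (hψc.sub (hρc.mul_left)) (by
        rw [integral_sub hiψ (hiρ.const_mul _), integral_const_mul, hρ1, mul_one, sub_self])
    have h1 := h φ hφ hφc
    rw [hφd] at h1
    simp only [sub_smul, mul_smul] at h1
    rw [integral_sub hiψD (hiρD.fun_smul _), integral_smul] at h1
    simp only [smul_sub]
    rw [integral_sub hiψD (hiψ.smul_const _), integral_smul_const]
    exact h1
  filter_upwards [key] with x hx using sub_eq_zero.1 hx

namespace IsWeakDeriv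

variable {N : ℕ} {U g : ℝ → Vec N}

/-- A function with a weak derivative has an absolutely continuous representative. -/
lemma exists_hasIntDeriv (h : IsWeakDeriv U g) : ∃ G, HasIntDeriv G g ∧ U =ᵐ[volume] G := by
  obtain ⟨hU, hg, hw⟩ := h
  have hF : HasIntDeriv (fun x => ∫ t in (0 : ℝ)..x, g t) g :=
    ⟨hg, fun a b => intervalIntegral.integral_interval_sub_left
      (LocallyIntegrable.intervalIntegrable' hg _ _) (LocallyIntegrable.intervalIntegrable' hg _ _)⟩
  obtain ⟨c, hc⟩ := ae_eq_const_of_integral_deriv_smul_eq_zero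
    (hU.sub hF.continuous.locallyIntegrable) (fun φ hφ hφc => by
      have hc' : Continuous (deriv φ) := hφ.continuous_deriv (by simp)
      simp only [Pi.sub_apply, smul_sub]
      rw [integral_sub (hU.integrable_smul_left_of_hasCompactSupport hc' hφc.deriv)
        (hF.continuous.locallyIntegrable.integrable_smul_left_of_hasCompactSupport hc' hφc.deriv),
        hw φ hφ hφc, hF.isWeakDeriv.2.2 φ hφ hφc, sub_self])
  refine ⟨fun x => (∫ t in (0 : ℝ)..x, g t) + c, ?_, ?_⟩
  · simpa using hF.add (HasIntDeriv.const c)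
  · filter_upwards [hc] with x hx
    rw [← hx, Pi.sub_apply]; abel

lemma hasIntDeriv (h : IsWeakDeriv U g) (hU : Continuous U) : HasIntDeriv U g := by
  obtain ⟨G, hG, hUG⟩ := h.exists_hasIntDeriv
  rwa [(hU.ae_eq_iff_eq volume hG.continuous).1 hUG]

end IsWeakDeriv

namespace HasIntDeriv

variable {N : ℕ} {U V g h : ℝ → Vec N}

lemma weakDeriv_spec (hU : HasIntDeriv U g) : HasIntDeriv U (weakDeriv U) := by
  have hex : ∃ g, IsWeakDeriv U g := ⟨g, hU.isWeakDeriv⟩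
  have : weakDeriv U = hex.choose := by rw [weakDeriv, dif_pos hex]
  rw [this]
  exact hex.choose_spec.hasIntDeriv hU.continuous

lemma weakDeriv_ae (hU : HasIntDeriv U g) : weakDeriv U =ᵐ[volume] g :=
  hU.weakDeriv_spec.ae_unique hU

lemma norm_le_of_hasDerivAt {u v : Vec N} {x : ℝ} (hu : HasDerivAt U u x) (hv : HasDerivAt V v x)
    (hVU : ∀ x y, ‖V x - V y‖ ≤ ‖U x - U y‖) : ‖v‖ ≤ ‖u‖ := by
  rw [hasDerivAt_iff_tendsto_slope] at hu hv
  refine le_of_tendsto_of_tendsto' hv.norm hu.norm fun y => ?_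
  simp only [slope, vsub_eq_sub, norm_smul]
  exact mul_le_mul_of_nonneg_left (hVU _ _) (norm_nonneg _)

/-- A function whose increments are dominated by those of `U` is weakly differentiable, with
derivative dominated by that of `U`. -/
lemma of_norm_sub_le (hU : HasIntDeriv U g) (hVU : ∀ x y, ‖V x - V y‖ ≤ ‖U x - U y‖) :
    ∃ v, HasIntDeriv V v ∧ ∀ᵐ x, ‖v x‖ ≤ ‖g x‖ := by
  have hac : ∀ a b, AbsolutelyContinuousOnInterval V a b := fun a b =>
    absolutelyContinuousOnInterval_of_dist_le (hU.absCont a b)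
      (fun x y => by simpa only [dist_eq_norm] using hVU x y)
  have hdiff : ∀ᵐ x, DifferentiableAt ℝ V x := by
    -- Lebesgue's differentiation theorem is applied to each coordinate on each interval `[-n, n]`;
    -- countably many null sets are discarded.
    have h1 : ∀ᵐ x, ∀ j : Fin N, ∀ n : ℕ, x ∈ uIcc (-(n : ℝ)) n →
        DifferentiableAt ℝ (fun x => V x j) x := by
      rw [ae_all_iff]; intro j
      rw [ae_all_iff]; intro n
      refine AbsolutelyContinuousOnInterval.ae_differentiableAt
        (absolutelyContinuousOnInterval_of_dist_le (hac _ _) fun x y => ?_)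
      rw [dist_eq_norm, dist_eq_norm]
      exact PiLp.norm_apply_le (V x - V y) j
    filter_upwards [h1] with x hx
    rw [differentiableAt_euclidean]
    intro j
    obtain ⟨n, hn⟩ := exists_nat_ge |x|
    refine hx j n ?_
    rw [uIcc_of_le (by linarith [abs_nonneg x])]
    exact abs_le.1 hn
  have hle : ∀ᵐ x, ‖deriv V x‖ ≤ ‖g x‖ := by
    filter_upwards [hdiff, hU.ae_hasDerivAt] with x h1 h2
    exact norm_le_of_hasDerivAt h2 h1.hasDerivAt hVU
  have hVc : Continuous V := by
    refine continuous_iff_continuousAt.2 fun x => ?_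
    rw [ContinuousAt, tendsto_iff_norm_sub_tendsto_zero]
    exact squeeze_zero (fun _ => norm_nonneg _) (fun y => hVU y x)
      (tendsto_iff_norm_sub_tendsto_zero.1 hU.continuous.continuousAt)
  have hloc : LocallyIntegrable (deriv V) :=
    hU.loc.mono (aestronglyMeasurable_deriv V volume) hle
  exact ⟨deriv V, of_absCont hac hloc (hdiff.mono fun x hx => hx.hasDerivAt), hle⟩

end HasIntDeriv

/-! ### Projection onto closed convex sets -/

/-- Existence and properties of the metric projection onto a closed convex set. -/
lemma exists_convex_projection {F : Type*} [NormedAddCommGroup F] [InnerProductSpace ℝ F]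
    [CompleteSpace F] {K : Set F} (hne : K.Nonempty) (hcl : IsClosed K) (hK : Convex ℝ K) :
    ∃ P : F → F, (∀ u, P u ∈ K) ∧ (∀ u ∈ K, P u = u) ∧ (∀ u v, ‖P u - P v‖ ≤ ‖u - v‖) ∧
      ∀ u ∉ K, P u ∈ frontier K := by
  have h1 : ∀ u : F, ∃ v ∈ K, ∀ w ∈ K, inner ℝ (u - v) (w - v) ≤ 0 := by
    intro u
    obtain ⟨v, hv, hv'⟩ := exists_norm_eq_iInf_of_complete_convex hne hcl.isComplete hK u
    exact ⟨v, hv, (norm_eq_iInf_iff_real_inner_le_zero hK hv).1 hv'⟩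
  choose P hP hPi using h1
  refine ⟨P, hP, fun u hu => ?_, fun u v => ?_, fun u hu => ?_⟩
  · have := hPi u u hu
    rw [real_inner_self_eq_norm_sq] at this
    have h0 : ‖u - P u‖ = 0 := by nlinarith [norm_nonneg (u - P u)]
    exact (sub_eq_zero.1 (norm_eq_zero.1 h0)).symm
  · have h1 := hPi u (P v) (hP v)
    have h2 := hPi v (P u) (hP u)
    -- Adding the obtuse-angle inequalities at `P u` and `P v` gives firm nonexpansiveness;
    -- Cauchy-Schwarz then yields the Lipschitz bound.
    have h3 : inner ℝ (u - v) (P u - P v) ≥ ‖P u - P v‖ ^ 2 := by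
      have e : inner ℝ (u - v) (P u - P v) = ‖P u - P v‖ ^ 2
          - inner ℝ (u - P u) (P v - P u) - inner ℝ (v - P v) (P u - P v) := by
        rw [← real_inner_self_eq_norm_sq, ← neg_sub (P u) (P v), inner_neg_right,
          sub_neg_eq_add, ← inner_add_left, ← inner_sub_left]
        congr 1; abel
      linarith
    have h4 := real_inner_le_norm (u - v) (P u - P v)
    rcases (norm_nonneg (P u - P v)).eq_or_lt with h | h
    · rw [← h]; exact norm_nonneg _
    · nlinarith
  · rw [hcl.frontier_eq]
    refine ⟨hP u, fun hint => hu ?_⟩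
    -- Were `P u` interior, a small step from it towards `u` would stay in `K` and violate the
    -- obtuse-angle inequality.
    have hc : Tendsto (fun t : ℝ => P u + t • (u - P u)) (𝓝[>] 0) (𝓝 (P u)) := by
      have : Continuous fun t : ℝ => P u + t • (u - P u) := by fun_prop
      have := this.tendsto 0
      simp only [zero_smul, add_zero] at this
      exact this.mono_left nhdsWithin_le_nhds
    obtain ⟨t, ht, ht0⟩ := ((hc.eventually (isOpen_interior.mem_nhds hint)).and
      self_mem_nhdsWithin).exists
    have := hPi u _ (interior_subset ht)
    rw [add_sub_cancel_left, inner_smul_right, real_inner_self_eq_norm_sq] at this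
    have h0 : ‖u - P u‖ = 0 := by
      have : ‖u - P u‖ ^ 2 ≤ 0 := by
        by_contra h
        have := mul_pos (show (0 : ℝ) < t from ht0) (not_le.1 h)
        linarith
      nlinarith [norm_nonneg (u - P u)]
    rw [sub_eq_zero.1 (norm_eq_zero.1 h0)]
    exact hP u

/-! ### Components of sublevel sets -/

section sublevelComp

variable {N : ℕ} {W : Vec N → ℝ} {α β : ℝ} {a b u : Vec N}

lemma sublevelComp_le (h : u ∈ sublevelComp W α a) : W u ≤ α :=
  connectedComponentIn_subset {u | W u ≤ α} a h

lemma self_mem_sublevelComp (h : W a ≤ α) : a ∈ sublevelComp W α a :=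
  mem_connectedComponentIn h

/-- The closure of a connected set is connected and remains in the closed set `{W ≤ α}`, so
maximality of the component absorbs it. -/
lemma isClosed_sublevelComp (hW : Continuous W) (α : ℝ) (a : Vec N) :
    IsClosed (sublevelComp W α a) := by
  refine isClosed_of_closure_subset fun u hu => ?_
  obtain ⟨v, hv⟩ := closure_nonempty_iff.1 ⟨u, hu⟩
  have ha : a ∈ sublevelComp W α a :=
    mem_connectedComponentIn (connectedComponentIn_nonempty_iff.1 ⟨v, hv⟩)
  refine (isPreconnected_connectedComponentIn.closure).subset_connectedComponentIn
    (subset_closure ha) ?_ hu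
  exact closure_minimal (connectedComponentIn_subset _ _) (isClosed_le hW continuous_const)

lemma sublevelComp_mono (h : α ≤ β) : sublevelComp W α a ⊆ sublevelComp W β a :=
  connectedComponentIn_mono a fun _ hu => le_trans hu h

lemma disjoint_sublevelComp (h : sublevelComp W α a ≠ sublevelComp W α b) :
    Disjoint (sublevelComp W α a) (sublevelComp W α b) := by
  rw [Set.disjoint_left]
  intro u hu hv
  exact h ((connectedComponentIn_eq hu).trans (connectedComponentIn_eq hv).symm)

/-- A small ball around `a` is connected and lies in `{W < α}`. -/
lemma sublevelComp_mem_nhds (hW : Continuous W) (h : W a < α) : sublevelComp W α a ∈ 𝓝 a := by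
  obtain ⟨r, hr, hball⟩ := Metric.mem_nhds_iff.1 (hW.continuousAt.eventually_lt
    (continuousAt_const (y := α)) h)
  refine mem_of_superset (Metric.ball_mem_nhds a hr) ?_
  exact (convex_ball a r).isPreconnected.subset_connectedComponentIn (Metric.mem_ball_self hr)
    fun u hu => (show W u < α from hball hu).le

end sublevelComp

/-! ### Common form of the two cases of (A2) -/

/-- The standing assumptions on the potential `W` and the target set `K`: the two wells satisfy
(A1), `W ≥ 0` on the closed convex set `K`, the low sublevel sets of `W` in `K` consist of the two
wells, and `W` is maximal (relative to `K`) on the boundary of `K`. -/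
structure WellData {N : ℕ} (W : Vec N → ℝ) (am ap : Vec N) (α₀ w₀ γ : ℝ) (K : Set (Vec N)) :
    Prop where
  smooth : ContDiff ℝ 2 W
  zero_minus : W am = 0
  zero_plus : W ap = 0
  hypA1 : HypA1 W am ap α₀ w₀ γ
  closed : IsClosed K
  convex : Convex ℝ K
  nonneg : ∀ u ∈ K, 0 ≤ W u
  minus_subset : sublevelComp W α₀ am ⊆ interior K
  plus_subset : sublevelComp W α₀ ap ⊆ interior K
  cover : ∀ α ∈ Icc 0 α₀, ∀ u ∈ K, W u ≤ α → u ∈ sublevelComp W α am ∨ u ∈ sublevelComp W α ap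
  frontier_max : ∀ u ∈ frontier K, ∀ v ∈ K, W v ≤ W u

lemma HypA1.swap {N : ℕ} {W : Vec N → ℝ} {am ap : Vec N} {α₀ w₀ γ : ℝ}
    (h : HypA1 W am ap α₀ w₀ γ) : HypA1 W ap am α₀ w₀ γ :=
  ⟨h.alpha_pos, h.w_pos, h.two_le_gamma, h.convex_plus, h.convex_minus,
    fun α hα => (h.two_components α hα).symm, h.growth_plus, h.growth_minus⟩

namespace WellData

variable {N : ℕ} {W : Vec N → ℝ} {am ap : Vec N} {α₀ w₀ γ : ℝ} {K : Set (Vec N)}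

lemma swap (h : WellData W am ap α₀ w₀ γ K) : WellData W ap am α₀ w₀ γ K :=
  ⟨h.smooth, h.zero_plus, h.zero_minus, h.hypA1.swap, h.closed, h.convex, h.nonneg,
    h.plus_subset, h.minus_subset, fun α hα u hu hw => (h.cover α hα u hu hw).symm,
    h.frontier_max⟩

/-- A negative value of `W` would occur in one of the components at level `0`, where the growth
bound forces `W ≥ 0`. The frontier conditions are vacuous for the whole space. -/
lemma of_coercive (hW : ContDiff ℝ 2 W) (hm : W am = 0) (hp : W ap = 0)
    (hA1 : HypA1 W am ap α₀ w₀ γ) (h : HypCoercive W am ap α₀) :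
    WellData W am ap α₀ w₀ γ univ := by
  have hcov : ∀ α ∈ Icc 0 α₀, ∀ u ∈ (univ : Set (Vec N)), W u ≤ α →
      u ∈ sublevelComp W α am ∨ u ∈ sublevelComp W α ap := by
    intro α hα u _ hu
    have : u ∈ {u | W u ≤ α} := hu
    rw [h α hα] at this
    exact this.symm
  refine ⟨hW, hm, hp, hA1, isClosed_univ, convex_univ, fun u _ => ?_, by simp, by simp, hcov,
    by simp⟩
  by_contra hneg
  have hα : (0 : ℝ) ∈ Icc 0 α₀ := ⟨le_rfl, hA1.alpha_pos.le⟩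
  rcases hcov 0 hα u trivial (not_le.1 hneg).le with h1 | h1
  · exact hneg (le_trans (mul_nonneg hA1.w_pos.le (by positivity))
      (hA1.growth_minus u (sublevelComp_mono hα.2 h1)))
  · exact hneg (le_trans (mul_nonneg hA1.w_pos.le (by positivity))
      (hA1.growth_plus u (sublevelComp_mono hα.2 h1)))

/-- On the frontier of `Ω` the potential equals `wmax > α₀`. Hence a component at level `α₀` that
meets `Ω` cannot cross this frontier, and the points added by taking the closure lie above all
relevant levels. -/
lemma of_localized (hW : ContDiff ℝ 2 W) (hm : W am = 0) (hp : W ap = 0)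
    (hA1 : HypA1 W am ap α₀ w₀ γ) {Ω : Set (Vec N)} {wmax : ℝ}
    (h : HypLocalized W am ap α₀ Ω wmax) : WellData W am ap α₀ w₀ γ (closure Ω) := by
  have hle : ∀ v ∈ closure Ω, W v ≤ wmax := fun v hv =>
    closure_minimal h.subset_sublevel (isClosed_le hW.continuous continuous_const) hv
  have hfr : ∀ u ∈ frontier Ω, W u = wmax := fun u hu => h.frontier_subset hu
  have hint : ∀ a ∈ Ω, sublevelComp W α₀ a ⊆ interior (closure Ω) := by
    intro a ha
    have hwm : W a ≤ α₀ ∨ sublevelComp W α₀ a = ∅ := by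
      by_cases hwa : W a ≤ α₀
      · exact Or.inl hwa
      · exact Or.inr (connectedComponentIn_eq_empty hwa)
    rcases hwm with hwa | hemp
    swap
    · simp [hemp]
    have hdisj : ∀ u ∈ sublevelComp W α₀ a, u ∉ frontier Ω := fun u hu hu' => by
      have h1 := sublevelComp_le hu
      rw [hfr u hu'] at h1
      exact absurd h.lt_wmax (not_lt.2 h1)
    have hsub : sublevelComp W α₀ a ⊆ interior Ω :=
      isPreconnected_connectedComponentIn.subset_left_of_subset_union isOpen_interior
        isClosed_closure.isOpen_compl
        (disjoint_compl_right.mono_left (interior_subset.trans subset_closure))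
        (fun u hu => by
          by_cases hi : u ∈ interior Ω
          · exact Or.inl hi
          · exact Or.inr fun hc => hdisj u hu ⟨hc, hi⟩)
        ⟨a, self_mem_sublevelComp hwa, by
          by_contra hi
          exact hdisj a (self_mem_sublevelComp hwa) ⟨subset_closure ha, hi⟩⟩
    exact hsub.trans (interior_mono subset_closure)
  refine ⟨hW, hm, hp, hA1, isClosed_closure, h.convex.closure, fun u hu => ?_, hint am h.minus_mem,
    hint ap h.plus_mem, fun α hα u hu hu' => ?_, fun u hu v hv => ?_⟩
  · refine closure_minimal (fun v hv => ?_) (isClosed_le continuous_const hW.continuous) hu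
    have := h.isMinOn_minus hv
    simpa [hm] using this
  · by_cases huΩ : u ∈ Ω
    · exact (h.only_components α hα ⟨huΩ, hu'⟩).symm
    · have := hfr u ⟨hu, fun hi => huΩ (interior_subset hi)⟩
      exact absurd h.lt_wmax (not_lt.2 (by linarith [hα.2]))
  · rw [hfr u (frontier_closure_subset hu)]
    exact hle v hv

variable (D : WellData W am ap α₀ w₀ γ K)
include D

lemma continuous : Continuous W := D.smooth.continuous

lemma alpha_pos : 0 < α₀ := D.hypA1.alpha_pos

lemma gamma_pos : 0 < γ := by linarith [D.hypA1.two_le_gamma]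

lemma minus_mem {α : ℝ} (hα : 0 ≤ α) : am ∈ sublevelComp W α am :=
  self_mem_sublevelComp (by rw [D.zero_minus]; exact hα)

lemma minus_subset_K {α : ℝ} (hα : α ≤ α₀) : sublevelComp W α am ⊆ K :=
  (sublevelComp_mono hα).trans (D.minus_subset.trans interior_subset)

lemma minus_mem_K : am ∈ K := D.minus_subset_K D.alpha_pos.le (D.minus_mem le_rfl)

lemma disjoint {α : ℝ} (hα : α ∈ Icc 0 α₀) :
    Disjoint (sublevelComp W α am) (sublevelComp W α ap) :=
  disjoint_sublevelComp (D.hypA1.two_components α hα)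

lemma notMem_plus {α : ℝ} (hα : α ∈ Icc 0 α₀) {u : Vec N} (hu : u ∈ sublevelComp W α am) :
    u ∉ sublevelComp W α ap :=
  fun h => Set.disjoint_left.1 (D.disjoint hα) hu h

lemma norm_sub_minus_le {α : ℝ} (hα : α ∈ Icc 0 α₀) {u : Vec N}
    (hu : u ∈ sublevelComp W α am) : ‖u - am‖ ≤ (α / w₀) ^ (1 / γ) := by
  have h1 := D.hypA1.growth_minus u (sublevelComp_mono hα.2 hu)
  have h2 := sublevelComp_le hu
  have h3 : ‖u - am‖ ^ γ ≤ α / w₀ := by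
    rw [le_div_iff₀ D.hypA1.w_pos]; linarith
  rw [one_div, Real.le_rpow_inv_iff_of_pos (norm_nonneg _)
    (div_nonneg hα.1 D.hypA1.w_pos.le) D.gamma_pos]
  exact h3

lemma ne : am ≠ ap := by
  intro h
  refine D.hypA1.two_components 0 ⟨le_rfl, D.alpha_pos.le⟩ ?_
  rw [h]

lemma isCompact_minus {α : ℝ} (hα : α ∈ Icc 0 α₀) : IsCompact (sublevelComp W α am) := by
  refine Metric.isCompact_of_isClosed_isBounded (isClosed_sublevelComp D.continuous _ _) ?_
  refine (Metric.isBounded_closedBall (x := am) (r := (α / w₀) ^ (1 / γ))).subset fun u hu => ?_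
  rw [Metric.mem_closedBall, dist_eq_norm]
  exact D.norm_sub_minus_le hα hu

end WellData

/-! ### Action on subsets, competitors and the infimum -/

/-- The action of `U` on the set `s`, where `g` plays the role of the derivative of `U`. -/
noncomputable def energyOn {N : ℕ} (W : Vec N → ℝ) (U g : ℝ → Vec N) (s : Set ℝ) : ENNReal :=
  ∫⁻ x in s, ENNReal.ofReal (‖g x‖ ^ 2 / 2 + W (U x))

/-- `U` is an admissible competitor with derivative `g`. -/
structure IsCompetitor {N : ℕ} (am ap : Vec N) (γ : ℝ) (K : Set (Vec N)) (U g : ℝ → Vec N) :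
    Prop where
  deriv : HasIntDeriv U g
  memLp_sub : MemLp (fun x => U x - Uaff am ap x) (ENNReal.ofReal γ)
  memLp_deriv : MemLp g 2
  mem : ∀ x, U x ∈ K

/-- The infimum of the action among competitors. -/
noncomputable def minEnergy {N : ℕ} (W : Vec N → ℝ) (am ap : Vec N) (γ : ℝ) (K : Set (Vec N)) :
    ENNReal :=
  sInf {e | ∃ U g, IsCompetitor am ap γ K U g ∧ e = energyOn W U g univ}

section energyOn

variable {N : ℕ} {W : Vec N → ℝ} {U V g v : ℝ → Vec N} {s t : Set ℝ}

lemma energyOn_congr (hs : MeasurableSet s) (hU : EqOn U V s) (hg : EqOn g v s) :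
    energyOn W U g s = energyOn W V v s :=
  setLIntegral_congr_fun hs fun x hx => by simp only [hU hx, hg hx]

lemma energyOn_congr_ae (hg : g =ᵐ[volume] v) : energyOn W U g s = energyOn W U v s :=
  lintegral_congr_ae (ae_restrict_of_ae (hg.mono fun x hx => by simp only [hx]))

lemma energyOn_mono (h : s ⊆ t) : energyOn W U g s ≤ energyOn W U g t :=
  lintegral_mono_set h

lemma energyOn_union (ht : MeasurableSet t) (hst : Disjoint s t) :
    energyOn W U g (s ∪ t) = energyOn W U g s + energyOn W U g t :=
  lintegral_union ht hst

lemma energyOn_univ_eq_two (x : ℝ) :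
    energyOn W U g univ = energyOn W U g (Iic x) + energyOn W U g (Ioi x) := by
  rw [← Iic_union_Ioi (a := x), energyOn_union measurableSet_Ioi (Iic_disjoint_Ioi le_rfl)]

lemma energyOn_univ_eq_three {x y : ℝ} (hxy : x ≤ y) :
    energyOn W U g univ
      = energyOn W U g (Iic x) + energyOn W U g (Ioc x y) + energyOn W U g (Ioi y) := by
  rw [energyOn_univ_eq_two x, ← Ioc_union_Ioi_eq_Ioi hxy, energyOn_union measurableSet_Ioi
    (disjoint_left.2 fun z hz hz' => absurd hz.2 (not_le.2 hz')), add_assoc]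

/-- Tailored to ramps, which rest in a well with zero energy density outside an interval `I` of
known length. -/
lemma energyOn_le_of_forall {I : Set ℝ} (hs : MeasurableSet s) (hI : MeasurableSet I) {c : ℝ}
    (h0 : ∀ x ∈ s, x ∉ I → g x = 0 ∧ W (U x) = 0)
    (hc : ∀ x ∈ s, x ∈ I → ‖g x‖ ^ 2 / 2 + W (U x) ≤ c) :
    energyOn W U g s ≤ ENNReal.ofReal c * volume I := by
  have h1 : energyOn W U g s ≤ ∫⁻ x in s, I.indicator (fun _ => ENNReal.ofReal c) x := by
    refine setLIntegral_mono' hs fun x hx => ?_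
    by_cases hxI : x ∈ I
    · rw [indicator_of_mem hxI]; exact ENNReal.ofReal_le_ofReal (hc x hx hxI)
    · obtain ⟨h2, h3⟩ := h0 x hx hxI
      simp [h2, h3]
  refine h1.trans ((setLIntegral_le_lintegral _ _).trans ?_)
  rw [lintegral_indicator hI, setLIntegral_const]

lemma energyOn_comp_sub_right (c : ℝ) :
    energyOn W (fun x => U (x - c)) (fun x => g (x - c)) univ = energyOn W U g univ := by
  simp only [energyOn, Measure.restrict_univ]
  exact lintegral_sub_right_eq_self (fun x => ENNReal.ofReal (‖g x‖ ^ 2 / 2 + W (U x))) c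

lemma energyOn_comp_neg (s : Set ℝ) :
    energyOn W (fun x => U (-x)) (fun x => -g (-x)) s = energyOn W U g (Neg.neg ⁻¹' s) := by
  simp only [energyOn, norm_neg]
  have h := (Measure.measurePreserving_neg (volume : Measure ℝ)).setLIntegral_comp_preimage_emb
    (MeasurableEquiv.neg ℝ).measurableEmbedding
    (fun x => ENNReal.ofReal (‖g (-x)‖ ^ 2 / 2 + W (U (-x)))) s
  rw [← h]
  simp

end energyOn

/-! ### Affine ramps and the reference function -/

section ramp

variable {N : ℕ}

/-- The ramp from `a` to `b`, affine on `[0, L]`. -/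
noncomputable def ramp (a b : Vec N) (L x : ℝ) : Vec N :=
  if x ≤ 0 then a else if x ≤ L then a + (x / L) • (b - a) else b

/-- The derivative of the ramp from `a` to `b`. -/
noncomputable def rampDeriv (a b : Vec N) (L x : ℝ) : Vec N :=
  if x ≤ 0 then 0 else if x ≤ L then (1 / L) • (b - a) else 0

variable {a b : Vec N} {L x : ℝ}

lemma ramp_of_nonpos (hx : x ≤ 0) : ramp a b L x = a := if_pos hx

lemma ramp_of_ge (hL : 0 < L) (hx : L ≤ x) : ramp a b L x = b := by
  rw [ramp, if_neg (by linarith)]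
  split_ifs with h
  · rw [le_antisymm h hx, div_self hL.ne', one_smul]; abel
  · rfl

lemma rampDeriv_of_nonpos (hx : x ≤ 0) : rampDeriv a b L x = 0 := if_pos hx

lemma rampDeriv_of_gt (hL : 0 < L) (hx : L < x) : rampDeriv a b L x = 0 := by
  rw [rampDeriv, if_neg (by linarith), if_neg (by linarith)]

lemma ramp_mem_segment (hL : 0 < L) (x : ℝ) : ramp a b L x ∈ segment ℝ a b := by
  rw [ramp]
  split_ifs with h h'
  · exact left_mem_segment ℝ a b
  · rw [segment_eq_image']
    exact ⟨x / L, ⟨by rw [le_div_iff₀ hL]; linarith, by rwa [div_le_one hL]⟩, rfl⟩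
  · exact right_mem_segment ℝ a b

lemma norm_rampDeriv_le (hL : 0 < L) (x : ℝ) : ‖rampDeriv a b L x‖ ≤ ‖b - a‖ / L := by
  rw [rampDeriv]
  split_ifs with h h'
  · simp; positivity
  · rw [norm_smul, Real.norm_of_nonneg (by positivity)]
    exact le_of_eq (by ring)
  · simp; positivity

lemma hasIntDeriv_ramp (a b : Vec N) (hL : 0 < L) :
    HasIntDeriv (ramp a b L) (rampDeriv a b L) := by
  have h1 : HasIntDeriv (fun x : ℝ => a + (x / L) • (b - a)) (fun _ => (1 / L) • (b - a)) := by
    refine HasIntDeriv.of_contDiff (fun x => ?_) continuous_const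
    exact (((hasDerivAt_id x).div_const L).smul_const (b - a)).const_add a
  have h2 := h1.glue (HasIntDeriv.const b) (c := L) (by
    rw [div_self hL.ne', one_smul]; abel)
  exact (HasIntDeriv.const a).glue h2 (c := 0) (by simp [hL.le])

lemma memLp_rampDeriv (a b : Vec N) (L : ℝ) (p : ENNReal) : MemLp (rampDeriv a b L) p := by
  have : rampDeriv a b L = (Ioc 0 L).indicator fun _ => (1 / L) • (b - a) := by
    funext x
    by_cases h : x ≤ 0
    · simp [rampDeriv, h, indicator, not_lt.2 h]
    · by_cases h' : x ≤ L <;> simp [rampDeriv, h, h', indicator, not_le.1 h]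
  rw [this]
  exact memLp_indicator_const p measurableSet_Ioc _ (Or.inr (by simp))

lemma Uaff_eq_ramp (am ap : Vec N) : Uaff am ap = fun x => ramp am ap 2 (x + 1) := by
  funext x
  rw [Uaff, ramp]
  by_cases h1 : x ≤ -1
  · rw [if_pos h1, if_pos (by linarith)]
  · rw [if_neg h1, if_neg (show ¬x + 1 ≤ 0 by linarith)]
    by_cases h2 : x < 1
    · rw [if_pos h2, if_pos (by linarith)]
      module
    · rw [if_neg h2]
      split_ifs with h3
      · have : x = 1 := by linarith
        rw [this]; norm_num
      · rfl

lemma continuous_Uaff (am ap : Vec N) : Continuous (Uaff am ap) := by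
  rw [Uaff_eq_ramp]
  exact (hasIntDeriv_ramp am ap two_pos).continuous.comp (continuous_add_const 1)

lemma Uaff_neg (am ap : Vec N) (x : ℝ) : Uaff ap am (-x) = Uaff am ap x := by
  simp only [Uaff]
  split_ifs <;> first | linarith | rfl | skip
  module

lemma Uaff_of_le (am ap : Vec N) (h : x ≤ -1) : Uaff am ap x = am := if_pos h

lemma Uaff_of_ge (am ap : Vec N) (h : 1 ≤ x) : Uaff am ap x = ap := by
  rw [Uaff, if_neg (by linarith), if_neg (by linarith)]

lemma memLp_sub_Uaff {am ap : Vec N} {V : ℝ → Vec N} (hV : Continuous V) (R : ℝ)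
    (hm : ∀ x ≤ -R, V x = am) (hp : ∀ x, R ≤ x → V x = ap) (p : ENNReal) :
    MemLp (fun x => V x - Uaff am ap x) p := by
  refine (hV.sub (continuous_Uaff am ap)).memLp_of_hasCompactSupport ?_
  refine HasCompactSupport.intro (K := Icc (-(max R 1)) (max R 1)) isCompact_Icc fun x hx => ?_
  by_cases h : x < -(max R 1)
  · rw [Pi.sub_apply, hm x (by linarith [le_max_left R 1]), Uaff_of_le am ap (by linarith [le_max_right R 1]),
      sub_self]
  · have h' : max R 1 < x := by
      by_contra h'
      exact hx ⟨not_lt.1 h, not_lt.1 h'⟩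
    rw [Pi.sub_apply, hp x (by linarith [le_max_left R 1]), Uaff_of_ge am ap (by linarith [le_max_right R 1]),
      sub_self]

end ramp

/-! ### Symmetries of the problem and the extended real action -/

namespace IsCompetitor

variable {N : ℕ} {W : Vec N → ℝ} {am ap : Vec N} {γ : ℝ} {K : Set (Vec N)} {U g : ℝ → Vec N}

lemma mem_competitors (h : IsCompetitor am ap γ K U g) : U ∈ competitors am ap γ K := by
  refine ⟨⟨h.deriv.continuous, ⟨g, h.deriv.isWeakDeriv⟩, h.memLp_sub, ?_⟩, h.mem⟩
  rw [ENNReal.ofReal_ofNat]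
  exact (memLp_congr_ae h.deriv.weakDeriv_ae).2 h.memLp_deriv

lemma of_mem (h : U ∈ competitors am ap γ K) : IsCompetitor am ap γ K U (weakDeriv U) := by
  obtain ⟨⟨hc, ⟨g, hg⟩, hp, hd⟩, hK⟩ := h
  rw [ENNReal.ofReal_ofNat] at hd
  exact ⟨(hg.hasIntDeriv hc).weakDeriv_spec, hp, hd, hK⟩

/-- Since `W ≥ 0` on `K`, the negative part in the definition of the action vanishes. -/
lemma action_eq (h : IsCompetitor am ap γ K U g) (hW : ∀ u ∈ K, 0 ≤ W u) :
    action W U = (energyOn W U g univ : EReal) := by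
  have h1 : ∫⁻ x, ENNReal.ofReal (-(‖weakDeriv U x‖ ^ 2 / 2 + W (U x))) = 0 := by
    rw [← lintegral_zero (μ := (volume : Measure ℝ))]
    congr 1
    funext x
    rw [ENNReal.ofReal_eq_zero]
    have := hW _ (h.mem x)
    have := sq_nonneg ‖weakDeriv U x‖
    linarith
  rw [action, h1, EReal.coe_ennreal_zero, sub_zero, energyOn_congr_ae h.deriv.weakDeriv_ae.symm,
    energyOn, Measure.restrict_univ]

lemma minEnergy_le (h : IsCompetitor am ap γ K U g) :
    minEnergy W am ap γ K ≤ energyOn W U g univ := sInf_le ⟨U, g, h, rfl⟩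

lemma comp_neg (h : IsCompetitor am ap γ K U g) :
    IsCompetitor ap am γ K (fun x => U (-x)) (fun x => -g (-x)) := by
  refine ⟨h.deriv.comp_neg, ?_, ?_, fun x => h.mem _⟩
  · have := h.memLp_sub.comp_measurePreserving (Measure.measurePreserving_neg volume)
    refine (memLp_congr_ae (ae_of_all _ fun x => ?_)).1 this
    simp only [Function.comp]
    rw [Uaff_neg ap am x]
  · exact (h.memLp_deriv.comp_measurePreserving (Measure.measurePreserving_neg volume)).neg

/-- The reference function is not translation invariant, but it differs from its translates by a
function of compact support. -/
lemma comp_sub_right (h : IsCompetitor am ap γ K U g) (s : ℝ) :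
    IsCompetitor am ap γ K (fun x => U (x - s)) (fun x => g (x - s)) := by
  refine ⟨h.deriv.comp_sub_right s, ?_, ?_, fun x => h.mem _⟩
  · have h1 := h.memLp_sub.comp_measurePreserving (measurePreserving_sub_right volume s)
    have h2 := memLp_sub_Uaff (am := am) (ap := ap) (V := fun x => Uaff am ap (x - s))
      ((continuous_Uaff am ap).comp (continuous_sub_right s)) (1 + |s|)
      (fun x hx => Uaff_of_le am ap (by linarith [neg_abs_le s]))
      (fun x hx => Uaff_of_ge am ap (by linarith [le_abs_self s])) (ENNReal.ofReal γ)
    refine (memLp_congr_ae (ae_of_all _ fun x => ?_)).1 (h1.add h2)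
    simp [Function.comp]
  · exact h.memLp_deriv.comp_measurePreserving (measurePreserving_sub_right volume s)

end IsCompetitor

section minEnergy

variable {N : ℕ} {W : Vec N → ℝ} {am ap : Vec N} {γ : ℝ} {K : Set (Vec N)}

/-- Allows all later estimates to be made in `ENNReal`: every action is nonnegative, so the infimum
in `EReal` is a coercion. -/
lemma sInf_action_eq (hW : ∀ u ∈ K, 0 ≤ W u) :
    sInf (action W '' competitors am ap γ K) = (minEnergy W am ap γ K : EReal) := by
  apply le_antisymm
  · have h0 : (0 : EReal) ≤ sInf (action W '' competitors am ap γ K) := by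
      refine le_sInf ?_
      rintro _ ⟨U, hU, rfl⟩
      rw [(IsCompetitor.of_mem hU).action_eq hW]
      exact EReal.coe_ennreal_nonneg _
    rw [← EReal.coe_toENNReal h0, EReal.coe_ennreal_le_coe_ennreal_iff]
    refine le_sInf ?_
    rintro _ ⟨U, g, hU, rfl⟩
    rw [← EReal.coe_ennreal_le_coe_ennreal_iff, EReal.coe_toENNReal h0, ← hU.action_eq hW]
    exact sInf_le ⟨U, hU.mem_competitors, rfl⟩
  · refine le_sInf ?_
    rintro _ ⟨U, hU, rfl⟩
    rw [(IsCompetitor.of_mem hU).action_eq hW, EReal.coe_ennreal_le_coe_ennreal_iff]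
    exact (IsCompetitor.of_mem hU).minEnergy_le

lemma minEnergy_swap_le : minEnergy W ap am γ K ≤ minEnergy W am ap γ K := by
  refine le_sInf ?_
  rintro _ ⟨U, g, hU, rfl⟩
  refine hU.comp_neg.minEnergy_le.trans (le_of_eq ?_)
  rw [energyOn_comp_neg, preimage_univ]

lemma minEnergy_swap : minEnergy W ap am γ K = minEnergy W am ap γ K :=
  le_antisymm minEnergy_swap_le minEnergy_swap_le

lemma isCompetitor_ramp (hK : Convex ℝ K) (ham : am ∈ K) (hap : ap ∈ K) {L : ℝ} (hL : 0 < L) :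
    IsCompetitor am ap γ K (ramp am ap L) (rampDeriv am ap L) :=
  ⟨hasIntDeriv_ramp am ap hL,
    memLp_sub_Uaff (hasIntDeriv_ramp am ap hL).continuous L
      (fun x hx => ramp_of_nonpos (by linarith)) (fun x hx => ramp_of_ge hL hx) _,
    memLp_rampDeriv am ap L 2, fun x => hK.segment_subset ham hap (ramp_mem_segment hL x)⟩

end minEnergy

/-! ### Upper bound for the infimum -/

namespace WellData

variable {N : ℕ} {W : Vec N → ℝ} {am ap : Vec N} {α₀ w₀ γ : ℝ} {K : Set (Vec N)}
variable (D : WellData W am ap α₀ w₀ γ K)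
include D

/-- The infimum of the action is bounded by the cost of the optimally parametrized segment. -/
lemma minEnergy_le_Mconst :
    minEnergy W am ap γ K ≤ ENNReal.ofReal (Mconst W am ap) := by
  set S := (fun u => Real.sqrt (2 * W u)) '' segment ℝ am ap with hS
  have hcont : Continuous fun u => Real.sqrt (2 * W u) :=
    Real.continuous_sqrt.comp (continuous_const.mul D.continuous)
  have hcomp : IsCompact (segment ℝ am ap) := by
    rw [segment_eq_image_lineMap]
    exact isCompact_Icc.image AffineMap.lineMap_continuous
  have hbdd : BddAbove S := (hcomp.image hcont).bddAbove
  have hsegK : segment ℝ am ap ⊆ K :=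
    D.convex.segment_subset D.minus_mem_K D.swap.minus_mem_K
  have hle : ∀ u ∈ segment ℝ am ap, Real.sqrt (2 * W u) ≤ sSup S := fun u hu =>
    le_csSup hbdd ⟨u, hu, rfl⟩
  -- If `W ≤ 0` on the whole segment, this connected set would join the two components at level `0`.
  have hpos : 0 < sSup S := by
    have h0 : ∃ u ∈ segment ℝ am ap, 0 < W u := by
      by_contra hcon
      push Not at hcon
      have hsub : segment ℝ am ap ⊆ sublevelComp W 0 am :=
        (convex_segment am ap).isPreconnected.subset_connectedComponentIn
          (left_mem_segment ℝ am ap) hcon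
      exact D.notMem_plus ⟨le_rfl, D.alpha_pos.le⟩ (hsub (right_mem_segment ℝ am ap))
        (D.swap.minus_mem le_rfl)
    obtain ⟨u, hu, hu0⟩ := h0
    exact (Real.sqrt_pos.2 (by linarith)).trans_le (hle u hu)
  have hd : 0 < ‖ap - am‖ := norm_pos_iff.2 (sub_ne_zero.2 D.ne.symm)
  -- This length makes the speed equal to `sSup S`, so kinetic and potential density are both at
  -- most `sSup S ^ 2 / 2`.
  set L := ‖ap - am‖ / sSup S with hLdef
  have hL : 0 < L := div_pos hd hpos
  refine ((isCompetitor_ramp D.convex D.minus_mem_K D.swap.minus_mem_K hL).minEnergy_le).trans ?_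
  have h1 := energyOn_le_of_forall (W := W) (U := ramp am ap L) (g := rampDeriv am ap L)
    (s := univ) (I := Ioc 0 L) (c := sSup S ^ 2) MeasurableSet.univ measurableSet_Ioc
    (fun x _ hx => by
      by_cases h : x ≤ 0
      · rw [rampDeriv_of_nonpos h, ramp_of_nonpos h]; exact ⟨rfl, D.zero_minus⟩
      · have h' : L < x := by
          by_contra h'
          exact hx ⟨not_le.1 h, not_lt.1 h'⟩
        rw [rampDeriv_of_gt hL h', ramp_of_ge hL h'.le]; exact ⟨rfl, D.zero_plus⟩)
    (fun x _ _ => by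
      have h2 : ‖rampDeriv am ap L x‖ ≤ sSup S := by
        refine (norm_rampDeriv_le hL x).trans (le_of_eq ?_)
        rw [hLdef]; field_simp
      have h3 := hle _ (ramp_mem_segment hL x)
      have h4 := D.nonneg _ (hsegK (ramp_mem_segment hL x))
      have h5 := (Real.sqrt_le_left hpos.le).1 h3
      have h6 := pow_le_pow_left₀ (norm_nonneg _) h2 2
      linarith)
  refine h1.trans (le_of_eq ?_)
  rw [Real.volume_Ioc, ← ENNReal.ofReal_mul (by positivity), Mconst, ← hS, hLdef]
  congr 1
  field_simp
  ring

end WellData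

/-! ### Exit times, transition costs and limits at infinity -/

lemma exists_last_mem {X : Type*} [TopologicalSpace X] {f : ℝ → X} (hf : Continuous f) {A : Set X}
    (hA : IsClosed A) {x y : ℝ} (hxy : x ≤ y) (hx : f x ∈ A) :
    ∃ s ∈ Icc x y, f s ∈ A ∧ ∀ r ∈ Ioc s y, f r ∉ A := by
  obtain ⟨s, ⟨hs, hsA⟩, hub⟩ := (isCompact_Icc.inter_right (hA.preimage hf)).exists_isGreatest
    (s := Icc x y ∩ f ⁻¹' A) ⟨x, ⟨le_rfl, hxy⟩, hx⟩
  exact ⟨s, hs, hsA, fun r hr hrA =>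
    absurd (hub ⟨⟨hs.1.trans hr.1.le, hr.2⟩, hrA⟩) (not_le.2 hr.1)⟩

lemma exists_first_mem {X : Type*} [TopologicalSpace X] {f : ℝ → X} (hf : Continuous f) {A : Set X}
    (hA : IsClosed A) {x y : ℝ} (hxy : x ≤ y) (hy : f y ∈ A) :
    ∃ s ∈ Icc x y, f s ∈ A ∧ ∀ r ∈ Ico x s, f r ∉ A := by
  obtain ⟨s, ⟨hs, hsA⟩, hlb⟩ := (isCompact_Icc.inter_right (hA.preimage hf)).exists_isLeast
    (s := Icc x y ∩ f ⁻¹' A) ⟨y, ⟨hxy, le_rfl⟩, hy⟩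
  exact ⟨s, hs, hsA, fun r hr hrA =>
    absurd (hlb ⟨⟨hr.1, hr.2.le.trans hs.2⟩, hrA⟩) (not_le.2 hr.2)⟩

namespace HasIntDeriv

variable {N : ℕ} {W : Vec N → ℝ} {U g : ℝ → Vec N}

/-- Young's inequality form of the Hölder continuity of functions with square integrable
derivative. -/
lemma norm_sub_le_add (hU : HasIntDeriv U g) (hg : MemLp g 2) {l x y : ℝ} (hl : 0 < l)
    (hxy : x ≤ y) : ‖U y - U x‖ ≤ l * (y - x) + (∫ t, ‖g t‖ ^ 2) / (4 * l) := by
  have hi : Integrable fun t => ‖g t‖ ^ 2 := (memLp_two_iff_integrable_sq_norm hg.1).1 hg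
  refine (hU.norm_sub_le hxy).trans ?_
  have h1 : ∫ t in x..y, ‖g t‖ ≤ ∫ t in x..y, (l + ‖g t‖ ^ 2 / (4 * l)) := by
    refine intervalIntegral.integral_mono hxy (hU.intervalIntegrable x y).norm
      (intervalIntegrable_const.add (hi.div_const _).intervalIntegrable) fun t => ?_
    have : 0 ≤ (2 * l - ‖g t‖) ^ 2 / (4 * l) := by positivity
    have e : (2 * l - ‖g t‖) ^ 2 / (4 * l) = l + ‖g t‖ ^ 2 / (4 * l) - ‖g t‖ := by
      field_simp; ring
    linarith
  refine h1.trans ?_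
  rw [intervalIntegral.integral_add intervalIntegrable_const (hi.div_const _).intervalIntegrable,
    intervalIntegral.integral_const, intervalIntegral.integral_div, smul_eq_mul,
    intervalIntegral.integral_of_le hxy, mul_comm (y - x)]
  have h2 := setIntegral_le_integral (s := Ioc x y) hi (ae_of_all _ fun t => sq_nonneg _)
  gcongr

/-- Pointwise `√(2α)|g| ≤ |g|²/2 + α`, and the length of a path bounds its displacement. -/
lemma ofReal_mul_norm_sub_le (hU : HasIntDeriv U g) {α x y : ℝ} (hα : 0 ≤ α) (hxy : x ≤ y)
    (hW : ∀ s ∈ Ioo x y, α ≤ W (U s)) :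
    ENNReal.ofReal (Real.sqrt (2 * α) * ‖U y - U x‖) ≤ energyOn W U g (Ioc x y) := by
  have hi : IntegrableOn (fun t => Real.sqrt (2 * α) * ‖g t‖) (Ioo x y) :=
    (((hU.intervalIntegrable x y).1.mono_set Ioo_subset_Ioc_self).norm).const_mul _
  calc ENNReal.ofReal (Real.sqrt (2 * α) * ‖U y - U x‖)
      ≤ ENNReal.ofReal (∫ t in Ioo x y, Real.sqrt (2 * α) * ‖g t‖) := by
        refine ENNReal.ofReal_le_ofReal ?_
        rw [integral_const_mul, ← integral_Ioc_eq_integral_Ioo,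
          ← intervalIntegral.integral_of_le hxy]
        exact mul_le_mul_of_nonneg_left (hU.norm_sub_le hxy) (Real.sqrt_nonneg _)
    _ = ∫⁻ t in Ioo x y, ENNReal.ofReal (Real.sqrt (2 * α) * ‖g t‖) :=
        ofReal_integral_eq_lintegral_ofReal hi (ae_of_all _ fun t => by positivity)
    _ ≤ ∫⁻ t in Ioo x y, ENNReal.ofReal (‖g t‖ ^ 2 / 2 + W (U t)) := by
        refine setLIntegral_mono' measurableSet_Ioo fun t ht => ENNReal.ofReal_le_ofReal ?_
        have h1 := hW t ht
        have h2 := Real.sq_sqrt (show 0 ≤ 2 * α by linarith)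
        nlinarith [sq_nonneg (Real.sqrt (2 * α) - ‖g t‖)]
    _ ≤ energyOn W U g (Ioc x y) := energyOn_mono Ioo_subset_Ioc_self

end HasIntDeriv

namespace IsCompetitor

variable {N : ℕ} {W : Vec N → ℝ} {am ap : Vec N} {γ : ℝ} {K : Set (Vec N)} {U g : ℝ → Vec N}

/-- Excursions of size `ε` at arbitrarily late times would each last at least a fixed time `δ` at
size `ε / 2`, because `g` is square integrable. Membership in `L^γ` leaves no such room near
infinity. -/
lemma tendsto_atTop (h : IsCompetitor am ap γ K U g) (hγ : 0 < γ) : Tendsto U atTop (𝓝 ap) := by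
  rw [Metric.tendsto_atTop]
  by_contra hcon
  push Not at hcon
  obtain ⟨ε, hε, hfr⟩ := hcon
  obtain ⟨G, hGdef⟩ : ∃ G, G = ∫ t, ‖g t‖ ^ 2 := ⟨_, rfl⟩
  have hG : 0 ≤ G := hGdef ▸ integral_nonneg fun t => sq_nonneg _
  -- With this `l` and `δ = ε / (4l)`, both terms in the bound of `norm_sub_le_add` over a time at
  -- most `δ` are at most `ε / 4`.
  obtain ⟨l, hl⟩ : ∃ l, l = (G + 1) / ε := ⟨_, rfl⟩
  have hlpos : 0 < l := by rw [hl]; positivity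
  obtain ⟨δ, hδdef⟩ : ∃ δ, δ = ε / (4 * l) := ⟨_, rfl⟩
  have hδ : 0 < δ := by rw [hδdef]; positivity
  set S := {x : ℝ | ε / 2 ≤ ‖U x - Uaff am ap x‖}
  have hScl : IsClosed S := isClosed_le continuous_const
    (h.deriv.continuous.sub (continuous_Uaff am ap)).norm
  have hSfin : volume S < ⊤ := by
    have := h.memLp_sub.meas_ge_lt_top (ENNReal.ofReal_pos.2 hγ).ne' ENNReal.ofReal_ne_top
      (ε := ⟨ε / 2, by positivity⟩) (by
        intro h0
        have : ε / 2 = 0 := congrArg NNReal.toReal h0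
        linarith)
    refine lt_of_le_of_lt (measure_mono fun x hx => ?_) this
    exact hx
  have hlim : Tendsto (fun n : ℕ => volume (S ∩ Ici (n : ℝ))) atTop (𝓝 0) := by
    have h1 := tendsto_measure_iInter_atTop (μ := (volume : Measure ℝ))
      (s := fun n : ℕ => S ∩ Ici (n : ℝ))
      (fun n => (hScl.measurableSet.inter measurableSet_Ici).nullMeasurableSet)
      (fun m n hmn => inter_subset_inter_right _ (Ici_subset_Ici.2 (by exact_mod_cast hmn)))
      ⟨0, ((measure_mono inter_subset_left).trans_lt hSfin).ne⟩
    have h2 : ⋂ n : ℕ, S ∩ Ici (n : ℝ) = ∅ := by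
      ext x
      simp only [mem_iInter, mem_inter_iff, mem_Ici, mem_empty_iff_false, iff_false, not_forall]
      obtain ⟨n, hn⟩ := exists_nat_gt x
      exact ⟨n, fun hx => absurd hx.2 (not_le.2 hn)⟩
    rwa [h2, measure_empty] at h1
  obtain ⟨n, hn⟩ := (hlim.eventually (gt_mem_nhds (ENNReal.ofReal_pos.2 hδ))).exists
  obtain ⟨x, hx, hxε⟩ := hfr (max n 1)
  refine absurd hn (not_lt.2 ?_)
  have : Icc x (x + δ) ⊆ S ∩ Ici (n : ℝ) := by
    intro y hy
    have hxn : (n : ℝ) ≤ x := (le_max_left _ _).trans hx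
    have hx1 : (1 : ℝ) ≤ x := (le_max_right _ _).trans hx
    refine ⟨?_, hxn.trans hy.1⟩
    change ε / 2 ≤ ‖U y - Uaff am ap y‖
    rw [Uaff_of_ge am ap (hx1.trans hy.1)]
    have h1 := h.deriv.norm_sub_le_add h.memLp_deriv hlpos hy.1
    have h2 : l * (y - x) ≤ ε / 4 := by
      have : l * (y - x) ≤ l * δ := mul_le_mul_of_nonneg_left (by linarith [hy.2]) hlpos.le
      have e : l * δ = ε / 4 := by rw [hδdef]; field_simp
      linarith
    rw [← hGdef] at h1
    have h3 : G / (4 * l) ≤ ε / 4 := by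
      rw [div_le_iff₀ (by positivity)]
      have : ε * l = G + 1 := by rw [hl]; field_simp
      linarith
    rw [dist_eq_norm] at hxε
    have h4 : ‖U x - ap‖ ≤ ‖U y - ap‖ + ‖U y - U x‖ := by
      have := norm_sub_le (U y - ap) (U y - U x)
      simpa using this
    linarith
  calc ENNReal.ofReal δ = volume (Icc x (x + δ)) := by simp
    _ ≤ _ := measure_mono this

lemma tendsto_atBot (h : IsCompetitor am ap γ K U g) (hγ : 0 < γ) : Tendsto U atBot (𝓝 am) := by
  have := (h.comp_neg.tendsto_atTop hγ).comp tendsto_neg_atBot_atTop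
  simpa [Function.comp_def] using this

end IsCompetitor

/-! ### The cost of crossing between the wells -/

lemma MemLp.ite_le {E : Type*} [NormedAddCommGroup E] {f g : ℝ → E} {p : ENNReal} (hf : MemLp f p)
    (hg : MemLp g p) (c : ℝ) : MemLp (fun x => if x ≤ c then f x else g x) p := by
  have h1 : (fun x => if x ≤ c then f x else g x)
      = fun x => (Iic c).indicator f x + (Ioi c).indicator g x := by
    funext x
    by_cases hx : x ≤ c <;> simp [hx, indicator]
  rw [h1]
  exact (hf.indicator measurableSet_Iic).add (hg.indicator measurableSet_Ioi)

namespace WellData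

variable {N : ℕ} {W : Vec N → ℝ} {am ap : Vec N} {α₀ w₀ γ : ℝ} {K : Set (Vec N)}
variable {U g : ℝ → Vec N}

/-- An upper bound for the cost of connecting a well to a point of `{W ≤ α}` near it. -/
noncomputable def capCost (w₀ γ α : ℝ) : ℝ := ((α / w₀) ^ (1 / γ)) ^ 2 / 2 + α

variable (D : WellData W am ap α₀ w₀ γ K)
include D

lemma lt_of_notMem {α : ℝ} (hα : α ∈ Icc 0 α₀) {u : Vec N} (hu : u ∈ K)
    (hm : u ∉ sublevelComp W α am) (hp : u ∉ sublevelComp W α ap) : α < W u := by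
  by_contra h
  rcases D.cover α hα u hu (not_lt.1 h) with h1 | h1
  exacts [hm h1, hp h1]

lemma tendsto_capCost : Tendsto (capCost w₀ γ) (𝓝[>] 0) (𝓝 0) := by
  have hγ := D.gamma_pos
  have h1 : ContinuousAt (capCost w₀ γ) 0 := by
    unfold capCost
    have : ContinuousAt (fun α : ℝ => (α / w₀) ^ (1 / γ)) 0 :=
      (continuousAt_id.div_const w₀).rpow_const (Or.inr (by positivity))
    exact ((this.pow 2).div_const 2).add continuousAt_id
  have h2 : capCost w₀ γ 0 = 0 := by
    simp [capCost, Real.zero_rpow (inv_pos.2 hγ).ne']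
  have := h1.tendsto
  rw [h2] at this
  exact this.mono_left nhdsWithin_le_nhds

/-- Convexity of the component keeps the ramp in `{W ≤ α}`; its speed is the distance to the well,
which the growth condition controls. -/
lemma ramp_energy_le {u : Vec N} {α : ℝ} (hα : α ∈ Icc 0 α₀) (hu : u ∈ sublevelComp W α am)
    (s : ℝ) : ‖rampDeriv am u 1 s‖ ^ 2 / 2 + W (ramp am u 1 s) ≤ capCost w₀ γ α := by
  have h1 := norm_rampDeriv_le (a := am) (b := u) one_pos s
  rw [div_one] at h1
  have h2 := h1.trans (D.norm_sub_minus_le hα hu)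
  have h3 := pow_le_pow_left₀ (norm_nonneg _) h2 2
  have h4 := sublevelComp_le (((D.hypA1.convex_minus α hα).segment_subset
    (D.minus_mem hα.1) hu) (ramp_mem_segment one_pos s))
  rw [capCost]
  linarith

lemma ramp_mem_K {u : Vec N} (hu : u ∈ K) (s : ℝ) : ramp am u 1 s ∈ K :=
  D.convex.segment_subset D.minus_mem_K hu (ramp_mem_segment one_pos s)

/-- Crossing from the well of `am` to the well of `ap` costs almost the minimal energy. -/
lemma minEnergy_le_crossing (hU : HasIntDeriv U g) (hg : MemLp g 2) (hK : ∀ s, U s ∈ K) {α : ℝ}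
    (hα : α ∈ Icc 0 α₀) {x y : ℝ} (hxy : x ≤ y) (hx : U x ∈ sublevelComp W α am)
    (hy : U y ∈ sublevelComp W α ap) :
    minEnergy W am ap γ K
      ≤ energyOn W U g (Ioc x y) + 2 * ENNReal.ofReal (capCost w₀ γ α) := by
  -- The competitor follows `U` on `[x, y]` and reaches the wells by ramps of length one on `[x - 1,
  -- x]` and `[y, y + 1]`.
  have hA : HasIntDeriv (fun s => ramp am (U x) 1 (s - (x - 1)))
      (fun s => rampDeriv am (U x) 1 (s - (x - 1))) :=
    (hasIntDeriv_ramp am (U x) one_pos).comp_sub_right (x - 1)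
  have hB : HasIntDeriv (fun s => ramp ap (U y) 1 (-(s - (y + 1))))
      (fun s => -rampDeriv ap (U y) 1 (-(s - (y + 1)))) :=
    (hasIntDeriv_ramp ap (U y) one_pos).comp_neg.comp_sub_right (y + 1)
  have hUB := hU.glue hB (c := y) (by rw [ramp_of_ge one_pos (by linarith)])
  have hV := hA.glue hUB (c := x) (by
    rw [ramp_of_ge one_pos (by linarith), if_pos hxy])
  set V : ℝ → Vec N := fun s => if s ≤ x then ramp am (U x) 1 (s - (x - 1)) else
    if s ≤ y then U s else ramp ap (U y) 1 (-(s - (y + 1))) with hVdef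
  set v : ℝ → Vec N := fun s => if s ≤ x then rampDeriv am (U x) 1 (s - (x - 1)) else
    if s ≤ y then g s else -rampDeriv ap (U y) 1 (-(s - (y + 1))) with hvdef
  have hcomp : IsCompetitor am ap γ K V v := by
    refine ⟨hV, memLp_sub_Uaff hV.continuous (max (|x| + 1) (|y| + 1)) (fun s hs => ?_)
      (fun s hs => ?_) _, ?_, fun s => ?_⟩
    · have h1 : s ≤ x - 1 := by
        linarith [le_max_left (|x| + 1) (|y| + 1), neg_abs_le x]
      simp only [hVdef]
      rw [if_pos (by linarith), ramp_of_nonpos (by linarith)]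
    · have h1 : y + 1 ≤ s := by
        linarith [le_max_right (|x| + 1) (|y| + 1), le_abs_self y]
      simp only [hVdef]
      rw [if_neg (by linarith), if_neg (by linarith), ramp_of_nonpos (by linarith)]
    · refine MemLp.ite_le ?_ (MemLp.ite_le hg ?_ y) x
      · exact (memLp_rampDeriv am (U x) 1 2).comp_measurePreserving
          (measurePreserving_sub_right volume (x - 1))
      · exact (((memLp_rampDeriv ap (U y) 1 2).comp_measurePreserving
          (Measure.measurePreserving_neg volume)).comp_measurePreserving
          (measurePreserving_sub_right volume (y + 1))).neg
    · simp only [hVdef]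
      split_ifs
      · exact D.ramp_mem_K (hK x) _
      · exact hK s
      · exact D.swap.ramp_mem_K (hK y) _
  refine hcomp.minEnergy_le.trans ?_
  rw [energyOn_univ_eq_three hxy]
  have h1 : energyOn W V v (Iic x) ≤ ENNReal.ofReal (capCost w₀ γ α) := by
    refine (energyOn_le_of_forall (I := Ioc (x - 1) x) (c := capCost w₀ γ α) measurableSet_Iic
      measurableSet_Ioc (fun s hs hsI => ?_) (fun s hs _ => ?_)).trans (le_of_eq (by simp))
    · have hs' : s ≤ x := hs
      have h2 : s ≤ x - 1 := by
        by_contra h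
        exact hsI ⟨not_le.1 h, hs⟩
      simp only [hVdef, hvdef, if_pos hs']
      rw [ramp_of_nonpos (by linarith), rampDeriv_of_nonpos (by linarith)]
      exact ⟨rfl, D.zero_minus⟩
    · have hs' : s ≤ x := hs
      simp only [hVdef, hvdef, if_pos hs']
      exact D.ramp_energy_le hα hx _
  have h2 : energyOn W V v (Ioi y) ≤ ENNReal.ofReal (capCost w₀ γ α) := by
    refine (energyOn_le_of_forall (I := Ico y (y + 1)) (c := capCost w₀ γ α) measurableSet_Ioi
      measurableSet_Ico (fun s hs hsI => ?_) (fun s hs _ => ?_)).trans (le_of_eq (by simp))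
    · have hs' : y < s := hs
      have h2 : y + 1 ≤ s := by
        by_contra h
        exact hsI ⟨hs'.le, not_le.1 h⟩
      simp only [hVdef, hvdef, if_neg (not_le.2 hs'), if_neg (not_le.2 (hxy.trans_lt hs'))]
      rw [ramp_of_nonpos (by linarith), rampDeriv_of_nonpos (by linarith)]
      exact ⟨neg_zero, D.zero_plus⟩
    · have hs' : y < s := hs
      simp only [hVdef, hvdef, if_neg (not_le.2 hs'), if_neg (not_le.2 (hxy.trans_lt hs')),
        norm_neg]
      exact D.swap.ramp_energy_le hα hy _
  have h3 : energyOn W V v (Ioc x y) = energyOn W U g (Ioc x y) := by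
    refine energyOn_congr measurableSet_Ioc (fun s hs => ?_) (fun s hs => ?_)
    · simp only [hVdef, if_neg (not_le.2 hs.1), if_pos hs.2]
    · simp only [hvdef, if_neg (not_le.2 hs.1), if_pos hs.2]
  rw [h3]
  calc energyOn W V v (Iic x) + energyOn W U g (Ioc x y) + energyOn W V v (Ioi y)
      ≤ ENNReal.ofReal (capCost w₀ γ α) + energyOn W U g (Ioc x y)
        + ENNReal.ofReal (capCost w₀ γ α) := by gcongr
    _ = _ := by ring

/-- Returning from the well of `ap` to the well of `am` costs almost twice the minimal energy. -/
lemma two_mul_minEnergy_le (h : IsCompetitor am ap γ K U g) {α : ℝ} (hα : α ∈ Ioc 0 α₀)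
    {y z : ℝ} (hyz : y ≤ z) (hy : U y ∈ sublevelComp W α ap) (hz : U z ∈ sublevelComp W α am) :
    2 * minEnergy W am ap γ K
      ≤ energyOn W U g univ + 4 * ENNReal.ofReal (capCost w₀ γ α) := by
  have hα' : α ∈ Icc 0 α₀ := ⟨hα.1.le, hα.2⟩
  obtain ⟨x, hxy, hx⟩ : ∃ x ≤ y, U x ∈ sublevelComp W α am := by
    have h1 := (h.tendsto_atBot D.gamma_pos).eventually
      (sublevelComp_mem_nhds D.continuous (by rw [D.zero_minus]; exact hα.1))
    obtain ⟨x, hx, hx'⟩ := (h1.and (eventually_le_atBot y)).exists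
    exact ⟨x, hx', hx⟩
  have h1 := D.minEnergy_le_crossing h.deriv h.memLp_deriv h.mem hα' hxy hx hy
  -- Read backwards in time, the return from `y` to `z` is again a crossing from the well of `am` to
  -- that of `ap`.
  have h2 := D.minEnergy_le_crossing h.deriv.comp_neg h.comp_neg.memLp_deriv (fun s => h.mem _)
    hα' (neg_le_neg hyz) (by rwa [neg_neg]) (by rwa [neg_neg])
  have h3 : energyOn W (fun x => U (-x)) (fun x => -g (-x)) (Ioc (-z) (-y))
      = energyOn W U g (Ioc y z) := by
    rw [energyOn_comp_neg]
    have : (Neg.neg ⁻¹' Ioc (-z) (-y) : Set ℝ) = Ico y z := by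
      ext s; simp
    rw [this]
    exact setLIntegral_congr Ico_ae_eq_Ioc
  rw [h3] at h2
  have h4 : energyOn W U g (Ioc x y) + energyOn W U g (Ioc y z) ≤ energyOn W U g univ := by
    rw [← energyOn_union measurableSet_Ioc
      (disjoint_left.2 fun s hs hs' => absurd hs.2 (not_le.2 hs'.1))]
    exact energyOn_mono (subset_univ _)
  calc 2 * minEnergy W am ap γ K
      ≤ (energyOn W U g (Ioc x y) + 2 * ENNReal.ofReal (capCost w₀ γ α))
        + (energyOn W U g (Ioc y z) + 2 * ENNReal.ofReal (capCost w₀ γ α)) := by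
        rw [two_mul]; exact add_le_add h1 h2
    _ = (energyOn W U g (Ioc x y) + energyOn W U g (Ioc y z))
        + 4 * ENNReal.ofReal (capCost w₀ γ α) := by ring
    _ ≤ _ := by gcongr

/-- Between the last visit to one well and the next visit to the other, the path stays in `{W > α₀}`
while covering at least their distance, which is positive as one well is compact and the other
closed. -/
lemma exists_pos_le_minEnergy : ∃ d : ℝ, 0 < d ∧ ENNReal.ofReal d ≤ minEnergy W am ap γ K := by
  have hα : α₀ ∈ Icc 0 α₀ := ⟨D.alpha_pos.le, le_rfl⟩
  obtain ⟨r, hr, hrd⟩ := Metric.exists_pos_forall_lt_edist (D.isCompact_minus hα)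
    (isClosed_sublevelComp D.continuous α₀ ap) (D.disjoint hα)
  have hs : 0 < Real.sqrt (2 * α₀) := Real.sqrt_pos.2 (by linarith [D.alpha_pos])
  refine ⟨Real.sqrt (2 * α₀) * r, mul_pos hs (by exact_mod_cast hr), le_sInf ?_⟩
  rintro _ ⟨U, g, h, rfl⟩
  obtain ⟨x, hx⟩ := ((h.tendsto_atBot D.gamma_pos).eventually
    (sublevelComp_mem_nhds D.continuous (by rw [D.zero_minus]; exact D.alpha_pos))).exists
  obtain ⟨y, hy, hxy⟩ := (((h.tendsto_atTop D.gamma_pos).eventually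
    (sublevelComp_mem_nhds D.continuous (by rw [D.zero_plus]; exact D.alpha_pos))).and
    (eventually_ge_atTop x)).exists
  obtain ⟨s, hs1, hs2, hs3⟩ := exists_last_mem h.deriv.continuous
    (isClosed_sublevelComp D.continuous α₀ am) hxy hx
  obtain ⟨t, ht1, ht2, ht3⟩ := exists_first_mem h.deriv.continuous
    (isClosed_sublevelComp D.continuous α₀ ap) hs1.2 hy
  have h1 := h.deriv.ofReal_mul_norm_sub_le (W := W) D.alpha_pos.le ht1.1 (fun q hq =>
    (D.lt_of_notMem hα (h.mem q) (hs3 q ⟨hq.1, hq.2.le.trans ht1.2⟩)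
      (ht3 q ⟨hq.1.le, hq.2⟩)).le)
  refine le_trans (ENNReal.ofReal_le_ofReal ?_) (h1.trans (energyOn_mono (subset_univ _)))
  refine mul_le_mul_of_nonneg_left ?_ hs.le
  have h2 := hrd _ hs2 _ ht2
  rw [edist_comm, edist_dist, dist_eq_norm, ← ENNReal.ofReal_coe_nnreal] at h2
  exact ((ENNReal.ofReal_lt_ofReal_iff_of_nonneg r.2).1 h2).le

/-- Competitors with bounded energy are uniformly bounded. -/
lemma exists_norm_le (E : ℝ) : ∃ R, ∀ U g, IsCompetitor am ap γ K U g →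
    energyOn W U g univ ≤ ENNReal.ofReal E → ∀ x, ‖U x‖ ≤ R := by
  have hα : α₀ ∈ Icc 0 α₀ := ⟨D.alpha_pos.le, le_rfl⟩
  set A := sublevelComp W α₀ am ∪ sublevelComp W α₀ ap with hA
  have hAc : IsCompact A := (D.isCompact_minus hα).union (D.swap.isCompact_minus hα)
  obtain ⟨R, hR⟩ := hAc.isBounded.exists_norm_le
  have hs : 0 < Real.sqrt (2 * α₀) := Real.sqrt_pos.2 (by linarith [D.alpha_pos])
  refine ⟨R + max E 0 / Real.sqrt (2 * α₀), fun U g h hE x => ?_⟩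
  obtain ⟨y, hy, hyx⟩ := (((h.tendsto_atBot D.gamma_pos).eventually
    (sublevelComp_mem_nhds D.continuous (by rw [D.zero_minus]; exact D.alpha_pos))).and
    (eventually_le_atBot x)).exists
  -- After the last visit to the bounded set `A` before `x`, the potential exceeds `α₀`, so the
  -- energy bounds the distance travelled since.
  obtain ⟨s, hs1, hs2, hs3⟩ := exists_last_mem h.deriv.continuous hAc.isClosed hyx (Or.inl hy)
  have h1 := h.deriv.ofReal_mul_norm_sub_le (W := W) D.alpha_pos.le hs1.2 (fun q hq => by
    have := hs3 q ⟨hq.1, hq.2.le⟩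
    rw [hA, mem_union, not_or] at this
    exact (D.lt_of_notMem hα (h.mem q) this.1 this.2).le)
  have h2 := (h1.trans (energyOn_mono (subset_univ _))).trans
    (hE.trans (ENNReal.ofReal_le_ofReal (le_max_left E 0)))
  rw [ENNReal.ofReal_le_ofReal_iff (le_max_right _ _)] at h2
  have h3 : ‖U x - U s‖ ≤ max E 0 / Real.sqrt (2 * α₀) := by
    rw [le_div_iff₀ hs]; linarith
  have h4 := hR _ hs2
  have h5 := norm_add_le (U s) (U x - U s)
  rw [add_sub_cancel] at h5
  linarith

end WellData

/-! ### Tools for weak convergence -/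

/-- Bounded sequences in a separable Hilbert space have weakly convergent subsequences. -/
lemma exists_weakly_convergent_subseq {H : Type*} [NormedAddCommGroup H] [InnerProductSpace ℝ H]
    [CompleteSpace H] [SecondCountableTopology H] {x : ℕ → H} {R : ℝ} (hx : ∀ i, ‖x i‖ ≤ R) :
    ∃ y, ∃ σ : ℕ → ℕ, StrictMono σ ∧
      ∀ z, Tendsto (fun i => inner ℝ (x (σ i)) z) atTop (𝓝 (inner ℝ y z)) := by
  -- Sequential Banach-Alaoglu, transported through the Riesz isomorphism.
  obtain ⟨f, _, σ, hσ, hlim⟩ := WeakDual.isSeqCompact_closedBall ℝ H 0 R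
    (x := fun i => StrongDual.toWeakDual (InnerProductSpace.toDual ℝ H (x i)))
    (fun i => by simpa using hx i)
  refine ⟨(InnerProductSpace.toDual ℝ H).symm (WeakDual.toStrongDual f), σ, hσ, fun z => ?_⟩
  have h1 := ((WeakDual.eval_continuous z).tendsto f).comp hlim
  rw [InnerProductSpace.toDual_symm_apply]
  exact h1

lemma tendsto_of_forall_tendsto_inner {N : ℕ} {ι : Type*} {l : Filter ι} {u : ι → Vec N}
    {v : Vec N} (h : ∀ e : Vec N, Tendsto (fun i => inner ℝ e (u i)) l (𝓝 (inner ℝ e v))) :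
    Tendsto u l (𝓝 v) := by
  have h1 : Tendsto (fun i => WithLp.ofLp (u i)) l (𝓝 (WithLp.ofLp v)) := by
    rw [tendsto_pi_nhds]
    intro j
    simpa [EuclideanSpace.inner_single_left] using h (EuclideanSpace.single j 1)
  exact ((PiLp.continuous_toLp 2 _).tendsto _).comp h1

/-- Weak convergence in `L^p` of bounded sequences that converge pointwise. -/
lemma tendsto_integral_inner_of_bounded {N : ℕ} {p q : ℝ} (hpq : p.HolderConjugate q)
    {f : ℕ → ℝ → Vec N} {φ : ℝ → Vec N} (hf : ∀ i, AEStronglyMeasurable (f i))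
    {B : ENNReal} (hB : B ≠ ⊤) (hfB : ∀ i, ∫⁻ x, ENNReal.ofReal (‖f i x‖ ^ p) ≤ B)
    (h0 : ∀ x, Tendsto (fun i => f i x) atTop (𝓝 0)) (hφ : MemLp φ (ENNReal.ofReal q)) :
    Tendsto (fun i => ∫ x, inner ℝ (f i x) (φ x)) atTop (𝓝 0) := by
  have hp := hpq.pos
  have hq := hpq.symm.pos
  have hφm : AEMeasurable (fun x => ‖φ x‖) := hφ.1.norm.aemeasurable
  have hφq : ∫⁻ x, ENNReal.ofReal (‖φ x‖ ^ q) ≠ ⊤ := by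
    have := hφ.integrable_norm_rpow (ENNReal.ofReal_pos.2 hq).ne' ENNReal.ofReal_ne_top
    rw [ENNReal.toReal_ofReal hq.le] at this
    exact (hasFiniteIntegral_iff_ofReal (ae_of_all _ fun x => by positivity)).1 this.2 |>.ne
  set u : ℕ → ℝ → ENNReal := fun i x => ENNReal.ofReal (‖f i x‖ * ‖φ x‖) with hu
  have hum : ∀ i, AEMeasurable (u i) := fun i =>
    ((hf i).norm.aemeasurable.mul hφm).ennreal_ofReal
  have hfm : ∀ i, AEMeasurable (fun x => ENNReal.ofReal (‖f i x‖ ^ p)) := fun i =>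
    ((hf i).norm.aemeasurable.pow_const p).ennreal_ofReal
  have hu0 : Tendsto (fun i => ∫⁻ x, u i x) atTop (𝓝 0) := by
    rw [ENNReal.tendsto_nhds_zero]
    intro ε hε
    obtain ⟨δ, hδB, hδ⟩ : ∃ δ : ℝ, ENNReal.ofReal (δ ^ p / p) * B ≤ ε / 2 ∧ 0 < δ := by
      have h1 : Tendsto (fun δ : ℝ => ENNReal.ofReal (δ ^ p / p) * B) (𝓝[>] 0) (𝓝 0) := by
        have h2 : Tendsto (fun δ : ℝ => ENNReal.ofReal (δ ^ p / p)) (𝓝[>] 0) (𝓝 0) := by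
          have h3 : ContinuousAt (fun δ : ℝ => δ ^ p / p) 0 :=
            (continuousAt_id.rpow_const (Or.inr hp.le)).div_const p
          have h4 := ENNReal.tendsto_ofReal h3.tendsto
          simp only [Real.zero_rpow hp.ne', zero_div, ENNReal.ofReal_zero] at h4
          exact h4.mono_left nhdsWithin_le_nhds
        simpa using ENNReal.Tendsto.mul_const h2 (Or.inr hB)
      exact (((ENNReal.tendsto_nhds_zero.1 h1) (ε / 2) (ENNReal.half_pos hε.ne')).and
        self_mem_nhdsWithin).exists
    -- Young's inequality with weight `δ`: the part of `|f||φ|` exceeding `δ^p |f|^p / p` is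
    -- dominated by a fixed multiple of `|φ|^q`, so its integral tends to zero, while the remainder
    -- is small uniformly in `i`.
    set k : ℕ → ℝ → ENNReal := fun i x =>
      u i x - ENNReal.ofReal (δ ^ p / p) * ENNReal.ofReal (‖f i x‖ ^ p) with hk
    have hkb : ∀ i x, k i x ≤ ENNReal.ofReal (1 / (q * δ ^ q)) * ENNReal.ofReal (‖φ x‖ ^ q) := by
      intro i x
      rw [hk, tsub_le_iff_right, ← ENNReal.ofReal_mul (by positivity),
        ← ENNReal.ofReal_mul (by positivity), ← ENNReal.ofReal_add (by positivity) (by positivity)]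
      refine ENNReal.ofReal_le_ofReal ?_
      have h1 := Real.young_inequality_of_nonneg (a := δ * ‖f i x‖) (b := ‖φ x‖ / δ)
        (by positivity) (by positivity) hpq
      rw [Real.mul_rpow hδ.le (norm_nonneg _), Real.div_rpow (norm_nonneg _) hδ.le] at h1
      have h2 : δ * ‖f i x‖ * (‖φ x‖ / δ) = ‖f i x‖ * ‖φ x‖ := by field_simp
      rw [h2] at h1
      refine h1.trans (le_of_eq ?_)
      have : δ ^ q ≠ 0 := (Real.rpow_pos_of_pos hδ q).ne'
      field_simp
      ring
    have hk0 : Tendsto (fun i => ∫⁻ x, k i x) atTop (𝓝 0) := by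
      have := tendsto_lintegral_of_dominated_convergence' (μ := volume) (F := k) (f := fun _ => 0)
        (fun x => ENNReal.ofReal (1 / (q * δ ^ q)) * ENNReal.ofReal (‖φ x‖ ^ q))
        (fun i => (hum i).sub ((hfm i).const_mul _)) (fun i => ae_of_all _ (hkb i))
        (by
          rw [lintegral_const_mul'' _ (hφm.pow_const q).ennreal_ofReal]
          exact ENNReal.mul_ne_top ENNReal.ofReal_ne_top hφq)
        (ae_of_all _ fun x => by
          have h1 : Tendsto (fun i => u i x) atTop (𝓝 0) := by
            have h2 := ENNReal.tendsto_ofReal (((h0 x).norm).mul_const ‖φ x‖)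
            simpa only [norm_zero, zero_mul, ENNReal.ofReal_zero] using h2
          exact tendsto_of_tendsto_of_tendsto_of_le_of_le tendsto_const_nhds h1
            (fun _ => zero_le) (fun i => tsub_le_self))
      simpa using this
    filter_upwards [(ENNReal.tendsto_nhds_zero.1 hk0) (ε / 2) (ENNReal.half_pos hε.ne')] with i hi
    calc ∫⁻ x, u i x
        ≤ ∫⁻ x, (ENNReal.ofReal (δ ^ p / p) * ENNReal.ofReal (‖f i x‖ ^ p) + k i x) :=
          lintegral_mono fun x => le_add_tsub
      _ = ENNReal.ofReal (δ ^ p / p) * (∫⁻ x, ENNReal.ofReal (‖f i x‖ ^ p)) + ∫⁻ x, k i x := by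
          rw [lintegral_add_left' ((hfm i).const_mul _), lintegral_const_mul'' _ (hfm i)]
      _ ≤ ENNReal.ofReal (δ ^ p / p) * B + ε / 2 := by gcongr; exact hfB i
      _ ≤ ε / 2 + ε / 2 := by gcongr
      _ = ε := ENNReal.add_halves ε
  rw [tendsto_zero_iff_enorm_tendsto_zero]
  refine tendsto_of_tendsto_of_tendsto_of_le_of_le tendsto_const_nhds hu0 (fun _ => zero_le)
    fun i => (enorm_integral_le_lintegral_enorm _).trans (lintegral_mono fun x => ?_)
  rw [hu, ← ofReal_norm]
  exact ENNReal.ofReal_le_ofReal (norm_inner_le_norm _ _)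

/-- Primitives of weakly convergent `L²` functions converge pointwise. -/
lemma tendsto_intervalIntegral_of_weakly {N : ℕ} {G : ℕ → Lp (Vec N) 2 (volume : Measure ℝ)}
    {Y : Lp (Vec N) 2 (volume : Measure ℝ)}
    (h : ∀ z, Tendsto (fun i => inner ℝ (G i) z) atTop (𝓝 (inner ℝ Y z))) (a b : ℝ) :
    Tendsto (fun i => ∫ x in a..b, G i x) atTop (𝓝 (∫ x in a..b, Y x)) := by
  have key : ∀ a b : ℝ, Tendsto (fun i => ∫ x in Ioc a b, G i x) atTop
      (𝓝 (∫ x in Ioc a b, Y x)) := by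
    intro a b
    refine tendsto_of_forall_tendsto_inner fun e => ?_
    -- Testing with `e` times the indicator of the interval gives the `e`-component of the integral.
    have h1 := h (indicatorConstLp 2 (measurableSet_Ioc (a := a) (b := b)) (by simp) e)
    simp only [real_inner_comm (indicatorConstLp 2 _ _ e)] at h1
    simpa only [L2.inner_indicatorConstLp_eq_inner_setIntegral] using h1
  exact (key a b).sub (key b a)

lemma norm_Uaff_le {N : ℕ} (am ap : Vec N) (x : ℝ) : ‖Uaff am ap x‖ ≤ ‖am‖ + ‖ap‖ := by
  rw [Uaff]
  split_ifs with h1 h2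
  · linarith [norm_nonneg ap]
  · refine (norm_add_le _ _).trans (add_le_add ?_ ?_)
    · rw [norm_smul, Real.norm_of_nonneg (by linarith)]
      exact mul_le_of_le_one_left (norm_nonneg _) (by linarith)
    · rw [norm_smul, Real.norm_of_nonneg (by linarith)]
      exact mul_le_of_le_one_left (norm_nonneg _) (by linarith)
  · linarith [norm_nonneg am]

/-- Uniform `L^γ` bound from the pointwise control of the distance to the wells. -/
lemma lintegral_rpow_sub_Uaff_le {N : ℕ} {W : Vec N → ℝ} {am ap : Vec N} {γ C R : ℝ}
    {V v : ℝ → Vec N} (hγ : 0 < γ) (hC : 0 ≤ C)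
    (hR : ∀ x, ‖V x‖ ≤ R) (hp : ∀ x, 0 < x → ‖V x - ap‖ ^ γ ≤ C * W (V x))
    (hm : ∀ x < 0, ‖V x - am‖ ^ γ ≤ C * W (V x)) :
    ∫⁻ x, ENNReal.ofReal (‖V x - Uaff am ap x‖ ^ γ)
      ≤ ENNReal.ofReal C * energyOn W V v univ
        + ENNReal.ofReal ((R + (‖am‖ + ‖ap‖)) ^ γ) * 2 := by
  have hpt : ∀ x, ENNReal.ofReal (‖V x - Uaff am ap x‖ ^ γ)
      ≤ ENNReal.ofReal C * ENNReal.ofReal (‖v x‖ ^ 2 / 2 + W (V x))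
        + (Ioo (-1 : ℝ) 1).indicator
          (fun _ => ENNReal.ofReal ((R + (‖am‖ + ‖ap‖)) ^ γ)) x := by
    intro x
    have h0 : C * W (V x) ≤ C * (‖v x‖ ^ 2 / 2 + W (V x)) :=
      mul_le_mul_of_nonneg_left (by linarith [sq_nonneg ‖v x‖]) hC
    rw [← ENNReal.ofReal_mul hC]
    by_cases h1 : 1 ≤ x
    · rw [Uaff_of_ge am ap h1]
      exact (ENNReal.ofReal_le_ofReal ((hp x (by linarith)).trans h0)).trans le_self_add
    · by_cases h2 : x ≤ -1
      · rw [Uaff_of_le am ap h2]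
        exact (ENNReal.ofReal_le_ofReal ((hm x (by linarith)).trans h0)).trans le_self_add
      · rw [indicator_of_mem (show x ∈ Ioo (-1 : ℝ) 1 from ⟨not_le.1 h2, not_le.1 h1⟩)]
        refine le_trans (ENNReal.ofReal_le_ofReal ?_) le_add_self
        refine Real.rpow_le_rpow (norm_nonneg _) ?_ hγ.le
        exact (norm_sub_le _ _).trans (add_le_add (hR x) (norm_Uaff_le am ap x))
  refine (lintegral_mono hpt).trans (le_of_eq ?_)
  rw [lintegral_add_right _ (measurable_const.indicator measurableSet_Ioo),
    lintegral_const_mul' _ _ ENNReal.ofReal_ne_top, lintegral_indicator measurableSet_Ioo,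
    setLIntegral_const, Real.volume_Ioo, energyOn, Measure.restrict_univ]
  norm_num

/-! ### Centering of competitors with almost minimal action -/

namespace WellData

variable {N : ℕ} {W : Vec N → ℝ} {am ap : Vec N} {α₀ w₀ γ : ℝ} {K : Set (Vec N)}
variable {U g : ℝ → Vec N} (D : WellData W am ap α₀ w₀ γ K)
include D

/-- In the well of `ap` the growth condition applies. Elsewhere, outside the other well, `W > α`, so
the bounded left side is absorbed by `R ^ γ / α * W u`. -/
lemma norm_sub_rpow_le {α R : ℝ} (hα : α ∈ Ioc 0 α₀) {u : Vec N} (hu : u ∈ K)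
    (hum : u ∉ sublevelComp W α am) (hR : ‖u - ap‖ ≤ R) :
    ‖u - ap‖ ^ γ ≤ (1 / w₀ + R ^ γ / α) * W u := by
  have hW := D.nonneg u hu
  have hw := D.hypA1.w_pos
  have hRp : 0 ≤ R ^ γ := Real.rpow_nonneg ((norm_nonneg _).trans hR) _
  rw [add_mul]
  by_cases hup : u ∈ sublevelComp W α₀ ap
  · have h1 := D.hypA1.growth_plus u hup
    have h2 : ‖u - ap‖ ^ γ ≤ 1 / w₀ * W u := by
      rw [one_div, inv_mul_eq_div, le_div_iff₀ hw]; linarith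
    have h3 : 0 ≤ R ^ γ / α * W u := mul_nonneg (div_nonneg hRp hα.1.le) hW
    linarith
  · have h1 := D.lt_of_notMem ⟨hα.1.le, hα.2⟩ hu hum (fun h => hup (sublevelComp_mono hα.2 h))
    have h2 : ‖u - ap‖ ^ γ ≤ R ^ γ := Real.rpow_le_rpow (norm_nonneg _) hR D.gamma_pos.le
    have h3 : R ^ γ ≤ R ^ γ / α * W u := by
      rw [div_mul_eq_mul_div, le_div_iff₀ hα.1]
      exact mul_le_mul_of_nonneg_left h1.le hRp
    have h4 : 0 ≤ 1 / w₀ * W u := mul_nonneg (by positivity) hW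
    linarith

lemma minEnergy_ne_top : minEnergy W am ap γ K ≠ ⊤ :=
  (D.minEnergy_le_Mconst.trans_lt ENNReal.ofReal_lt_top).ne

lemma minEnergy_ne_zero : minEnergy W am ap γ K ≠ 0 := by
  obtain ⟨d, hd, hdm⟩ := D.exists_pos_le_minEnergy
  exact ((ENNReal.ofReal_pos.2 hd).trans_le hdm).ne'

/-- Competitors with almost minimal energy can be centered so that they are close to the
respective well on both half lines. -/
lemma exists_center : ∃ C R : ℝ, 0 ≤ C ∧ ∀ U g, IsCompetitor am ap γ K U g →
    2 * energyOn W U g univ ≤ 3 * minEnergy W am ap γ K →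
    ∃ s, ∀ x, ‖U x‖ ≤ R ∧ (s < x → ‖U x - ap‖ ^ γ ≤ C * W (U x)) ∧
      (x < s → ‖U x - am‖ ^ γ ≤ C * W (U x)) := by
  obtain ⟨d, hd, hdm⟩ := D.exists_pos_le_minEnergy
  set m := minEnergy W am ap γ K with hm
  have hmtop : m ≠ ⊤ := D.minEnergy_ne_top
  -- What is needed below is `8 * capCost w₀ γ α < m`.
  obtain ⟨α, hcap, hα⟩ : ∃ α, capCost w₀ γ α < d / 16 ∧ α ∈ Ioc 0 α₀ :=
    ((D.tendsto_capCost.eventually (gt_mem_nhds (by positivity))).and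
      (Ioc_mem_nhdsGT D.alpha_pos)).exists
  obtain ⟨R, hR⟩ := D.exists_norm_le (3 * m).toReal
  have hR' : ∀ U g, IsCompetitor am ap γ K U g → 2 * energyOn W U g univ ≤ 3 * m →
      ∀ x, ‖U x‖ ≤ R := by
    intro U g h hE
    refine hR U g h ?_
    rw [ENNReal.ofReal_toReal (ENNReal.mul_ne_top (by simp) hmtop)]
    refine le_trans ?_ hE
    rw [two_mul]; exact le_self_add
  set C := 1 / w₀ + (|R| + (‖am‖ + ‖ap‖)) ^ γ / α with hC
  refine ⟨C, R, add_nonneg (one_div_nonneg.2 D.hypA1.w_pos.le)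
    (div_nonneg (by positivity) hα.1.le), fun U g h hE => ?_⟩
  have hbd : ∀ x, ‖U x‖ ≤ |R| := fun x => (hR' U g h hE x).trans (le_abs_self R)
  obtain ⟨x₀, hx₀⟩ := ((h.tendsto_atBot D.gamma_pos).eventually
    (sublevelComp_mem_nhds D.continuous (by rw [D.zero_minus]; exact hα.1))).exists
  obtain ⟨y, hy⟩ := eventually_atTop.1 ((h.tendsto_atTop D.gamma_pos).eventually
    (sublevelComp_mem_nhds D.continuous (α := α) (by rw [D.zero_plus]; exact hα.1)))
  have hα' : α ∈ Icc 0 α₀ := ⟨hα.1.le, hα.2⟩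
  -- The centre is the last visit to the well of `am` at level `α`; beyond `max x₀ y` the path is in
  -- the well of `ap`.
  obtain ⟨s, hs1, hs2, hs3⟩ := exists_last_mem h.deriv.continuous
    (isClosed_sublevelComp D.continuous α am) (le_max_left x₀ y) hx₀
  refine ⟨s, fun x => ⟨hR' U g h hE x, fun hx => ?_, fun hx => ?_⟩⟩
  · refine D.norm_sub_rpow_le hα (h.mem x) (fun hmem => ?_)
      ((norm_sub_le _ _).trans (add_le_add (hbd x) (by linarith [norm_nonneg am])))
    by_cases hxy : x ≤ max x₀ y
    · exact hs3 x ⟨hx, hxy⟩ hmem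
    · exact D.notMem_plus hα' hmem (hy x ((le_max_right x₀ y).trans (not_le.1 hxy).le))
  · rw [hC, add_comm ‖am‖]
    rw [add_comm ‖am‖] at hC
    refine D.swap.norm_sub_rpow_le hα (h.mem x) (fun hmem => ?_)
      ((norm_sub_le _ _).trans (add_le_add (hbd x) (by linarith [norm_nonneg ap])))
    -- A visit to the well of `ap` before `s` would be followed by a return at `s`, too expensive
    -- for action at most `3m / 2`.
    have h1 := D.two_mul_minEnergy_le h hα hx.le hmem hs2
    rw [← hm] at h1
    have h2 : 8 * ENNReal.ofReal (capCost w₀ γ α) < m := by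
      refine lt_of_lt_of_le ?_ hdm
      rw [← ENNReal.ofReal_ofNat, ← ENNReal.ofReal_mul (by norm_num)]
      exact (ENNReal.ofReal_lt_ofReal_iff hd).2 (by linarith)
    have h3 : 4 * m < 4 * m := by
      calc 4 * m = 2 * (2 * m) := by rw [← mul_assoc]; norm_num
        _ ≤ 2 * (energyOn W U g univ + 4 * ENNReal.ofReal (capCost w₀ γ α)) := by gcongr
        _ = 2 * energyOn W U g univ + 8 * ENNReal.ofReal (capCost w₀ γ α) := by
            rw [mul_add, ← mul_assoc]; norm_num
        _ ≤ 3 * m + 8 * ENNReal.ofReal (capCost w₀ γ α) := by gcongr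
        _ < 3 * m + m := ENNReal.add_lt_add_left (ENNReal.mul_ne_top (by simp) hmtop) h2
        _ = 4 * m := by ring
    exact lt_irrefl _ h3

end WellData

/-! ### Lower semicontinuity of the action -/

lemma ENNReal.liminf_add_liminf_le (u v : ℕ → ENNReal) :
    liminf u atTop + liminf v atTop ≤ liminf (fun i => u i + v i) atTop := by
  simp only [liminf_eq_iSup_iInf_of_nat]
  have hmono : ∀ w : ℕ → ENNReal, Monotone fun n => ⨅ i ≥ n, w i := fun w a b hab =>
    le_iInf₂ fun i hi => iInf₂_le i (hab.trans hi)
  rw [ENNReal.iSup_add_iSup_of_monotone (hmono u) (hmono v)]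
  exact iSup_mono fun n => le_iInf₂ fun i hi => add_le_add (iInf₂_le i hi) (iInf₂_le i hi)

section lowerSemicontinuity

variable {N : ℕ} {W : Vec N → ℝ}

lemma ofReal_norm_sq_eq_lintegral (G : Lp (Vec N) 2 (volume : Measure ℝ)) :
    ∫⁻ x, ENNReal.ofReal (‖G x‖ ^ 2 / 2) = ENNReal.ofReal (‖G‖ ^ 2 / 2) := by
  have h1 : Integrable fun x => ‖G x‖ ^ 2 :=
    (memLp_two_iff_integrable_sq_norm (Lp.memLp G).1).1 (Lp.memLp G)
  rw [← ofReal_integral_eq_lintegral_ofReal (h1.div_const 2) (ae_of_all _ fun x => by positivity),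
    integral_div, ← real_inner_self_eq_norm_sq, L2.inner_def]
  simp only [real_inner_self_eq_norm_sq]

/-- Lower semicontinuity of the action under weak convergence of the derivatives and pointwise
convergence. -/
lemma energyOn_le_of_tendsto (hW : Continuous W) {V : ℕ → ℝ → Vec N} {U : ℝ → Vec N}
    {G : ℕ → Lp (Vec N) 2 (volume : Measure ℝ)} {Y : Lp (Vec N) 2 (volume : Measure ℝ)}
    {m : ENNReal} (hV : ∀ i, Continuous (V i)) (hW0 : ∀ i x, 0 ≤ W (V i x))
    (hU : ∀ x, Tendsto (fun i => V i x) atTop (𝓝 (U x)))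
    (hG : ∀ z, Tendsto (fun i => inner ℝ (G i) z) atTop (𝓝 (inner ℝ Y z)))
    (hE : Tendsto (fun i => energyOn W (V i) (G i) univ) atTop (𝓝 m)) :
    energyOn W U Y univ ≤ m := by
  have hU0 : ∀ x, 0 ≤ W (U x) := fun x =>
    ge_of_tendsto' ((hW.tendsto _).comp (hU x)) fun i => hW0 i x
  have hsplit : ∀ (Z : Lp (Vec N) 2 (volume : Measure ℝ)) (X : ℝ → Vec N), (∀ x, 0 ≤ W (X x)) →
      energyOn W X Z univ = ENNReal.ofReal (‖Z‖ ^ 2 / 2) + ∫⁻ x, ENNReal.ofReal (W (X x)) := by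
    intro Z X hX
    rw [energyOn, Measure.restrict_univ, ← ofReal_norm_sq_eq_lintegral, ← lintegral_add_left']
    · exact lintegral_congr fun x => ENNReal.ofReal_add (by positivity) (hX x)
    · exact (((Lp.aestronglyMeasurable Z).norm.aemeasurable.pow_const 2).div_const 2).ennreal_ofReal
  rw [hsplit Y U hU0]
  have hfatou : ∫⁻ x, ENNReal.ofReal (W (U x))
      ≤ liminf (fun i => ∫⁻ x, ENNReal.ofReal (W (V i x))) atTop := by
    refine le_trans (le_of_eq ?_) (lintegral_liminf_le fun i =>
      (hW.comp (hV i)).measurable.ennreal_ofReal)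
    exact lintegral_congr fun x =>
      ((ENNReal.tendsto_ofReal ((hW.tendsto _).comp (hU x))).liminf_eq).symm
  -- The tangent bound `‖G‖²/2 ≥ ⟨G, Y⟩ - ‖Y‖²/2` replaces the convex kinetic term by one that is
  -- weakly continuous.
  have hnorm : Tendsto (fun i => ENNReal.ofReal (inner ℝ (G i) Y - ‖Y‖ ^ 2 / 2)) atTop
      (𝓝 (ENNReal.ofReal (‖Y‖ ^ 2 / 2))) := by
    refine ENNReal.tendsto_ofReal ?_
    have := (hG Y).sub_const (‖Y‖ ^ 2 / 2)
    rw [real_inner_self_eq_norm_sq] at this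
    convert this using 2
    ring
  refine (add_le_add hnorm.liminf_eq.ge hfatou).trans
    ((ENNReal.liminf_add_liminf_le _ _).trans (le_trans ?_ hE.liminf_eq.le))
  refine liminf_le_liminf (Eventually.of_forall fun i => ?_)
  rw [hsplit (G i) (V i) (hW0 i)]
  refine add_le_add_left (ENNReal.ofReal_le_ofReal ?_) _
  have h1 := real_inner_le_norm (G i) Y
  nlinarith [sq_nonneg (‖G i‖ - ‖Y‖)]

end lowerSemicontinuity

lemma memLp_of_lintegral_ofReal_rpow {E : Type*} [NormedAddCommGroup E] {f : ℝ → E} {p : ℝ}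
    (hp : 0 < p) (hf : AEStronglyMeasurable f)
    (h : ∫⁻ x, ENNReal.ofReal (‖f x‖ ^ p) < ⊤) : MemLp f (ENNReal.ofReal p) := by
  refine ⟨hf, (eLpNorm_lt_top_iff_lintegral_rpow_enorm_lt_top (ENNReal.ofReal_pos.2 hp).ne'
    ENNReal.ofReal_ne_top).2 ?_⟩
  rw [ENNReal.toReal_ofReal hp.le]
  refine lt_of_eq_of_lt (lintegral_congr fun x => ?_) h
  rw [← ENNReal.ofReal_rpow_of_nonneg (norm_nonneg _) hp.le, ofReal_norm]

lemma norm_sub_rpow_le_two_rpow {E : Type*} [NormedAddCommGroup E] (a b : E) {p : ℝ}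
    (hp : 0 < p) : ‖a - b‖ ^ p ≤ 2 ^ p * (‖a‖ ^ p + ‖b‖ ^ p) := by
  have h1 : ‖a - b‖ ≤ 2 * max ‖a‖ ‖b‖ := by
    have := norm_sub_le a b
    linarith [le_max_left ‖a‖ ‖b‖, le_max_right ‖a‖ ‖b‖]
  refine (Real.rpow_le_rpow (norm_nonneg _) h1 hp.le).trans ?_
  rw [Real.mul_rpow two_pos.le (by positivity)]
  gcongr
  rcases max_choice ‖a‖ ‖b‖ with h | h <;> rw [h]
  · linarith [Real.rpow_nonneg (norm_nonneg b) p]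
  · linarith [Real.rpow_nonneg (norm_nonneg a) p]

/-! ### Compactness of minimizing sequences -/

namespace WellData

variable {N : ℕ} {W : Vec N → ℝ} {am ap : Vec N} {α₀ w₀ γ : ℝ} {K : Set (Vec N)}
variable (D : WellData W am ap α₀ w₀ γ K)
include D

/-- Compactness of minimizing sequences up to translations. -/
lemma exists_limit {U g : ℕ → ℝ → Vec N} (hU : ∀ i, IsCompetitor am ap γ K (U i) (g i))
    (hE : Tendsto (fun i => energyOn W (U i) (g i) univ) atTop (𝓝 (minEnergy W am ap γ K))) :
    ∃ (s : ℕ → ℝ) (σ : ℕ → ℕ) (V v : ℝ → Vec N), StrictMono σ ∧ IsCompetitor am ap γ K V v ∧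
      energyOn W V v univ = minEnergy W am ap γ K ∧
      TendstoWeakly am ap γ (fun i => shiftRight (U (σ i)) (s (σ i))) V := by
  set m := minEnergy W am ap γ K with hm
  have hmtop : m ≠ ⊤ := D.minEnergy_ne_top
  have hγ := D.gamma_pos
  have hev : ∀ᶠ i in atTop, 2 * energyOn W (U i) (g i) univ ≤ 3 * m := by
    have h1 : Tendsto (fun i => 2 * energyOn W (U i) (g i) univ) atTop (𝓝 (2 * m)) :=
      ENNReal.Tendsto.const_mul hE (Or.inr (by simp))
    refine (h1.eventually (gt_mem_nhds ?_)).mono fun i hi => hi.le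
    calc 2 * m < 2 * m + m := ENNReal.lt_add_right (ENNReal.mul_ne_top (by simp) hmtop)
          D.minEnergy_ne_zero
      _ = 3 * m := by ring
  obtain ⟨i₀, hi₀⟩ := eventually_atTop.1 hev
  obtain ⟨C, R, hC, hcen⟩ := D.exists_center
  -- Early terms with large action get the dummy centre `0`; they are discarded by starting the
  -- subsequence at `i₀`.
  have hcen' : ∀ i, ∃ s, 2 * energyOn W (U i) (g i) univ ≤ 3 * m → ∀ x, ‖U i x‖ ≤ R ∧
      (s < x → ‖U i x - ap‖ ^ γ ≤ C * W (U i x)) ∧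
      (x < s → ‖U i x - am‖ ^ γ ≤ C * W (U i x)) := by
    intro i
    by_cases h : 2 * energyOn W (U i) (g i) univ ≤ 3 * m
    · obtain ⟨s, hs⟩ := hcen (U i) (g i) (hU i) h
      exact ⟨s, fun _ => hs⟩
    · exact ⟨0, fun h' => absurd h' h⟩
  choose c hc using hcen'
  set X : ℕ → ℝ → Vec N := fun i x => U i (x - (-c i)) with hX
  set Z : ℕ → ℝ → Vec N := fun i x => g i (x - (-c i)) with hZ
  have hXc : ∀ i, IsCompetitor am ap γ K (X i) (Z i) := fun i => (hU i).comp_sub_right _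
  have hXE : ∀ i, energyOn W (X i) (Z i) univ = energyOn W (U i) (g i) univ :=
    fun i => energyOn_comp_sub_right _
  have hXR : ∀ i, i₀ ≤ i → ∀ x, ‖X i x‖ ≤ R := fun i hi x => (hc i (hi₀ i hi) _).1
  set G : ℕ → Lp (Vec N) 2 (volume : Measure ℝ) := fun i => (hXc i).memLp_deriv.toLp with hG
  have hGZ : ∀ i, (G i : ℝ → Vec N) =ᵐ[volume] Z i := fun i => MemLp.coeFn_toLp _
  have hGE : ∀ i, energyOn W (X i) (G i) univ = energyOn W (U i) (g i) univ := fun i => by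
    rw [← hXE i, energyOn_congr_ae (hGZ i)]
  have hle : ∀ i, i₀ ≤ i → energyOn W (U i) (g i) univ ≤ 3 * m := fun i hi =>
    le_trans (by rw [two_mul]; exact le_self_add) (hi₀ i hi)
  have h3m : 3 * m ≠ ⊤ := ENNReal.mul_ne_top (by simp) hmtop
  have hGR : ∀ i, i₀ ≤ i → ‖G i‖ ≤ Real.sqrt (2 * (3 * m).toReal) := by
    intro i hi
    refine Real.le_sqrt_of_sq_le ?_
    have h1 : ENNReal.ofReal (‖G i‖ ^ 2 / 2) ≤ 3 * m := by
      refine le_trans ?_ ((hGE i).le.trans (hle i hi))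
      rw [← ofReal_norm_sq_eq_lintegral, energyOn, Measure.restrict_univ]
      refine lintegral_mono fun x => ENNReal.ofReal_le_ofReal ?_
      linarith [D.nonneg _ ((hXc i).mem x)]
    rw [ENNReal.ofReal_le_iff_le_toReal h3m] at h1
    linarith
  -- Two extractions: the values at `0` converge, then the derivatives converge weakly. Together
  -- they determine the pointwise limit by integration.
  obtain ⟨b, -, σ₁, hσ₁, hb⟩ := tendsto_subseq_of_bounded (Metric.isBounded_closedBall
    (x := (0 : Vec N)) (r := R)) (x := fun i => X (i₀ + i) 0) (fun i => by
      simpa using hXR (i₀ + i) (Nat.le_add_right _ _) 0)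
  have : Fact ((2 : ENNReal) ≠ ⊤) := ⟨by simp⟩
  obtain ⟨Y, σ₂, hσ₂, hY⟩ := exists_weakly_convergent_subseq (x := fun i => G (i₀ + σ₁ i))
    (fun i => hGR _ (Nat.le_add_right _ _))
  set σ : ℕ → ℕ := fun i => i₀ + σ₁ (σ₂ i) with hσ
  have hσmono : StrictMono σ := fun i j hij => Nat.add_lt_add_left (hσ₁ (hσ₂ hij)) i₀
  have hσi : ∀ i, i₀ ≤ σ i := fun i => Nat.le_add_right _ _
  have hYm : MemLp (Y : ℝ → Vec N) 2 := Lp.memLp Y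
  have hYloc : LocallyIntegrable (Y : ℝ → Vec N) := hYm.locallyIntegrable one_le_two
  set V : ℝ → Vec N := fun x => b + ∫ t in (0 : ℝ)..x, Y t with hVdef
  have hVd : HasIntDeriv V Y := by
    refine ⟨hYloc, fun x y => ?_⟩
    simp only [hVdef, add_sub_add_left_eq_sub]
    exact intervalIntegral.integral_interval_sub_left
      (LocallyIntegrable.intervalIntegrable' hYloc _ _)
      (LocallyIntegrable.intervalIntegrable' hYloc _ _)
  have hlim : ∀ x, Tendsto (fun i => X (σ i) x) atTop (𝓝 (V x)) := by
    intro x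
    have h1 := (hb.comp hσ₂.tendsto_atTop).add (tendsto_intervalIntegral_of_weakly hY 0 x)
    refine h1.congr fun i => ?_
    have h2 := (hXc (σ i)).deriv.eq 0 x
    have h3 : ∫ t in (0 : ℝ)..x, G (σ i) t = ∫ t in (0 : ℝ)..x, Z (σ i) t :=
      intervalIntegral.integral_congr_ae ((hGZ (σ i)).mono fun t ht _ => ht)
    change X (σ i) 0 + ∫ t in (0 : ℝ)..x, G (σ i) t = X (σ i) x
    rw [h3, ← h2]; abel
  have hVK : ∀ x, V x ∈ K := fun x =>
    D.closed.mem_of_tendsto (hlim x) (Eventually.of_forall fun i => (hXc (σ i)).mem x)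
  obtain ⟨B, hB, hXB⟩ : ∃ B : ENNReal, B ≠ ⊤ ∧
      ∀ i, ∫⁻ x, ENNReal.ofReal (‖X (σ i) x - Uaff am ap x‖ ^ γ) ≤ B := by
    refine ⟨ENNReal.ofReal C * (3 * m) + ENNReal.ofReal ((R + (‖am‖ + ‖ap‖)) ^ γ) * 2, ?_,
      fun i => ?_⟩
    · exact ENNReal.add_ne_top.2 ⟨ENNReal.mul_ne_top ENNReal.ofReal_ne_top h3m,
        ENNReal.mul_ne_top ENNReal.ofReal_ne_top (by simp)⟩
    · refine (lintegral_rpow_sub_Uaff_le (W := W) (v := Z (σ i)) hγ hC (hXR _ (hσi i)) (fun x hx => ?_)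
        (fun x hx => ?_)).trans ?_
      · exact (hc (σ i) (hi₀ _ (hσi i)) _).2.1 (by linarith)
      · exact (hc (σ i) (hi₀ _ (hσi i)) _).2.2 (by linarith)
      · gcongr
        rw [hXE]
        exact hle _ (hσi i)
  -- Fatou's lemma passes the uniform `L^γ` bound to the limit, which keeps its asymptotic values
  -- from being lost.
  have hVB : ∫⁻ x, ENNReal.ofReal (‖V x - Uaff am ap x‖ ^ γ) ≤ B := by
    have hcont : ∀ i, Continuous fun x => X (σ i) x - Uaff am ap x := fun i =>
      (hXc (σ i)).deriv.continuous.sub (continuous_Uaff am ap)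
    calc ∫⁻ x, ENNReal.ofReal (‖V x - Uaff am ap x‖ ^ γ)
        = ∫⁻ x, liminf (fun i => ENNReal.ofReal (‖X (σ i) x - Uaff am ap x‖ ^ γ)) atTop := by
          refine lintegral_congr fun x => ?_
          refine ((ENNReal.tendsto_ofReal ?_).liminf_eq).symm
          exact (((hlim x).sub_const _).norm).rpow_const (Or.inr hγ.le)
      _ ≤ liminf (fun i => ∫⁻ x, ENNReal.ofReal (‖X (σ i) x - Uaff am ap x‖ ^ γ)) atTop :=
          lintegral_liminf_le fun i =>
            ((hcont i).norm.measurable.pow_const γ).ennreal_ofReal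
      _ ≤ B := by
          refine liminf_le_of_le (by isBoundedDefault) fun b hb => ?_
          obtain ⟨i, hi⟩ := hb.exists
          exact hi.trans (hXB i)
  have hVc : IsCompetitor am ap γ K V Y :=
    ⟨hVd, memLp_of_lintegral_ofReal_rpow hγ
      (hVd.continuous.sub (continuous_Uaff am ap)).aestronglyMeasurable
      (hVB.trans_lt hB.lt_top), hYm, hVK⟩
  refine ⟨fun i => -c i, σ, V, Y, hσmono, hVc, le_antisymm ?_ hVc.minEnergy_le,
    fun i => (hXc (σ i)).mem_competitors.1, hVc.mem_competitors.1, fun φ hφ => ?_,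
    fun ψ hψ => ?_⟩
  · refine energyOn_le_of_tendsto D.continuous (fun i => (hXc (σ i)).deriv.continuous)
      (fun i x => D.nonneg _ ((hXc (σ i)).mem x)) hlim hY ?_
    refine (hE.comp hσmono.tendsto_atTop).congr fun i => ?_
    exact (hGE (σ i)).symm
  · have h1γ : 1 < γ := by linarith [D.hypA1.two_le_gamma]
    refine tendsto_integral_inner_of_bounded (Real.HolderConjugate.conjExponent h1γ)
      (B := ENNReal.ofReal (2 ^ γ) * (B + B)) (fun i => ?_) ?_ (fun i => ?_) (fun x => ?_) hφ
    · exact ((hXc (σ i)).deriv.continuous.sub hVd.continuous).aestronglyMeasurable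
    · exact ENNReal.mul_ne_top ENNReal.ofReal_ne_top (ENNReal.add_ne_top.2 ⟨hB, hB⟩)
    · calc ∫⁻ x, ENNReal.ofReal (‖X (σ i) x - V x‖ ^ γ)
          ≤ ∫⁻ x, ENNReal.ofReal (2 ^ γ) *
            (ENNReal.ofReal (‖X (σ i) x - Uaff am ap x‖ ^ γ)
              + ENNReal.ofReal (‖V x - Uaff am ap x‖ ^ γ)) := by
            refine lintegral_mono fun x => ?_
            rw [← ENNReal.ofReal_add (by positivity) (by positivity),
              ← ENNReal.ofReal_mul (by positivity)]
            refine ENNReal.ofReal_le_ofReal ?_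
            have := norm_sub_rpow_le_two_rpow (X (σ i) x - Uaff am ap x) (V x - Uaff am ap x) hγ
            rwa [sub_sub_sub_cancel_right] at this
        _ ≤ ENNReal.ofReal (2 ^ γ) * (B + B) := by
            rw [lintegral_const_mul' _ _ ENNReal.ofReal_ne_top, lintegral_add_left]
            · gcongr
              exact hXB i
            · exact (((hXc (σ i)).deriv.continuous.sub
                (continuous_Uaff am ap)).norm.measurable.pow_const γ).ennreal_ofReal
    · have := (hlim x).sub_const (V x)
      rwa [sub_self] at this
  · have h1 := (hY hψ.toLp).sub_const (inner ℝ Y hψ.toLp)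
    rw [sub_self] at h1
    refine h1.congr fun i => ?_
    rw [← inner_sub_left, L2.inner_def]
    refine integral_congr_ae ?_
    filter_upwards [hψ.coeFn_toLp, Lp.coeFn_sub (G (i₀ + σ₁ (σ₂ i))) Y,
      (hXc (σ i)).deriv.weakDeriv_ae, hVd.weakDeriv_ae, hGZ (σ i)] with x h2 h3 h4 h5 h6
    rw [h2, h3, Pi.sub_apply, h5]
    congr 2
    exact h6.trans h4.symm

end WellData

/-! ### First variation and the Euler-Lagrange equation -/

lemma continuous_gradient {F : Type*} [NormedAddCommGroup F] [InnerProductSpace ℝ F]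
    [CompleteSpace F] {f : F → ℝ} (hf : ContDiff ℝ 2 f) : Continuous (gradient f) :=
  (InnerProductSpace.toDual ℝ F).symm.continuous.comp (hf.continuous_fderiv (by norm_num))

/-- The difference quotients of `f` along a ray converge to the directional derivative. -/
lemma tendsto_slope_gradient {F : Type*} [NormedAddCommGroup F] [InnerProductSpace ℝ F]
    [CompleteSpace F] {f : F → ℝ} {u : F} (hf : DifferentiableAt ℝ f u) (w : F) :
    Tendsto (fun t : ℝ => (f (u + t • w) - f u) / t) (𝓝[>] 0) (𝓝 (inner ℝ (gradient f u) w)) := by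
  have h1 : HasDerivAt (fun t : ℝ => f (u + t • w)) (fderiv ℝ f u w) 0 := by
    have h2 : HasDerivAt (fun t : ℝ => u + t • w) w 0 := by
      simpa using ((hasDerivAt_id (0 : ℝ)).smul_const w).const_add u
    have h3 : HasFDerivAt f (fderiv ℝ f u) (u + (0 : ℝ) • w) := by
      simpa using hf.hasFDerivAt
    exact h3.comp_hasDerivAt 0 h2
  rw [inner_gradient_left]
  have h4 := (hasDerivAt_iff_tendsto_slope.1 h1).mono_left
    (nhdsWithin_mono _ (fun t (ht : 0 < t) => ht.ne'))
  refine h4.congr fun t => ?_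
  simp [slope_def_field]

lemma exists_lipschitz_on_ball {N : ℕ} {W : Vec N → ℝ} (hW : ContDiff ℝ 2 W) (r : ℝ) :
    ∃ L : ℝ, 0 ≤ L ∧ ∀ u v : Vec N, ‖u‖ ≤ r → ‖v‖ ≤ r → |W u - W v| ≤ L * ‖u - v‖ := by
  obtain ⟨L, hL⟩ := (isCompact_closedBall (0 : Vec N) r).exists_bound_of_continuousOn
    (hW.continuous_fderiv (by norm_num)).continuousOn
  refine ⟨max L 0, le_max_right _ _, fun u v hu hv => ?_⟩
  have := (convex_closedBall (0 : Vec N) r).norm_image_sub_le_of_norm_fderiv_le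
    (𝕜 := ℝ) (f := W) (fun x _ => hW.differentiable (by norm_num) x)
    (fun x hx => (hL x hx).trans (le_max_left L 0)) (x := v) (y := u) (by simpa using hv)
    (by simpa using hu)
  simpa using this

namespace WellData

variable {N : ℕ} {W : Vec N → ℝ} {am ap : Vec N} {α₀ w₀ γ : ℝ} {K : Set (Vec N)}
variable {U g φ ψ : ℝ → Vec N} (D : WellData W am ap α₀ w₀ γ K)
include D

lemma integrable_energy (h : IsCompetitor am ap γ K U g) (hE : energyOn W U g univ ≠ ⊤) :
    Integrable fun x => ‖g x‖ ^ 2 / 2 + W (U x) := by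
  have hm : AEStronglyMeasurable fun x => ‖g x‖ ^ 2 / 2 + W (U x) :=
    ((h.memLp_deriv.1.norm.pow 2).mul_const 2⁻¹).add
      (D.continuous.comp h.deriv.continuous).aestronglyMeasurable
  refine ⟨hm, (hasFiniteIntegral_iff_ofReal (ae_of_all _ fun x => ?_)).2 ?_⟩
  · exact add_nonneg (by positivity) (D.nonneg _ (h.mem x))
  · rw [energyOn, Measure.restrict_univ] at hE
    exact hE.lt_top

lemma ofReal_integral_energy (h : IsCompetitor am ap γ K U g)
    (hE : energyOn W U g univ ≠ ⊤) :
    ENNReal.ofReal (∫ x, (‖g x‖ ^ 2 / 2 + W (U x))) = energyOn W U g univ := by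
  rw [ofReal_integral_eq_lintegral_ofReal (D.integrable_energy h hE)
    (ae_of_all _ fun x => add_nonneg (by positivity) (D.nonneg _ (h.mem x))), energyOn,
    Measure.restrict_univ]

/-- Comparison of a minimizer with the projection onto `K` of a perturbation. -/
lemma variation_nonneg {P : Vec N → Vec N} (hPK : ∀ u, P u ∈ K) (hPid : ∀ u ∈ K, P u = u)
    (hPlip : ∀ u v, ‖P u - P v‖ ≤ ‖u - v‖)
    (h : IsCompetitor am ap γ K U g) (hmin : energyOn W U g univ = minEnergy W am ap γ K)
    (hφ : HasIntDeriv φ ψ) (hφc : HasCompactSupport φ) (hψ : MemLp ψ 2) (t : ℝ) :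
    0 ≤ t * (∫ x, inner ℝ (g x) (ψ x)) + t ^ 2 / 2 * (∫ x, ‖ψ x‖ ^ 2)
      + ∫ x, (W (P (U x + t • φ x)) - W (U x)) := by
  have hd := h.deriv.add (hφ.const_smul t)
  -- The projection is nonexpansive, so the kinetic term of the projected path is at most that of `U
  -- + t • φ`.
  obtain ⟨v, hv, hvle⟩ := hd.of_norm_sub_le (V := fun x => P (U x + t • φ x))
    (fun x y => hPlip _ _)
  have hz : ∀ x, φ x = 0 → P (U x + t • φ x) = U x := fun x hx => by
    rw [hx, smul_zero, add_zero, hPid _ (h.mem x)]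
  have hgψ : MemLp (fun x => g x + t • ψ x) 2 := h.memLp_deriv.add (hψ.const_smul t)
  have hcomp : IsCompetitor am ap γ K (fun x => P (U x + t • φ x)) v := by
    refine ⟨hv, ?_, hgψ.mono hv.loc.aestronglyMeasurable hvle, fun x => hPK _⟩
    have h1 : MemLp (fun x => P (U x + t • φ x) - U x) (ENNReal.ofReal γ) := by
      refine (hv.continuous.sub h.deriv.continuous).memLp_of_hasCompactSupport ?_
      refine hφc.mono fun x hx => ?_
      contrapose! hx
      simp only [Function.mem_support, not_not] at hx
      simp [hz x hx]
    refine (memLp_congr_ae (ae_of_all _ fun x => ?_)).1 (h1.add h.memLp_sub)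
    simp
  have hEtop : energyOn W U g univ ≠ ⊤ := hmin ▸ D.minEnergy_ne_top
  have hi0 := D.integrable_energy h hEtop
  have hi1 : Integrable fun x => inner ℝ (g x) (ψ x) := by
    refine (integrable_congr ?_).1 (L2.integrable_inner (𝕜 := ℝ) h.memLp_deriv.toLp hψ.toLp)
    filter_upwards [h.memLp_deriv.coeFn_toLp, hψ.coeFn_toLp] with x h1 h2
    rw [h1, h2]
  have hi2 : Integrable fun x => ‖ψ x‖ ^ 2 := (memLp_two_iff_integrable_sq_norm hψ.1).1 hψ
  have hi3 : Integrable fun x => W (P (U x + t • φ x)) - W (U x) := by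
    refine Continuous.integrable_of_hasCompactSupport
      ((D.continuous.comp hv.continuous).sub (D.continuous.comp h.deriv.continuous)) ?_
    refine hφc.mono fun x hx => ?_
    contrapose! hx
    simp only [Function.mem_support, not_not] at hx
    simp [hz x hx]
  have hpt : ∀ x, ‖g x + t • ψ x‖ ^ 2 / 2 + W (P (U x + t • φ x))
      = (‖g x‖ ^ 2 / 2 + W (U x)) + (t * inner ℝ (g x) (ψ x) + t ^ 2 / 2 * ‖ψ x‖ ^ 2
        + (W (P (U x + t • φ x)) - W (U x))) := by
    intro x
    rw [norm_add_sq_real, inner_smul_right, norm_smul, mul_pow, Real.norm_eq_abs, sq_abs]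
    ring
  have hi12 : Integrable fun x => t * inner ℝ (g x) (ψ x) + t ^ 2 / 2 * ‖ψ x‖ ^ 2 :=
    (hi1.const_mul t).add (hi2.const_mul (t ^ 2 / 2))
  have hi4 : Integrable fun x => t * inner ℝ (g x) (ψ x) + t ^ 2 / 2 * ‖ψ x‖ ^ 2
        + (W (P (U x + t • φ x)) - W (U x)) :=
    hi12.add hi3
  have hi5 : Integrable fun x => ‖g x + t • ψ x‖ ^ 2 / 2 + W (P (U x + t • φ x)) := by
    simp only [hpt]; exact hi0.add hi4
  have hle : ENNReal.ofReal (∫ x, (‖g x‖ ^ 2 / 2 + W (U x)))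
      ≤ ENNReal.ofReal (∫ x, (‖g x + t • ψ x‖ ^ 2 / 2 + W (P (U x + t • φ x)))) := by
    rw [D.ofReal_integral_energy h hEtop, hmin, ofReal_integral_eq_lintegral_ofReal hi5
      (ae_of_all _ fun x => add_nonneg (by positivity) (D.nonneg _ (hPK _)))]
    refine hcomp.minEnergy_le.trans ?_
    rw [energyOn, Measure.restrict_univ]
    refine lintegral_mono_ae (hvle.mono fun x hx => ENNReal.ofReal_le_ofReal ?_)
    gcongr
  rw [ENNReal.ofReal_le_ofReal_iff (integral_nonneg fun x =>
    add_nonneg (by positivity) (D.nonneg _ (hPK _)))] at hle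
  simp only [hpt] at hle
  rw [integral_add hi0 hi4, integral_add hi12 hi3,
    integral_add (hi1.const_mul t) (hi2.const_mul (t ^ 2 / 2)), integral_const_mul,
    integral_const_mul] at hle
  linarith

/-- First variation inequality: on the set `S` the minimizer may touch the boundary of `K`. -/
lemma first_variation_nonneg (h : IsCompetitor am ap γ K U g)
    (hmin : energyOn W U g univ = minEnergy W am ap γ K)
    (hφ : HasIntDeriv φ ψ) (hφc : HasCompactSupport φ) (hψ : MemLp ψ 2)
    {S : Set ℝ} (hS : MeasurableSet S) (hS1 : ∀ x ∈ S, U x ∈ frontier K)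
    (hS2 : ∀ x ∉ S, ∀ᶠ t in 𝓝[>] (0 : ℝ), U x + t • φ x ∈ K) :
    0 ≤ (∫ x, inner ℝ (g x) (ψ x)) + ∫ x in Sᶜ, inner ℝ (gradient W (U x)) (φ x) := by
  obtain ⟨P, hPK, hPid, hPlip, -⟩ := exists_convex_projection ⟨am, D.minus_mem_K⟩ D.closed D.convex
  have hφcont := hφ.continuous
  have hUc := h.deriv.continuous
  have hPc : Continuous P := (LipschitzWith.of_dist_le_mul (K := 1) fun u v => by
    simpa [dist_eq_norm] using hPlip u v).continuous
  obtain ⟨B, hB⟩ := hφc.exists_bound_of_continuous hφcont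
  obtain ⟨R, hR⟩ := hφc.isCompact.exists_bound_of_continuousOn hUc.continuousOn
  obtain ⟨L, hL0, hL⟩ := exists_lipschitz_on_ball D.smooth (R + B)
  have hB0 : 0 ≤ B := (norm_nonneg _).trans (hB 0)
  -- Difference quotients of the potential term, cut off on `S`: there `W` is already maximal over
  -- `K`, so the discarded contribution is nonpositive.
  set Q : ℝ → ℝ → ℝ := fun t x => Sᶜ.indicator
    (fun x => (W (P (U x + t • φ x)) - W (U x)) / t) x with hQ
  have hdist : ∀ t, 0 < t → ∀ x, ‖P (U x + t • φ x) - U x‖ ≤ t * ‖φ x‖ := by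
    intro t ht x
    have := hPlip (U x + t • φ x) (U x)
    rwa [hPid _ (h.mem x), add_sub_cancel_left, norm_smul, Real.norm_of_nonneg ht.le] at this
  have hbound : ∀ t ∈ Ioc (0 : ℝ) 1, ∀ x, ‖Q t x‖ ≤ L * ‖φ x‖ := by
    intro t ht x
    by_cases hx : x ∈ tsupport φ
    · have h1 := hdist t ht.1 x
      have h2 : t * ‖φ x‖ ≤ B := (mul_le_of_le_one_left (norm_nonneg _) ht.2).trans (hB x)
      have h3 : ‖P (U x + t • φ x)‖ ≤ R + B := by
        have := norm_add_le (U x) (P (U x + t • φ x) - U x)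
        rw [add_sub_cancel] at this
        linarith [hR x hx]
      have h4 := hL _ (U x) h3 (by linarith [hR x hx])
      have h5 : ‖(W (P (U x + t • φ x)) - W (U x)) / t‖ ≤ L * ‖φ x‖ := by
        rw [norm_div, Real.norm_eq_abs, Real.norm_of_nonneg ht.1.le, div_le_iff₀ ht.1]
        refine h4.trans ?_
        have := mul_le_mul_of_nonneg_left h1 hL0
        linarith
      refine (norm_indicator_le_norm_self _ _).trans h5
    · have h1 : φ x = 0 := image_eq_zero_of_notMem_tsupport hx
      have h2 : Q t x = 0 := by
        simp only [hQ]
        by_cases hxS : x ∈ Sᶜ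
        · rw [indicator_of_mem hxS, h1, smul_zero, add_zero, hPid _ (h.mem x), sub_self, zero_div]
        · rw [indicator_of_notMem hxS]
      rw [h2, norm_zero]; positivity
  have hQm : ∀ t, AEStronglyMeasurable (Q t) := by
    intro t
    refine AEStronglyMeasurable.indicator ?_ hS.compl
    have : Continuous fun x => (W (P (U x + t • φ x)) - W (U x)) / t :=
      ((D.continuous.comp (hPc.comp (hUc.add (hφcont.const_smul t)))).sub
        (D.continuous.comp hUc)).div_const t
    exact this.aestronglyMeasurable
  have hφi : Integrable fun x => L * ‖φ x‖ :=
    (hφcont.integrable_of_hasCompactSupport hφc).norm.const_mul L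
  have hlim : Tendsto (fun t => ∫ x, Q t x) (𝓝[>] 0)
      (𝓝 (∫ x, Sᶜ.indicator (fun x => inner ℝ (gradient W (U x)) (φ x)) x)) := by
    refine tendsto_integral_filter_of_dominated_convergence _ (Eventually.of_forall hQm)
      ?_ hφi (ae_of_all _ fun x => ?_)
    · filter_upwards [Ioc_mem_nhdsGT (show (0 : ℝ) < 1 from one_pos)] with t ht
      exact ae_of_all _ (hbound t ht)
    · by_cases hx : x ∈ S
      · have hx' : x ∉ Sᶜ := fun h => h hx
        simp only [hQ, indicator_of_notMem hx']
        exact tendsto_const_nhds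
      · have hx' : x ∈ Sᶜ := hx
        simp only [hQ, indicator_of_mem hx']
        refine (tendsto_slope_gradient
          (D.smooth.differentiable (by norm_num) (U x)) (φ x)).congr' ?_
        filter_upwards [hS2 x hx] with t ht
        rw [hPid _ ht]
  rw [← integral_indicator hS.compl]
  have hlim2 : Tendsto (fun t : ℝ => (∫ x, inner ℝ (g x) (ψ x)) + t / 2 * (∫ x, ‖ψ x‖ ^ 2)
      + ∫ x, Q t x) (𝓝[>] 0) (𝓝 ((∫ x, inner ℝ (g x) (ψ x)) + 0 / 2 * (∫ x, ‖ψ x‖ ^ 2)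
      + ∫ x, Sᶜ.indicator (fun x => inner ℝ (gradient W (U x)) (φ x)) x)) := by
    refine Tendsto.add (tendsto_const_nhds.add ?_) hlim
    have : Continuous fun t : ℝ => t / 2 * (∫ x, ‖ψ x‖ ^ 2) := by fun_prop
    exact (this.tendsto 0).mono_left nhdsWithin_le_nhds
  rw [zero_div, zero_mul, add_zero] at hlim2
  refine ge_of_tendsto hlim2 ?_
  filter_upwards [Ioc_mem_nhdsGT (show (0 : ℝ) < 1 from one_pos)] with t ht
  have h1 := D.variation_nonneg hPK hPid hPlip h hmin hφ hφc hψ t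
  have h2 : ∫ x, (W (P (U x + t • φ x)) - W (U x)) ≤ ∫ x, t * Q t x := by
    refine integral_mono ?_ ((hφi.mono' (hQm t) (ae_of_all _ (hbound t ht))).const_mul t) ?_
    · refine Continuous.integrable_of_hasCompactSupport
        ((D.continuous.comp (hPc.comp (hUc.add (hφcont.const_smul t)))).sub
          (D.continuous.comp hUc)) ?_
      refine hφc.mono fun x hx => ?_
      contrapose! hx
      simp only [Function.mem_support, not_not] at hx
      simp [hx, hPid _ (h.mem x)]
    · intro x
      by_cases hx : x ∈ S
      · have hx' : x ∉ Sᶜ := fun h => h hx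
        simp only [hQ, indicator_of_notMem hx', mul_zero]
        linarith [D.frontier_max _ (hS1 x hx) _ (hPK (U x + t • φ x))]
      · have hx' : x ∈ Sᶜ := hx
        simp only [hQ, indicator_of_mem hx']
        rw [mul_div_cancel₀ _ ht.1.ne']
  rw [integral_const_mul] at h2
  have h3 : 0 ≤ t * ((∫ x, inner ℝ (g x) (ψ x)) + t / 2 * (∫ x, ‖ψ x‖ ^ 2) + ∫ x, Q t x) := by
    calc 0 ≤ _ := h1
      _ ≤ t * (∫ x, inner ℝ (g x) (ψ x)) + t ^ 2 / 2 * (∫ x, ‖ψ x‖ ^ 2) + t * ∫ x, Q t x := by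
          linarith
      _ = _ := by ring
  exact nonneg_of_mul_nonneg_right h3 ht.1

end WellData

lemma HasIntDeriv.hasDerivAt {N : ℕ} {U g : ℝ → Vec N} (hU : HasIntDeriv U g) (hg : Continuous g)
    (x : ℝ) : HasDerivAt U (g x) x := by
  have h : U = fun x => U 0 + ∫ t in (0 : ℝ)..x, g t := by
    funext x; rw [← hU.eq]; abel
  rw [h]
  exact ((hg.integral_hasStrictDerivAt 0 x).hasDerivAt).const_add _

namespace WellData

variable {N : ℕ} {W : Vec N → ℝ} {am ap : Vec N} {α₀ w₀ γ : ℝ} {K : Set (Vec N)}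
variable {U g φ ψ : ℝ → Vec N} (D : WellData W am ap α₀ w₀ γ K)
include D

/-- Away from the boundary of `K` the Euler-Lagrange equation holds, while the contact set does
not contribute. -/
lemma first_variation_eq_zero (h : IsCompetitor am ap γ K U g)
    (hmin : energyOn W U g univ = minEnergy W am ap γ K)
    (hφ : HasIntDeriv φ ψ) (hφc : HasCompactSupport φ) (hψ : MemLp ψ 2) :
    (∫ x, inner ℝ (g x) (ψ x))
      + ∫ x in (U ⁻¹' frontier K)ᶜ, inner ℝ (gradient W (U x)) (φ x) = 0 := by
  have hS : MeasurableSet (U ⁻¹' frontier K) :=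
    (isClosed_frontier.preimage h.deriv.continuous).measurableSet
  have hev : ∀ (w : Vec N) (x : ℝ), x ∉ U ⁻¹' frontier K →
      ∀ᶠ t in 𝓝[>] (0 : ℝ), U x + t • w ∈ K := by
    intro w x hx
    have hint : U x ∈ interior K := by
      by_contra hn
      exact hx ⟨subset_closure (h.mem x), hn⟩
    have hc : Continuous fun t : ℝ => U x + t • w := by fun_prop
    have h1 : Tendsto (fun t : ℝ => U x + t • w) (𝓝[>] 0) (𝓝 (U x)) := by
      have := hc.tendsto 0
      simp only [zero_smul, add_zero] at this
      exact this.mono_left nhdsWithin_le_nhds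
    exact h1.eventually (mem_interior_iff_mem_nhds.1 hint)
  refine le_antisymm ?_ (D.first_variation_nonneg h hmin hφ hφc hψ hS (fun x hx => hx)
    (fun x hx => hev _ x hx))
  have hn : HasIntDeriv (fun x => -φ x) (fun x => -ψ x) := by simpa using hφ.const_smul (-1)
  have h2 := D.first_variation_nonneg h hmin hn hφc.neg hψ.neg hS (fun x hx => hx)
    (fun x hx => hev _ x hx)
  simp only [inner_neg_right, integral_neg] at h2
  linarith

/-- `∇W` vanishes almost everywhere on the contact set. -/
lemma gradient_eq_zero_on_contact (h : IsCompetitor am ap γ K U g)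
    (hmin : energyOn W U g univ = minEnergy W am ap γ K) :
    ∀ᵐ x, U x ∈ frontier K → gradient W (U x) = 0 := by
  have hamint : am ∈ interior K := D.minus_subset (D.minus_mem D.alpha_pos.le)
  have hUc := h.deriv.continuous
  have hS : MeasurableSet (U ⁻¹' frontier K) :=
    (isClosed_frontier.preimage hUc).measurableSet
  -- At a frontier point `W` is maximal over the convex set `K`, so no direction into `K` increases
  -- it to first order.
  have hdir : ∀ x, U x ∈ frontier K → ∀ v ∈ K, inner ℝ (gradient W (U x)) (v - U x) ≤ 0 := by
    intro x hx v hv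
    have h1 := tendsto_slope_gradient (D.smooth.differentiable (by norm_num) (U x)) (v - U x)
    refine le_of_tendsto h1 ?_
    filter_upwards [Ioc_mem_nhdsGT (show (0 : ℝ) < 1 from one_pos)] with t ht
    refine div_nonpos_of_nonpos_of_nonneg ?_ ht.1.le
    have h2 : U x + t • (v - U x) ∈ K := by
      have := D.convex (h.mem x) hv (sub_nonneg.2 ht.2) ht.1.le (sub_add_cancel 1 t)
      convert this using 1
      module
    linarith [D.frontier_max _ hx _ h2]
  have hae : ∀ n : ℕ, ∀ᵐ x, x ∈ Metric.closedBall (0 : ℝ) (n + 1) → U x ∈ frontier K →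
      inner ℝ (gradient W (U x)) (am - U x) = 0 := by
    intro n
    -- The cutoff equals one on the ball of radius `n + 1`; these balls exhaust the line.
    let η : ContDiffBump (0 : ℝ) := ⟨n + 1, n + 2, by positivity, by linarith⟩
    have hηd : ∀ x, HasDerivAt η (deriv η x) x := fun x =>
      ((η.contDiff (n := 1)).differentiable (by norm_num) x).hasDerivAt
    have hη' : Continuous (deriv η) := (η.contDiff (n := 1)).continuous_deriv (by norm_num)
    have hηc : HasCompactSupport η := η.hasCompactSupport
    have hφ := ((HasIntDeriv.const am).sub h.deriv).smul hηd hη'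
    have hφc : HasCompactSupport fun x => η x • (am - U x) := hηc.smul_right
    have hψ : MemLp (fun x => deriv η x • (am - U x) + η x • (0 - g x)) 2 := by
      refine MemLp.add ?_ ?_
      · exact (hη'.smul (continuous_const.sub hUc)).memLp_of_hasCompactSupport
          (hηc.deriv.smul_right)
      · refine h.memLp_deriv.mono (η.continuous.aestronglyMeasurable.smul
          (aestronglyMeasurable_const.sub h.memLp_deriv.1)) (ae_of_all _ fun x => ?_)
        rw [norm_smul, zero_sub, norm_neg, Real.norm_of_nonneg η.nonneg]
        exact mul_le_of_le_one_left (norm_nonneg _) η.le_one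
    have h1 := D.first_variation_eq_zero h hmin hφ hφc hψ
    -- Moving towards `am` by the fraction `t * η x ≤ 1` stays in `K`, so here no contact set need
    -- be excluded. Against `h1`, this shows that the contact set contributes a nonnegative amount,
    -- whereas `hdir` makes its integrand nonpositive.
    have h2 := D.first_variation_nonneg h hmin hφ hφc hψ MeasurableSet.empty (by simp)
      (fun x _ => by
        filter_upwards [Ioc_mem_nhdsGT (show (0 : ℝ) < 1 from one_pos)] with t ht
        have h3 : t * η x ≤ 1 := mul_le_one₀ ht.2 η.nonneg η.le_one
        have := D.convex (h.mem x) D.minus_mem_K (sub_nonneg.2 h3)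
          (mul_nonneg ht.1.le η.nonneg) (sub_add_cancel 1 (t * η x))
        convert this using 1
        module)
    rw [compl_empty, Measure.restrict_univ] at h2
    set F : ℝ → ℝ := fun x => inner ℝ (gradient W (U x)) (η x • (am - U x)) with hF
    have hFc : Continuous F := ((continuous_gradient D.smooth).comp hUc).inner
      (η.continuous.smul (continuous_const.sub hUc))
    have hFi : Integrable F := hFc.integrable_of_hasCompactSupport (hφc.mono fun x hx => by
      refine fun h0 => hx ?_
      have h0 : η x • (am - U x) = 0 := h0
      simp only [hF]
      rw [h0, inner_zero_right])
    have h3 := integral_add_compl hS hFi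
    have h4 : 0 ≤ ∫ x in U ⁻¹' frontier K, F x := by linarith
    have h5 : ∀ x ∈ U ⁻¹' frontier K, F x ≤ 0 := fun x hx => by
      simp only [hF, inner_smul_right]
      exact mul_nonpos_of_nonneg_of_nonpos η.nonneg (hdir x hx am D.minus_mem_K)
    have h6 : ∫ x in U ⁻¹' frontier K, -F x = 0 := by
      rw [integral_neg]
      linarith [setIntegral_nonpos (μ := volume) hS h5]
    have h7 := (setIntegral_eq_zero_iff_of_nonneg_ae (ae_restrict_of_forall_mem hS fun x hx =>
      neg_nonneg.2 (h5 x hx)) hFi.neg.integrableOn).1 h6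
    rw [EventuallyEq, ae_restrict_iff' hS] at h7
    filter_upwards [h7] with x hx hxn hxf
    have h8 : F x = 0 := neg_eq_zero.1 (hx hxf)
    have h9 : η x = 1 := η.one_of_mem_closedBall hxn
    simpa only [hF, h9, one_smul] using h8
  rw [← ae_all_iff] at hae
  filter_upwards [hae] with x hx hxf
  obtain ⟨n, hn⟩ := exists_nat_ge |x|
  have h0 := hx n (by simp; linarith) hxf
  -- Since `am` is interior to `K`, the point `am` shifted slightly along `∇W(U x)` may be used in
  -- `hdir`; with `h0` this leaves `t * |∇W(U x)|² ≤ 0`.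
  have hev : ∀ᶠ t in 𝓝[>] (0 : ℝ), am + t • gradient W (U x) ∈ K := by
    have hc : Continuous fun t : ℝ => am + t • gradient W (U x) := by fun_prop
    have h1 : Tendsto (fun t : ℝ => am + t • gradient W (U x)) (𝓝[>] 0) (𝓝 am) := by
      have := hc.tendsto 0
      simp only [zero_smul, add_zero] at this
      exact this.mono_left nhdsWithin_le_nhds
    exact h1.eventually (mem_interior_iff_mem_nhds.1 hamint)
  obtain ⟨t, htK, ht⟩ := (hev.and self_mem_nhdsWithin).exists
  have ht : 0 < t := ht
  have h1 := hdir x hxf _ htK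
  rw [add_sub_right_comm, inner_add_right, h0, inner_smul_right, real_inner_self_eq_norm_sq,
    zero_add] at h1
  have h2 : ‖gradient W (U x)‖ ^ 2 ≤ 0 := by
    by_contra hcon
    have := mul_pos ht (not_le.1 hcon)
    linarith
  exact norm_eq_zero.1 (pow_eq_zero_iff two_ne_zero |>.1 (le_antisymm h2 (sq_nonneg _)))

/-- Minimizers solve the Euler-Lagrange equation in the weak sense. -/
lemma isWeakDeriv_gradient (h : IsCompetitor am ap γ K U g)
    (hmin : energyOn W U g univ = minEnergy W am ap γ K) :
    IsWeakDeriv g (fun x => gradient W (U x)) := by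
  have hc : Continuous fun x => gradient W (U x) :=
    (continuous_gradient D.smooth).comp h.deriv.continuous
  refine ⟨h.deriv.loc, hc.locallyIntegrable, fun φ hφ hφc => ?_⟩
  have hφ' : Continuous (deriv φ) := hφ.continuous_deriv (by simp)
  have hS : MeasurableSet (U ⁻¹' frontier K) :=
    (isClosed_frontier.preimage h.deriv.continuous).measurableSet
  have hi1 : Integrable fun x => deriv φ x • g x :=
    h.deriv.loc.integrable_smul_left_of_hasCompactSupport hφ' hφc.deriv
  have hi2 : Integrable fun x => φ x • gradient W (U x) :=
    hc.locallyIntegrable.integrable_smul_left_of_hasCompactSupport hφ.continuous hφc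
  refine ext_inner_left ℝ fun e => ?_
  rw [inner_neg_right, ← integral_inner hi1, ← integral_inner hi2]
  have hd : HasIntDeriv (fun x => φ x • e) (fun x => deriv φ x • e) :=
    HasIntDeriv.of_contDiff (fun x =>
      ((hφ.differentiable (by simp) x).hasDerivAt).smul_const e) (hφ'.smul continuous_const)
  have hψ : MemLp (fun x => deriv φ x • e) 2 :=
    (hφ'.smul continuous_const).memLp_of_hasCompactSupport hφc.deriv.smul_right
  have h1 := D.first_variation_eq_zero h hmin hd hφc.smul_right hψ
  have hi3 : Integrable fun x => inner ℝ (gradient W (U x)) (φ x • e) :=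
    (hc.inner (hφ.continuous.smul continuous_const)).integrable_of_hasCompactSupport
      (hφc.mono fun x hx => by
        contrapose! hx
        simp only [Function.mem_support, not_not] at hx
        simp [hx])
  have h2 : ∫ x in U ⁻¹' frontier K, inner ℝ (gradient W (U x)) (φ x • e) = 0 := by
    refine integral_eq_zero_of_ae ((ae_restrict_iff' hS).2 ?_)
    filter_upwards [D.gradient_eq_zero_on_contact h hmin] with x hx hxf
    rw [hx hxf, inner_zero_left, Pi.zero_apply]
  have h3 := integral_add_compl hS hi3
  have e1 : ∫ x, inner ℝ e (deriv φ x • g x) = ∫ x, inner ℝ (g x) (deriv φ x • e) := by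
    congr 1; funext x
    rw [inner_smul_right, inner_smul_right, real_inner_comm]
  have e2 : ∫ x, inner ℝ e (φ x • gradient W (U x))
      = ∫ x, inner ℝ (gradient W (U x)) (φ x • e) := by
    congr 1; funext x
    rw [inner_smul_right, inner_smul_right, real_inner_comm]
  rw [e1, e2]
  linarith

/-- Minimizers are classical heteroclinic connections. -/
lemma isConnection (h : IsCompetitor am ap γ K U g)
    (hmin : energyOn W U g univ = minEnergy W am ap γ K) : IsConnection W am ap U := by
  have hc : Continuous fun x => gradient W (U x) :=
    (continuous_gradient D.smooth).comp h.deriv.continuous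
  -- Bootstrap: the derivative has a continuous representative `G`, whose own derivative is the
  -- continuous function `∇W(U)`.
  obtain ⟨G, hG, hgG⟩ := (D.isWeakDeriv_gradient h hmin).exists_hasIntDeriv
  have hU := h.deriv.congr_ae hgG
  have hdU : deriv U = G := funext fun x => (hU.hasDerivAt hG.continuous x).deriv
  have hdG : deriv G = fun x => gradient W (U x) := funext fun x => (hG.hasDerivAt hc x).deriv
  refine ⟨?_, fun x => by rw [hdU, hdG], h.tendsto_atBot D.gamma_pos, h.tendsto_atTop D.gamma_pos⟩
  have h1 : ContDiff ℝ 1 G := by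
    rw [contDiff_one_iff_deriv, hdG]
    exact ⟨fun x => (hG.hasDerivAt hc x).differentiableAt, hc⟩
  rw [show (2 : WithTop ℕ∞) = 1 + 1 by norm_num, contDiff_succ_iff_deriv, hdU]
  exact ⟨fun x => (hU.hasDerivAt hG.continuous x).differentiableAt, by simp, h1⟩

end WellData

/-! ### Minimizers visit the wells in order -/

namespace WellData

variable {N : ℕ} {W : Vec N → ℝ} {am ap : Vec N} {α₀ w₀ γ : ℝ} {K : Set (Vec N)}
variable {U g : ℝ → Vec N} (D : WellData W am ap α₀ w₀ γ K)
include D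

/-- Projecting a minimizer to the well of `am` on a half line must not decrease the potential on
an open set. -/
lemma mem_minus_of_le (h : IsCompetitor am ap γ K U g)
    (hmin : energyOn W U g univ = minEnergy W am ap γ K) {β : ℝ} (hβ : β ∈ Icc 0 α₀) {z : ℝ}
    (hz : U z ∈ sublevelComp W β am)
    (hlow : ∀ x ≤ z, U x ∈ sublevelComp W β ap → β ≤ W (U x)) {x : ℝ} (hx : x ≤ z) :
    U x ∈ sublevelComp W β am := by
  by_contra hxn
  have hUc := h.deriv.continuous
  have hCm := isClosed_sublevelComp D.continuous β am
  have hCp := isClosed_sublevelComp D.continuous β ap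
  have ham := D.minus_mem hβ.1
  obtain ⟨P, hPm, hPid, hPlip, -⟩ := exists_convex_projection ⟨am, ham⟩ hCm
    (D.hypA1.convex_minus β hβ)
  obtain ⟨v, hv, hvle⟩ := h.deriv.of_norm_sub_le (V := fun x => P (U x)) fun x y => hPlip _ _
  have hV := hv.glue h.deriv (c := z) (hPid _ hz)
  set V : ℝ → Vec N := fun x => if x ≤ z then P (U x) else U x with hVdef
  set v' : ℝ → Vec N := fun x => if x ≤ z then v x else g x with hv'def
  have hv'le : ∀ᵐ x, ‖v' x‖ ≤ ‖g x‖ := by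
    filter_upwards [hvle] with x hx
    simp only [hv'def]
    split_ifs
    exacts [hx, le_rfl]
  have hcomp : IsCompetitor am ap γ K V v' := by
    refine ⟨hV, ?_, h.memLp_deriv.mono hV.loc.aestronglyMeasurable hv'le, fun x => ?_⟩
    -- The reference function shifted by `z + 1` equals `am` on `(-∞, z]`, which bounds `|am -
    -- Uaff|` there by an `L^γ` function.
    · have h1 : MemLp (fun x => Uaff am ap (x - (z + 1)) - Uaff am ap x) (ENNReal.ofReal γ) :=
        memLp_sub_Uaff ((continuous_Uaff am ap).comp (continuous_sub_right _)) (1 + |z + 1|)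
          (fun x hx => Uaff_of_le am ap (by linarith [neg_abs_le (z + 1)]))
          (fun x hx => Uaff_of_ge am ap (by linarith [le_abs_self (z + 1)])) _
      have h2 : MemLp (fun x => V x - U x) (ENNReal.ofReal γ) := by
        refine ((h.memLp_sub.norm.const_mul 2).add (h1.norm.const_mul 2)).mono'
          (hV.continuous.sub hUc).aestronglyMeasurable (ae_of_all _ fun x => ?_)
        simp only [hVdef, Pi.add_apply]
        split_ifs with hxz
        · rw [Uaff_of_le am ap (show x - (z + 1) ≤ -1 by linarith)]
          have e1 : ‖P (U x) - am‖ ≤ ‖U x - am‖ := by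
            have := hPlip (U x) am
            rwa [hPid am ham] at this
          have e2 : ‖P (U x) - U x‖ ≤ ‖P (U x) - am‖ + ‖U x - am‖ := by
            have := norm_sub_le (P (U x) - am) (U x - am)
            rwa [sub_sub_sub_cancel_right] at this
          have e3 : ‖U x - am‖ ≤ ‖U x - Uaff am ap x‖ + ‖am - Uaff am ap x‖ := by
            have := norm_sub_le (U x - Uaff am ap x) (am - Uaff am ap x)
            rwa [sub_sub_sub_cancel_right] at this
          linarith
        · rw [sub_self, norm_zero]; positivity
      refine (memLp_congr_ae (ae_of_all _ fun x => ?_)).1 (h2.add h.memLp_sub)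
      simp only [Pi.add_apply]; abel
    · simp only [hVdef]
      split_ifs
      exacts [D.minus_subset_K hβ.2 (hPm _), h.mem x]
  have hWle : ∀ x, W (V x) ≤ W (U x) := by
    intro x
    simp only [hVdef]
    split_ifs with hxz
    · by_cases hm : U x ∈ sublevelComp W β am
      · rw [hPid _ hm]
      · refine (sublevelComp_le (hPm (U x))).trans ?_
        by_cases hp : U x ∈ sublevelComp W β ap
        · exact hlow x hxz hp
        · exact (D.lt_of_notMem hβ (h.mem x) hm hp).le
    · exact le_rfl
  set O : Set ℝ := Iio z ∩ U ⁻¹' (sublevelComp W β am)ᶜ ∩ U ⁻¹' (sublevelComp W β ap)ᶜ with hO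
  have hOo : IsOpen O := (isOpen_Iio.inter (hCm.isOpen_compl.preimage hUc)).inter
    (hCp.isOpen_compl.preimage hUc)
  -- Just before the first entry after `x` into the well of `am`, the path is outside this well but,
  -- by closedness and disjointness, not in the other one either.
  have hOne : O.Nonempty := by
    obtain ⟨s, hs, hsm, hsl⟩ := exists_first_mem hUc hCm hx hz
    have hxs : x < s := lt_of_le_of_ne hs.1 fun e => hxn (e ▸ hsm)
    have hev : ∀ᶠ r in 𝓝[<] s, U r ∈ (sublevelComp W β ap)ᶜ :=
      (hUc.continuousAt.eventually_mem (hCp.isOpen_compl.mem_nhds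
        (D.notMem_plus hβ hsm))).filter_mono nhdsWithin_le_nhds
    obtain ⟨r, hr, hrI⟩ := (hev.and (Ico_mem_nhdsLT hxs)).exists
    exact ⟨r, ⟨hrI.2.trans_le hs.2, hsl r hrI⟩, hr⟩
  have hWlt : ∀ x ∈ O, W (V x) < W (U x) := by
    intro x hx
    simp only [hVdef, if_pos (show x ≤ z from le_of_lt hx.1.1)]
    exact (sublevelComp_le (hPm (U x))).trans_lt (D.lt_of_notMem hβ (h.mem x) hx.1.2 hx.2)
  have hlt : energyOn W V v' univ < energyOn W U g univ := by
    rw [energyOn, energyOn, Measure.restrict_univ]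
    refine lintegral_strict_mono_of_ae_le_of_ae_lt_on ?_ ?_ ?_ (hOo.measure_pos volume hOne).ne' ?_
    · exact ENNReal.measurable_ofReal.comp_aemeasurable
        (((h.memLp_deriv.1.norm.pow 2).mul_const 2⁻¹).add
          (D.continuous.comp hUc).aestronglyMeasurable).aemeasurable
    · refine ne_top_of_le_ne_top (b := minEnergy W am ap γ K) D.minEnergy_ne_top ?_
      rw [← hmin, energyOn, Measure.restrict_univ]
      refine lintegral_mono_ae (hv'le.mono fun x hx => ENNReal.ofReal_le_ofReal ?_)
      gcongr
      exact hWle x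
    · refine hv'le.mono fun x hx => ENNReal.ofReal_le_ofReal ?_
      gcongr
      exact hWle x
    · refine hv'le.mono fun x hx hxO => ?_
      have h1 := hWlt x hxO
      have h2 := D.nonneg _ (hcomp.mem x)
      have h3 := pow_le_pow_left₀ (norm_nonneg _) hx 2
      exact (ENNReal.ofReal_lt_ofReal_iff (by linarith [sq_nonneg ‖g x‖])).2 (by linarith)
  exact absurd hcomp.minEnergy_le (not_le.2 (hmin ▸ hlt))

/-- A minimizer does not visit the well of `ap` before the well of `am`. -/
lemma notMem_minus_of_mem_plus (h : IsCompetitor am ap γ K U g)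
    (hmin : energyOn W U g univ = minEnergy W am ap γ K) {y z : ℝ} (hyz : y ≤ z)
    (hy : U y ∈ sublevelComp W α₀ ap) : U z ∉ sublevelComp W α₀ am := by
  intro hz
  have hα : α₀ ∈ Icc 0 α₀ := ⟨D.alpha_pos.le, le_rfl⟩
  have hUc := h.deriv.continuous
  have hCm := isClosed_sublevelComp D.continuous α₀ am
  have hCp := isClosed_sublevelComp D.continuous α₀ ap
  obtain ⟨R, hR⟩ := eventually_atBot.1 ((h.tendsto_atBot D.gamma_pos).eventually
    (sublevelComp_mem_nhds D.continuous (by rw [D.zero_minus]; exact D.alpha_pos)))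
  obtain ⟨R', hR'⟩ := eventually_atTop.1 ((h.tendsto_atTop D.gamma_pos).eventually
    (sublevelComp_mem_nhds D.continuous (by rw [D.zero_plus]; exact D.alpha_pos)))
  -- The pairs of times visited in the wrong order form a compact set, since near `±∞` the path is
  -- in the respective well. A pair with the lowest potential value is taken.
  let S : Set (ℝ × ℝ) := {q | q.1 ≤ q.2} ∩ ((fun q => U q.1) ⁻¹' sublevelComp W α₀ ap) ∩
    ((fun q => U q.2) ⁻¹' sublevelComp W α₀ am)
  have hSc : IsCompact S := by
    refine (isCompact_Icc.prod isCompact_Icc : IsCompact (Icc R R' ×ˢ Icc R R')).of_isClosed_subset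
      (((isClosed_le continuous_fst continuous_snd).inter
        (hCp.preimage (hUc.comp continuous_fst))).inter
        (hCm.preimage (hUc.comp continuous_snd))) ?_
    rintro ⟨a, b⟩ ⟨⟨hab, ha⟩, hb⟩
    have h1 : R ≤ a := le_of_not_ge fun hle => D.notMem_plus hα (hR a hle) ha
    have h2 : b ≤ R' := le_of_not_ge fun hle => D.notMem_plus hα hb (hR' b hle)
    exact ⟨⟨h1, le_trans hab h2⟩, ⟨h1.trans hab, h2⟩⟩
  have hcont : Continuous fun q : ℝ × ℝ => min (W (U q.1)) (W (U q.2)) :=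
    (D.continuous.comp (hUc.comp continuous_fst)).min
      (D.continuous.comp (hUc.comp continuous_snd))
  obtain ⟨⟨a, b⟩, ⟨⟨hab, ha⟩, hb⟩, hmn⟩ := hSc.exists_isMinOn ⟨(y, z), ⟨⟨hyz, hy⟩, hz⟩⟩
    hcont.continuousOn
  have hmn' : ∀ x w, x ≤ w → U x ∈ sublevelComp W α₀ ap → U w ∈ sublevelComp W α₀ am →
      min (W (U a)) (W (U b)) ≤ min (W (U x)) (W (U w)) := fun x w hxw hx hw =>
    hmn (show (x, w) ∈ S from ⟨⟨hxw, hx⟩, hw⟩)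
  rcases le_total (W (U b)) (W (U a)) with hle | hle
  -- At the level `β = W (U b)`, minimality says that earlier visits to the well of `ap` have
  -- potential at least `β`, as the projection argument requires. It then places `U a` in the wrong
  -- well.
  · have hβ : W (U b) ∈ Icc 0 α₀ := ⟨D.nonneg _ (h.mem b), sublevelComp_le hb⟩
    have hbm : U b ∈ sublevelComp W (W (U b)) am :=
      (D.cover _ hβ _ (h.mem b) le_rfl).resolve_right fun h' =>
        D.notMem_plus hα hb (sublevelComp_mono hβ.2 h')
    have := D.mem_minus_of_le h hmin hβ hbm (fun x hx hxp => by
      have h1 := hmn' x b hx (sublevelComp_mono hβ.2 hxp) hb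
      rw [min_eq_right hle] at h1
      exact h1.trans (min_le_left _ _)) hab
    exact D.notMem_plus hα (sublevelComp_mono hβ.2 this) ha
  · have hβ : W (U a) ∈ Icc 0 α₀ := ⟨D.nonneg _ (h.mem a), sublevelComp_le ha⟩
    have hap : U a ∈ sublevelComp W (W (U a)) ap :=
      (D.cover _ hβ _ (h.mem a) le_rfl).resolve_left fun h' =>
        D.notMem_plus hα (sublevelComp_mono hβ.2 h') ha
    have hmin' : energyOn W (fun x => U (-x)) (fun x => -g (-x)) univ
        = minEnergy W ap am γ K := by
      rw [energyOn_comp_neg, preimage_univ, hmin, minEnergy_swap]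
    have := D.swap.mem_minus_of_le h.comp_neg hmin' hβ (z := -a) (by rwa [neg_neg])
      (fun x hx hxm => by
        have h1 := hmn' a (-x) (by linarith) ha (sublevelComp_mono hβ.2 hxm)
        rw [min_eq_left hle] at h1
        exact h1.trans (min_le_right _ _)) (neg_le_neg hab)
    rw [neg_neg] at this
    exact D.notMem_plus hα hb (sublevelComp_mono hβ.2 this)

/-- The ordering of the wells makes the extra hypothesis of `mem_minus_of_le` vacuous. -/
lemma mem_minus_of_mem_minus (h : IsCompetitor am ap γ K U g)
    (hmin : energyOn W U g univ = minEnergy W am ap γ K) {α : ℝ} (hα : α ∈ Icc 0 α₀) {x z : ℝ}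
    (hxz : x ≤ z) (hz : U z ∈ sublevelComp W α am) : U x ∈ sublevelComp W α am :=
  D.mem_minus_of_le h hmin hα hz (fun _ hy hyp => absurd (sublevelComp_mono hα.2 hz)
    (D.notMem_minus_of_mem_plus h hmin hy (sublevelComp_mono hα.2 hyp))) hxz

lemma mem_plus_of_mem_plus (h : IsCompetitor am ap γ K U g)
    (hmin : energyOn W U g univ = minEnergy W am ap γ K) {α : ℝ} (hα : α ∈ Icc 0 α₀) {x y : ℝ}
    (hyx : y ≤ x) (hy : U y ∈ sublevelComp W α ap) : U x ∈ sublevelComp W α ap := by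
  have hmin' : energyOn W (fun x => U (-x)) (fun x => -g (-x)) univ
      = minEnergy W ap am γ K := by
    rw [energyOn_comp_neg, preimage_univ, hmin, minEnergy_swap]
  have := D.swap.mem_minus_of_mem_minus h.comp_neg hmin' hα (neg_le_neg hyx) (by rwa [neg_neg])
  rwa [neg_neg] at this

end WellData

/-! ### Equipartition and decay estimates -/

namespace WellData

variable {N : ℕ} {W : Vec N → ℝ} {am ap : Vec N} {α₀ w₀ γ : ℝ} {K : Set (Vec N)}
variable {U g : ℝ → Vec N} (D : WellData W am ap α₀ w₀ γ K)
include D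

lemma Mconst_pos : 0 < Mconst W am ap := by
  have h1 : 0 < minEnergy W am ap γ K := pos_iff_ne_zero.2 D.minEnergy_ne_zero
  exact ENNReal.ofReal_pos.1 (h1.trans_le D.minEnergy_le_Mconst)

/-- Equipartition of energy. -/
lemma half_norm_deriv_sq (h : IsCompetitor am ap γ K U g)
    (hE : energyOn W U g univ ≠ ⊤) (hC : IsConnection W am ap U) (x : ℝ) :
    ‖deriv U x‖ ^ 2 / 2 = W (U x) := by
  have h1 : ContDiff ℝ 1 (deriv U) := by
    have := hC.1
    rw [show (2 : WithTop ℕ∞) = 1 + 1 by norm_num, contDiff_succ_iff_deriv] at this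
    exact this.2.2
  have hd : ∀ x, HasDerivAt U (deriv U x) x := fun x =>
    (hC.1.differentiable (by norm_num) x).hasDerivAt
  have hd2 : ∀ x, HasDerivAt (deriv U) (gradient W (U x)) x := fun x => by
    rw [← hC.2.1 x]
    exact (h1.differentiable (by norm_num) x).hasDerivAt
  set H : ℝ → ℝ := fun x => ‖deriv U x‖ ^ 2 / 2 - W (U x) with hH
  have hH0 : ∀ x, HasDerivAt H 0 x := by
    intro x
    have e1 := ((hd2 x).norm_sq).div_const 2
    have e2 := (D.smooth.differentiable (by norm_num) (U x)).hasGradientAt.hasFDerivAt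
      |>.comp_hasDerivAt x (hd x)
    refine (e1.sub e2).congr_deriv ?_
    rw [InnerProductSpace.toDual_apply_apply, real_inner_comm]
    ring
  have hconst : ∀ y, H y = H x := fun y =>
    is_const_of_deriv_eq_zero (fun z => (hH0 z).differentiableAt) (fun z => (hH0 z).deriv) y x
  have hae : g =ᵐ[volume] deriv U :=
    h.deriv.ae_unique (HasIntDeriv.of_contDiff hd h1.continuous)
  -- The conserved quantity is dominated by the integrable energy density, and a constant integrable
  -- on the line is zero.
  have hi : Integrable fun _ : ℝ => H x := by
    refine (D.integrable_energy h hE).mono' aestronglyMeasurable_const ?_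
    filter_upwards [hae] with y hy
    rw [← hconst y, hy]
    simp only [hH, Real.norm_eq_abs]
    refine (abs_sub _ _).trans (le_of_eq ?_)
    rw [abs_of_nonneg (by positivity), abs_of_nonneg (D.nonneg _ (h.mem y))]
  rcases integrable_const_iff.1 hi with h0 | h0
  · exact sub_eq_zero.1 h0
  · exact absurd h0.measure_univ_lt_top (by simp)

/-- A minimizer spends little time at high levels of the potential. -/
lemma mul_lt_Mconst (h : IsCompetitor am ap γ K U g)
    (hmin : energyOn W U g univ = minEnergy W am ap γ K) (hC : IsConnection W am ap U)
    {α a b : ℝ} (hα : 0 ≤ α) (hlow : ∀ x ∈ Ioo a b, α ≤ W (U x)) :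
    α * (b - a) < Mconst W am ap := by
  have hM := D.Mconst_pos
  have hE : energyOn W U g univ ≠ ⊤ := hmin ▸ D.minEnergy_ne_top
  have hd : HasIntDeriv U (deriv U) := HasIntDeriv.of_contDiff
    (fun x => (hC.1.differentiable (by norm_num) x).hasDerivAt)
    (hC.1.continuous_deriv (by norm_num))
  -- Equipartition makes the density `2W ≥ 2α`; this factor two yields the strict inequality since
  -- `M > 0`.
  have h1 : ENNReal.ofReal (2 * (α * (b - a))) ≤ ENNReal.ofReal (Mconst W am ap) := by
    calc ENNReal.ofReal (2 * (α * (b - a)))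
        = ∫⁻ _ in Ioo a b, ENNReal.ofReal (2 * α) := by
          rw [setLIntegral_const, Real.volume_Ioo, ← ENNReal.ofReal_mul (by positivity), mul_assoc]
      _ ≤ energyOn W U (deriv U) (Ioo a b) := by
          refine setLIntegral_mono' measurableSet_Ioo fun x hx => ENNReal.ofReal_le_ofReal ?_
          rw [D.half_norm_deriv_sq h hE hC x]
          linarith [hlow x hx]
      _ ≤ energyOn W U (deriv U) univ := energyOn_mono (subset_univ _)
      _ = minEnergy W am ap γ K := by rw [energyOn_congr_ae (hd.ae_unique h.deriv), hmin]
      _ ≤ ENNReal.ofReal (Mconst W am ap) := D.minEnergy_le_Mconst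
  rw [ENNReal.ofReal_le_ofReal_iff hM.le] at h1
  linarith

/-- After a suitable translation, a minimizer is in the low wells outside short intervals. -/
lemma exists_time_split (h : IsCompetitor am ap γ K U g)
    (hmin : energyOn W U g univ = minEnergy W am ap γ K) (hC : IsConnection W am ap U) :
    ∃ t : ℝ, ∀ α ∈ Ioc 0 α₀, (∀ x, t + Mconst W am ap / α ≤ x → U x ∈ sublevelComp W α ap) ∧
      ∀ x, x ≤ t - Mconst W am ap / α → U x ∈ sublevelComp W α am := by
  have hM := D.Mconst_pos
  have hα₀ : α₀ ∈ Icc 0 α₀ := ⟨D.alpha_pos.le, le_rfl⟩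
  have hUc := h.deriv.continuous
  obtain ⟨R, hR⟩ := eventually_atBot.1 ((h.tendsto_atBot D.gamma_pos).eventually
    (sublevelComp_mem_nhds D.continuous (by rw [D.zero_minus]; exact D.alpha_pos)))
  obtain ⟨R', hR'⟩ := eventually_atTop.1 ((h.tendsto_atTop D.gamma_pos).eventually
    (sublevelComp_mem_nhds D.continuous (by rw [D.zero_plus]; exact D.alpha_pos)))
  have hRR' : R ≤ R' := le_of_not_ge fun hle =>
    D.notMem_plus hα₀ (hR R le_rfl) (hR' R hle)
  -- The last visit to the well of `am` at the top level `α₀` is independent of `α`, so one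
  -- translation serves all levels.
  obtain ⟨t, ht, htm, htn⟩ := exists_last_mem hUc (isClosed_sublevelComp D.continuous α₀ am)
    hRR' (hR R le_rfl)
  have htn' : ∀ r, t < r → U r ∉ sublevelComp W α₀ am := fun r hr hrm => by
    rcases le_total r R' with hle | hle
    exacts [htn r ⟨hr, hle⟩ hrm, D.notMem_plus hα₀ hrm (hR' r hle)]
  refine ⟨t, fun α hα => ⟨fun x hx => ?_, fun x hx => ?_⟩⟩
  · by_contra hxn
    have hα' : α ∈ Icc 0 α₀ := ⟨hα.1.le, hα.2⟩
    have hq : 0 < Mconst W am ap / α := div_pos hM hα.1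
    -- Between `t` and `x` the path is in neither well at level `α`: `t` was the last visit to one,
    -- and entering the other would be permanent.
    have h1 := D.mul_lt_Mconst h hmin hC hα.1.le (a := t) (b := x) fun r hr =>
      (D.lt_of_notMem hα' (h.mem r) (fun hrm => htn' r hr.1 (sublevelComp_mono hα.2 hrm))
        (fun hrp => hxn (D.mem_plus_of_mem_plus h hmin hα' hr.2.le hrp))).le
    have h2 : Mconst W am ap / α ≤ x - t := by linarith
    rw [div_le_iff₀ hα.1] at h2
    linarith
  · by_contra hxn
    have hα' : α ∈ Icc 0 α₀ := ⟨hα.1.le, hα.2⟩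
    have hq : 0 < Mconst W am ap / α := div_pos hM hα.1
    have h1 := D.mul_lt_Mconst h hmin hC hα.1.le (a := x) (b := t) fun r hr =>
      (D.lt_of_notMem hα' (h.mem r)
        (fun hrm => hxn (D.mem_minus_of_mem_minus h hmin hα' hr.1.le hrm))
        (fun hrp => D.notMem_minus_of_mem_plus h hmin hr.2.le (sublevelComp_mono hα.2 hrp)
          htm)).le
    have h2 : Mconst W am ap / α ≤ t - x := by linarith
    rw [div_le_iff₀ hα.1] at h2
    linarith

/-- For each `x` the level is chosen as `α = M / |x|`; the requirement `α ≤ α₀` is exactly `|x| ≥ M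
/ α₀`. Growth of `W` bounds the distance to the well, and equipartition bounds the derivative. -/
lemma exists_hasDecay (h : IsCompetitor am ap γ K U g)
    (hmin : energyOn W U g univ = minEnergy W am ap γ K) (hC : IsConnection W am ap U) :
    ∃ t : ℝ, HasDecay W am ap α₀ w₀ γ (shiftRight U t) := by
  have hM := D.Mconst_pos
  have hw := D.hypA1.w_pos
  have hE : energyOn W U g univ ≠ ⊤ := hmin ▸ D.minEnergy_ne_top
  obtain ⟨t, ht⟩ := D.exists_time_split h hmin hC
  refine ⟨-t, fun x hx => ?_⟩
  have hx0 : 0 < |x| := (div_pos hM D.alpha_pos).trans_le hx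
  set α := Mconst W am ap / |x| with hαdef
  have hα : α ∈ Ioc 0 α₀ := ⟨div_pos hM hx0, by
    rw [hαdef, div_le_iff₀ hx0]
    rwa [div_le_iff₀' D.alpha_pos] at hx⟩
  have hMα : Mconst W am ap / α = |x| := by rw [hαdef]; field_simp
  have hα' : α ∈ Icc 0 α₀ := ⟨hα.1.le, hα.2⟩
  have hrate : (α / w₀) ^ (1 / γ) = (Mconst W am ap / w₀) ^ (1 / γ) * |x| ^ (-(1 / γ)) := by
    rw [show α / w₀ = Mconst W am ap / w₀ * |x|⁻¹ by rw [hαdef]; field_simp,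
      Real.mul_rpow (by positivity) (by positivity), Real.inv_rpow hx0.le, Real.rpow_neg hx0.le]
  obtain ⟨hp, hm⟩ := ht α hα
  rw [hMα] at hp hm
  have hpos : 0 < x → U (x + t) ∈ sublevelComp W α ap := fun h0 =>
    hp _ (by rw [abs_of_pos h0]; linarith)
  have hneg : x < 0 → U (x + t) ∈ sublevelComp W α am := fun h0 =>
    hm _ (by rw [abs_of_neg h0]; linarith)
  have hWα : W (U (x + t)) ≤ α := by
    rcases lt_or_gt_of_ne (abs_pos.1 hx0) with h0 | h0
    exacts [sublevelComp_le (hneg h0), sublevelComp_le (hpos h0)]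
  simp only [shiftRight, sub_neg_eq_add]
  refine ⟨fun h0 => ?_, fun h0 => ?_, ?_⟩
  · rw [← hrate]
    exact D.swap.norm_sub_minus_le hα' (hpos h0)
  · rw [← hrate]
    exact D.norm_sub_minus_le hα' (hneg h0)
  · have hdx : deriv (shiftRight U (-t)) x = deriv U (x + t) := by
      rw [← sub_neg_eq_add]
      exact deriv_comp_sub_const U (-t) x
    rw [hdx, Real.rpow_neg hx0.le, ← Real.inv_rpow hx0.le,
      ← Real.mul_rpow (by positivity) (by positivity), ← Real.sqrt_eq_rpow]
    refine Real.le_sqrt_of_sq_le ?_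
    have h1 := D.half_norm_deriv_sq h hE hC (x + t)
    rw [show 2 * Mconst W am ap * |x|⁻¹ = 2 * α by rw [hαdef]; ring]
    linarith

end WellData

/-! ### Translation of weak limits and conclusion -/

/-- Needed because the decay estimate holds only after a further translation of the limit; the
translation is moved to the test functions. -/
lemma TendstoWeakly.shiftRight {N : ℕ} {am ap : Vec N} {γ : ℝ} {V : ℕ → ℝ → Vec N} {U : ℝ → Vec N}
    (h : TendstoWeakly am ap γ V U) (t : ℝ) :
    TendstoWeakly am ap γ (fun i => shiftRight (V i) t) (shiftRight U t) := by
  have hmem : ∀ {V : ℝ → Vec N}, V ∈ affSobolev am ap γ 2 →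
      V ∈ competitors am ap γ univ := fun hV => ⟨hV, fun _ => trivial⟩
  have hd : ∀ {V : ℝ → Vec N}, V ∈ affSobolev am ap γ 2 →
      weakDeriv (_root_.shiftRight V t) =ᵐ[volume] fun x => weakDeriv V (x - t) := fun hV =>
    ((IsCompetitor.of_mem (hmem hV)).comp_sub_right t).deriv.weakDeriv_ae
  have hs : ∀ {V : ℝ → Vec N}, V ∈ affSobolev am ap γ 2 →
      _root_.shiftRight V t ∈ affSobolev am ap γ 2 := fun hV =>
    (((IsCompetitor.of_mem (hmem hV)).comp_sub_right t).mem_competitors).1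
  have htest : ∀ {φ : ℝ → Vec N} {p : ENNReal}, MemLp φ p → MemLp (fun x => φ (x + t)) p :=
    fun hφ => hφ.comp_measurePreserving (measurePreserving_add_right volume t)
  refine ⟨fun i => hs (h.1 i), hs h.2.1, fun φ hφ => ?_, fun ψ hψ => ?_⟩
  · refine (h.2.2.1 _ (htest hφ)).congr fun i => ?_
    rw [← integral_sub_right_eq_self _ t]
    simp only [_root_.shiftRight, sub_add_cancel]
  · refine (h.2.2.2 _ (htest hψ)).congr fun i => ?_
    rw [← integral_sub_right_eq_self _ t]
    refine integral_congr_ae ?_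
    filter_upwards [hd (h.1 i), hd h.2.1] with x h1 h2
    rw [h1, h2, sub_add_cancel]

theorem theorem1 {N : ℕ} (W : Vec N → ℝ) (am ap : Vec N) (α₀ w₀ γ : ℝ)
    (hW : ContDiff ℝ 2 W)
    (hm_min : IsLocalMin W am) (hp_min : IsLocalMin W ap)
    (hm_zero : W am = 0) (hp_zero : W ap = 0)
    (hA1 : HypA1 W am ap α₀ w₀ γ)
    (K : Set (Vec N))
    (hA2 : (HypCoercive W am ap α₀ ∧ K = Set.univ) ∨
      (∃ (Ω : Set (Vec N)) (wmax : ℝ), HypLocalized W am ap α₀ Ω wmax ∧ K = closure Ω)) :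
    (∃ U : ℕ → ℝ → Vec N, IsMinimizingSeq W am ap γ K U ∧ ∀ i, 0 ≤ action W (U i)) ∧
    (∀ U : ℕ → ℝ → Vec N, IsMinimizingSeq W am ap γ K U → (∀ i, 0 ≤ action W (U i)) →
      ∃ (s : ℕ → ℝ) (σ : ℕ → ℕ) (V : ℝ → Vec N), StrictMono σ ∧
        TendstoWeakly am ap γ (fun i => shiftRight (U (σ i)) (s (σ i))) V ∧
        IsMinimizer W am ap γ K V ∧ IsConnection W am ap V ∧
        HasDecay W am ap α₀ w₀ γ V) ∧
    (∀ U : ℝ → Vec N, IsMinimizer W am ap γ K U → IsConnection W am ap U →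
      action W U ≤ ((Mconst W am ap : ℝ) : EReal) ∧
      ∃ t : ℝ, HasDecay W am ap α₀ w₀ γ (shiftRight U t)) := by
  have D : WellData W am ap α₀ w₀ γ K := by
    rcases hA2 with ⟨h, rfl⟩ | ⟨Ω, wmax, h, rfl⟩
    exacts [.of_coercive hW hm_zero hp_zero hA1 h, .of_localized hW hm_zero hp_zero hA1 h]
  have hact : ∀ {U}, U ∈ competitors am ap γ K →
      action W U = (energyOn W U (weakDeriv U) univ : EReal) := fun hU =>
    (IsCompetitor.of_mem hU).action_eq D.nonneg
  have hne : (action W '' competitors am ap γ K).Nonempty :=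
    ⟨_, _, (isCompetitor_ramp D.convex D.minus_mem_K D.swap.minus_mem_K
      one_pos).mem_competitors, rfl⟩
  refine ⟨?_, fun U hU _ => ?_, fun U hU hC => ?_⟩
  · obtain ⟨u, -, hu, hmem⟩ := exists_seq_tendsto_sInf hne (OrderBot.bddBelow _)
    choose U hU hUu using hmem
    refine ⟨U, ⟨hU, by simpa only [hUu] using hu⟩, fun i => ?_⟩
    rw [hact (hU i)]
    exact EReal.coe_ennreal_nonneg _
  · obtain ⟨s, σ, V, v, hσ, hV, hVmin, hweak⟩ := D.exists_limit
      (fun i => IsCompetitor.of_mem (hU.1 i)) (by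
        have h1 := hU.2
        simp only [hact (hU.1 _), sInf_action_eq D.nonneg] at h1
        exact EReal.tendsto_coe_ennreal.1 h1)
    obtain ⟨t, ht⟩ := D.exists_hasDecay hV hVmin (D.isConnection hV hVmin)
    have hVt := hV.comp_sub_right t
    have hVtmin : energyOn W (shiftRight V t) (fun x => v (x - t)) univ = minEnergy W am ap γ K :=
      (energyOn_comp_sub_right t).trans hVmin
    -- The centering shifts are corrected by the fixed shift `t` that normalizes the limit for the
    -- decay estimate.
    refine ⟨fun i => s i + t, σ, shiftRight V t, hσ, ?_, ⟨hVt.mem_competitors, ?_⟩,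
      D.isConnection hVt hVtmin, ht⟩
    · have e : ∀ i, shiftRight (U (σ i)) (s (σ i) + t)
          = shiftRight (shiftRight (U (σ i)) (s (σ i))) t := fun i => by
        funext x
        simp only [shiftRight]
        congr 1; ring
      simpa only [e] using hweak.shiftRight t
    · rw [sInf_action_eq D.nonneg, ← hVtmin]
      exact hVt.action_eq D.nonneg
  · have hUmin : energyOn W U (weakDeriv U) univ = minEnergy W am ap γ K := by
      have h1 := hU.2
      rw [hact hU.1, sInf_action_eq D.nonneg] at h1
      exact EReal.coe_ennreal_injective h1
    refine ⟨?_, D.exists_hasDecay (IsCompetitor.of_mem hU.1) hUmin hC⟩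
    -- The coercion of `ENNReal.ofReal M` to `EReal` is `max M 0`, so `M` is first written in that
    -- form.
    rw [hU.2, sInf_action_eq D.nonneg, ← max_eq_left D.Mconst_pos.le, ← EReal.coe_ennreal_ofReal]
    exact EReal.coe_ennreal_le_coe_ennreal_iff.2 D.minEnergy_le_Mconst
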